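/- **Setting.** Let $E_j=i\lambda_j/\sqrt2$ ($\lambda_1,\dots,\lambda_8$ the Gell-Mann matrices) be the orthonormal basis of $\mathfrak{su}(3)$ for $\langle X|Y\rangle=\mathrm{tr}(X^\dagger Y)$, with coordinates $x_1,\dots,x_8$ and structure constants $[E_k,E_j]=\sum_l c_{kj}^lE_l$. The space $Poly(\mathfrak{su}(3))$ of complex polynomials on $\mathfrak{su}(3)$ carries the Poisson bracket $\{F,G\}=\sum_{j,k,l}c^l_{kj}\,x_l\,\partial_jF\,\partial_kG$. Dominant weights are the matrices $p\varpi_1+q\varpi_2$ ($p,q\in\mathbb N_0$), where $\varpi_1=\tfrac1{\sqrt2}E_3+\tfrac1{\sqrt6}E_8$ and $\varpi_2=\sqrt{\tfrac23}E_8$; a weight $\omega$ is identified with the functional $H\mapsto\mathrm{tr}(H(-i\omega))$ on diagonal traceless matrices. Let $\overline{\mathcal Q}$ be the set of $\xi=\sqrt{3/2}\,(x\varpi_1+y\varpi_2)$ with $x,y\ge0$, $x^2+xy+y^2=1$, such that $R\xi$ is a dominant weight for some $R>0$. For $\xi\in\overline{\mathcal Q}$ let $r(\xi)=\min\{R>0: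 R\xi\text{ is a dominant weight}\}$ and $\omega_\xi=r(\xi)\xi$, let $\mathcal O_\xi=\{g\xi g^{-1}:g\in SU(3)\}$ and let $Poly(\mathcal O_\xi)$ be the algebra of restrictions to $\mathcal O_\xi$ of polynomials on $\mathfrak{su}(3)$, with the supremum norm and the Poisson bracket $\{F|_{\mathcal O_\xi},G|_{\mathcal O_\xi}\}=\{F,G\}|_{\mathcal O_\xi}$. *Correspondences.* Let $\mathcal H_\omega$ be a unitary irreducible representation of $SU(3)$ with highest weight $\omega$, and $\rho_\omega:U(\mathfrak{sl}(3))\to\mathcal B(\mathcal H_\omega)$ the induced representation. A symbol correspondence is an injective linear map $W:\mathcal B(\mathcal H_\omega)\to Poly(\mathcal O_\xi)$ that is $SU(3)$-equivariant, real ($W_{A^\dagger}=\overline{W_A}$) and normalized ($\int_{\mathcal O_\xi}W_A=\mathrm{tr}(A)/\dim\mathcal H_\omega$ for the invariant probability measure). A $\xi$-ray of universal correspondences is a sequence of maps $w^s_\xi=W^s\circ\rho_{s\omega_\xi}:U(\mathfrak{sl}(3))\to Poly(\mathcal O_\xi)$, $s=1,2,\dots$, with $W^s$ a symbol correspondence for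 $\mathcal H_{s\omega_\xi}$. It induces on the image of $w^s_\xi$ the twisted product $w^s_\xi[u]\star^s_\xi w^s_\xi[v]=w^s_\xi[uv]$; every $f\in Poly(\mathcal O_\xi)$ lies in this image for all large $s$. The ray is of *Poisson type* if, for all $f_1,f_2\in Poly(\mathcal O_\xi)$, uniformly on $\mathcal O_\xi$ as $s\to\infty$, $$f_1\star^s_\xi f_2\to f_1f_2,\qquad s\,r(\xi)\,\big(f_1\star^s_\xi f_2-f_2\star^s_\xi f_1\big)\to i\{f_1,f_2\}.$$ *Degree and $\beta_d$.* Let $(e_1,\dots,e_8)=(T_-,-U_-,V_-,-T_+,U_+,V_+,-\sqrt2\,U_3,\sqrt{2/3}\,(2T_3+U_3))$ be the ordered basis of $\mathfrak{sl}(3)$, where $T_+,U_+,V_+$ are the matrix units $E_{12},E_{23},E_{13}$, $T_-,U_-,V_-$ their transposes, $T_3=\frac12\mathrm{diag}(1,-1,0)$ and $U_3=\frac12\mathrm{diag}(0,1,-1)$. By the Poincaré–Birkhoff–Witt theorem the ordered monomials $e_{j_1}\cdots e_{j_d}$, $j_1\le\dots\le j_d$, $d\ge0$, form a basis of $U(\mathfrak{sl}(3))$;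 let $U_d$ be the span of those of length $d$, $\pi_d$ the projection onto $U_d$, $\deg u$ the least $d$ with $u\in U_0\oplus\dots\oplus U_d$, $\beta:U(\mathfrak{sl}(3))\to Poly(\mathfrak{sl}(3))\equiv Poly(\mathfrak{su}(3))$ the linear map with $\beta[e_{j_1}\cdots e_{j_d}](X)=\mathrm{tr}(e_{j_1}X)\cdots\mathrm{tr}(e_{j_d}X)$ on ordered monomials, and $\beta_d[u]=\beta[\pi_d(u)]$. **Theorem.** Let $\xi\in\overline{\mathcal Q}$ and let $(w^s_\xi)_{s\ge1}$ be a $\xi$-ray of universal correspondences. Then $(w^s_\xi)$ is of Poisson type if and only if $$\lim_{s\to\infty}(s\,r(\xi))^{-\deg u}\,w^s_\xi[u]=(-i)^{\deg u}\,\beta_{\deg u}[u]\big|_{\mathcal O_\xi}\quad\text{uniformly on }\mathcal O_\xi,\ \text{ for every }u\in U(\mathfrak{sl}(3)).$$ -/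

import Mathlib

open Matrix Filter Topology

attribute [local instance 100] LieRing.ofAssociativeRing

noncomputable section

/-! ## The group `SU(3)`, the Lie algebras `su(3) ⊂ sl(3)`, bases -/

/-- Complex `3 × 3` matrices. -/
abbrev Mat3 : Type := Matrix (Fin 3) (Fin 3) ℂ

/-- The group `SU(3)`. -/
abbrev SU3 : Type := Matrix.specialUnitaryGroup (Fin 3) ℂ

/-- The complex Lie algebra `sl(3)` of traceless matrices. -/
abbrev SL3Lie : LieSubalgebra ℂ Mat3 := LieAlgebra.SpecialLinear.sl (Fin 3) ℂ

/-- The universal enveloping algebra `U(sl(3))`. -/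
abbrev USL3 : Type := UniversalEnvelopingAlgebra ℂ SL3Lie

instance SU3.instIsTopologicalGroup : IsTopologicalGroup SU3 where
  continuous_inv := by
    have h : Continuous fun g : SU3 => (star (g : Mat3) : Mat3) :=
      continuous_star.comp continuous_subtype_val
    exact Continuous.subtype_mk h _

instance SU3.instCompactSpace : CompactSpace SU3 := by
  suffices h : IsCompact (Matrix.specialUnitaryGroup (Fin 3) ℂ : Set Mat3) from
    isCompact_iff_compactSpace.mp h
  have hc : IsCompact (Set.pi Set.univ fun _ : Fin 3 => Set.pi Set.univ fun _ : Fin 3 =>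
      Metric.closedBall (0 : ℂ) 1) :=
    isCompact_univ_pi fun _ => isCompact_univ_pi fun _ => isCompact_closedBall 0 1
  refine IsCompact.of_isClosed_subset hc ?_ ?_
  · have h1 : IsClosed {A : Mat3 | star A * A = 1} :=
      isClosed_eq (by fun_prop) continuous_const
    have h2 : IsClosed {A : Mat3 | A * star A = 1} :=
      isClosed_eq (by fun_prop) continuous_const
    have h3 : IsClosed {A : Mat3 | A.det = 1} :=
      isClosed_eq (Continuous.matrix_det continuous_id) continuous_const
    have : (Matrix.specialUnitaryGroup (Fin 3) ℂ : Set Mat3) =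
        ({A : Mat3 | star A * A = 1} ∩ {A : Mat3 | A * star A = 1}) ∩ {A : Mat3 | A.det = 1} := by
      ext A
      rfl
    rw [this]
    exact (h1.inter h2).inter h3
  · intro A hA i _ j _
    have h := entry_norm_bound_of_unitary (Matrix.specialUnitaryGroup_le_unitaryGroup hA) i j
    simpa using h

instance SU3.instMeasurableSpace : MeasurableSpace SU3 := borel SU3

instance SU3.instBorelSpace : BorelSpace SU3 := ⟨rfl⟩

/-- The normalized (total mass one) Haar measure of `SU(3)`. -/
def haarSU3 : MeasureTheory.Measure SU3 := MeasureTheory.Measure.haarMeasure ⊤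

/-- The Gell-Mann matrices `λ₁, …, λ₈` (indexed by `0, …, 7`). -/
def gellMann : Fin 8 → Mat3 :=
  ![!![0, 1, 0; 1, 0, 0; 0, 0, 0],
    !![0, -Complex.I, 0; Complex.I, 0, 0; 0, 0, 0],
    !![1, 0, 0; 0, -1, 0; 0, 0, 0],
    !![0, 0, 1; 0, 0, 0; 1, 0, 0],
    !![0, 0, -Complex.I; 0, 0, 0; Complex.I, 0, 0],
    !![0, 0, 0; 0, 0, 1; 0, 1, 0],
    !![0, 0, 0; 0, 0, -Complex.I; 0, Complex.I, 0],
    ((1 / Real.sqrt 3 : ℝ) : ℂ) • !![1, 0, 0; 0, 1, 0; 0, 0, -2]]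

/-- The orthonormal basis `E_j = i λ_j / √2` of `su(3)`, for the inner product `tr (X† Y)`. -/
def suBasis (j : Fin 8) : Mat3 := (Complex.I / ((Real.sqrt 2 : ℝ) : ℂ)) • gellMann j

/-- The coordinate `x_j(X) = tr (E_j† X)` with respect to the basis `E_1, …, E_8`. -/
def suCoord (X : Mat3) (j : Fin 8) : ℂ := ((suBasis j)ᴴ * X).trace

/-- The matrices of the ordered basis `e_1, …, e_8` of `sl(3)`:
`T₋, -U₋, V₋, -T₊, U₊, V₊, -√2 U₃, √(2/3) (2 T₃ + U₃)`. -/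
def gtMatrix : Fin 8 → Mat3 :=
  ![!![0, 0, 0; 1, 0, 0; 0, 0, 0],
    !![0, 0, 0; 0, 0, 0; 0, -1, 0],
    !![0, 0, 0; 0, 0, 0; 1, 0, 0],
    !![0, -1, 0; 0, 0, 0; 0, 0, 0],
    !![0, 0, 0; 0, 0, 1; 0, 0, 0],
    !![0, 0, 1; 0, 0, 0; 0, 0, 0],
    ((Real.sqrt 2 : ℝ) : ℂ) • !![0, 0, 0; 0, -1 / 2, 0; 0, 0, 1 / 2],
    ((Real.sqrt (2 / 3) : ℝ) : ℂ) • !![1, 0, 0; 0, -1 / 2, 0; 0, 0, -1 / 2]]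

/-- The ordered basis `e_1, …, e_8` as elements of `sl(3)`. -/
def gtBasis (j : Fin 8) : SL3Lie :=
  ⟨gtMatrix j, by
    change (gtMatrix j).trace = 0
    fin_cases j <;> simp [gtMatrix, Matrix.trace_fin_three] <;> ring⟩

/-! ## Dominant weights and rational orbits -/

/-- The fundamental weight `ϖ₁ = E₃ / √2 + E₈ / √6`. -/
def fundWeight₁ : Mat3 :=
  (1 / Real.sqrt 2 : ℝ) • suBasis 2 + (1 / Real.sqrt 6 : ℝ) • suBasis 7

/-- The fundamental weight `ϖ₂ = √(2/3) E₈`. -/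
def fundWeight₂ : Mat3 := (Real.sqrt (2 / 3) : ℝ) • suBasis 7

/-- Dominant weights `p ϖ₁ + q ϖ₂`, `p, q ∈ ℕ₀`. -/
def IsDominantWeight (ω : Mat3) : Prop :=
  ∃ p q : ℕ, ω = (p : ℝ) • fundWeight₁ + (q : ℝ) • fundWeight₂

/-- The intersection of the unit sphere of `su(3)` with the closed principal Weyl chamber: the
points `√(3/2) (x ϖ₁ + y ϖ₂)` with `x, y ≥ 0` and `x² + x y + y² = 1`. -/
def unitChamber : Set Mat3 :=
  {ξ | ∃ x y : ℝ, 0 ≤ x ∧ 0 ≤ y ∧ x ^ 2 + x * y + y ^ 2 = 1 ∧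
    ξ = Real.sqrt (3 / 2) • (x • fundWeight₁ + y • fundWeight₂)}

/-- The points of the unit chamber whose adjoint orbit is rational, i.e. a rescaling of the orbit
of a dominant weight. -/
def rationalPoints : Set Mat3 :=
  {ξ ∈ unitChamber | ∃ R : ℝ, 0 < R ∧ IsDominantWeight (R • ξ)}

/-- The integral radius `r(ξ) = min {R > 0 : R ξ is a dominant weight}`. -/
def integralRadius (ξ : Mat3) : ℝ := sInf {R : ℝ | 0 < R ∧ IsDominantWeight (R • ξ)}

/-- The first dominant weight `ω_ξ = r(ξ) ξ`. -/
def firstDominantWeight (ξ : Mat3) : Mat3 := integralRadius ξ • ξ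

/-! ## Adjoint orbits and polynomials on them -/

/-- The adjoint action `Ad_g X = g X g⁻¹`. -/
def adMat (g : SU3) (X : Mat3) : Mat3 := (g : Mat3) * X * ((g⁻¹ : SU3) : Mat3)

/-- The adjoint orbit `O_ξ`. -/
def adOrbit (ξ : Mat3) : Set Mat3 := Set.range fun g : SU3 => adMat g ξ

/-- The action of `SU(3)` on the orbit `O_ξ`. -/
def adOn {ξ : Mat3} (g : SU3) (x : adOrbit ξ) : adOrbit ξ :=
  ⟨adMat g x, by
    obtain ⟨h, hh⟩ := x.2
    refine ⟨g * h, ?_⟩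
    simp only [← hh, adMat, _root_.mul_inv_rev, Submonoid.coe_mul, mul_assoc]⟩

/-- The base point `ξ` of `O_ξ`. -/
def basePoint (ξ : Mat3) : adOrbit ξ := ⟨ξ, 1, by simp [adMat]⟩

/-- Complex polynomials on `su(3)` (equivalently on `sl(3)`), written in the linear coordinates
`x_1, …, x_8` of the basis `E_1, …, E_8`. -/
abbrev PolySU3 : Type := MvPolynomial (Fin 8) ℂ

/-- Restriction of polynomials to the orbit `O_ξ`. -/
def restrictPoly (ξ : Mat3) : PolySU3 →ₐ[ℂ] (adOrbit ξ → ℂ) :=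
  MvPolynomial.aeval fun j (x : adOrbit ξ) => suCoord x j

/-- The algebra `Poly(O_ξ)` of restrictions to `O_ξ` of polynomials on `su(3)`. -/
def PolyOrbit (ξ : Mat3) : Subalgebra ℂ (adOrbit ξ → ℂ) := (restrictPoly ξ).range

/-- The restriction of a polynomial, as an element of `Poly(O_ξ)`. -/
def resOrbit (ξ : Mat3) (F : PolySU3) : PolyOrbit ξ := ⟨restrictPoly ξ F, F, rfl⟩

/-- The structure constants: `[E_k, E_j] = ∑ l, c^l_{kj} E_l`. -/
def structConst (k j l : Fin 8) : ℂ := suCoord ⁅suBasis k, suBasis j⁆ l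

/-- The Poisson bracket of polynomials on `su(3)` given by the bivector
`∑ c^l_{kj} x_l ∂_j ⊗ ∂_k`. This bivector is tangent to the adjoint orbits, and its restriction to
`O_ξ` is the Poisson bivector of `O_ξ`: the bracket of `F|O_ξ` and `G|O_ξ` is `{F, G}|O_ξ`. -/
def poissonBracket (F G : PolySU3) : PolySU3 :=
  ∑ j : Fin 8, ∑ k : Fin 8, ∑ l : Fin 8,
    MvPolynomial.C (structConst k j l) * MvPolynomial.X l *
      MvPolynomial.pderiv j F * MvPolynomial.pderiv k G

/-! ## Poincaré–Birkhoff–Witt and the maps `β`, `β_d` -/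

/-- The ordered monomial `e_1^{m_1} ⋯ e_8^{m_8}` in `U(sl(3))`. -/
def pbwMonomial (m : Fin 8 →₀ ℕ) : USL3 :=
  (List.ofFn fun j : Fin 8 => UniversalEnvelopingAlgebra.ι ℂ (gtBasis j) ^ m j).prod

/-- The linear map that sends a commutative monomial to the corresponding ordered monomial of
`U(sl(3))`. By the Poincaré–Birkhoff–Witt theorem it is bijective. -/
def pbwMap : MvPolynomial (Fin 8) ℂ →ₗ[ℂ] USL3 :=
  (MvPolynomial.basisMonomials (Fin 8) ℂ).constr ℂ pbwMonomial

/-- The coordinates of `u ∈ U(sl(3))` in the basis of ordered monomials, collected in a polynomial: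
the inverse of the bijection `pbwMap`. -/
def pbwCoords : USL3 → MvPolynomial (Fin 8) ℂ := Function.invFun pbwMap

/-- `U_d(sl(3))`, the span of the ordered monomials of length `d`. -/
def Uhom (d : ℕ) : Submodule ℂ USL3 :=
  Submodule.span ℂ (pbwMonomial '' {m | m.degree = d})

/-- `U_{≤ d}(sl(3))`. -/
def Ule (d : ℕ) : Submodule ℂ USL3 := ⨆ m ∈ Set.Iic d, Uhom m

/-- The degree of `u ∈ U(sl(3))`: the least `d` with `u ∈ U_{≤ d}(sl(3))`. -/
def Udeg (u : USL3) : ℕ := sInf {d | u ∈ Ule d}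

/-- The projection `π_d` of `U(sl(3))` onto `U_d(sl(3))`. -/
def Uproj (d : ℕ) (u : USL3) : USL3 :=
  pbwMap (MvPolynomial.homogeneousComponent d (pbwCoords u))

/-- The linear polynomial `X ↦ (Y, X) = tr (Y X)`, in the coordinates `x_1, …, x_8`. -/
def linPoly (Y : Mat3) : PolySU3 :=
  ∑ k : Fin 8, MvPolynomial.C ((Y * suBasis k).trace) * MvPolynomial.X k

/-- The linear map `β : U(sl(3)) → Poly(sl(3))`, determined by
`β[e_{j_1} ⋯ e_{j_d}](X) = (e_{j_1}, X) ⋯ (e_{j_d}, X)` for `j_1 ≤ ⋯ ≤ j_d`. -/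
def beta (u : USL3) : PolySU3 :=
  MvPolynomial.aeval (fun j => linPoly (gtMatrix j)) (pbwCoords u)

/-- `β_d[u] = β[π_d u]`. -/
def betaHom (d : ℕ) (u : USL3) : PolySU3 := beta (Uproj d u)

/-! ## Quark systems and correspondences -/

/-- A quantum quark system with highest weight `ω`: a continuous irreducible unitary representation
of `SU(3)` of highest weight `ω`, on a Hilbert space `ℂ^dim` (in an orthonormal basis), with the
representation of `sl(3)` that it induces. A weight `ω ∈ su(3)` is identified with the functional
`H ↦ tr (H (-i ω))` on the diagonal matrices. -/
structure QuarkSystem (ω : Mat3) where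
  /-- the dimension -/
  dim : ℕ
  /-- the representation of `SU(3)` -/
  rep : SU3 →* Matrix.unitaryGroup (Fin dim) ℂ
  continuous_rep : Continuous rep
  irreducible : ∀ S : Submodule ℂ (Fin dim → ℂ),
    (∀ g : SU3, ∀ v ∈ S, (rep g : Matrix (Fin dim) (Fin dim) ℂ) *ᵥ v ∈ S) → S = ⊥ ∨ S = ⊤
  /-- the induced representation of `sl(3)` -/
  diff : SL3Lie →ₗ⁅ℂ⁆ Matrix (Fin dim) (Fin dim) ℂ
  /-- on `su(3)`, `diff` is the differential of `rep` -/
  rep_exp : ∀ (X : SL3Lie) (g : SU3), (X : Mat3)ᴴ = -(X : Mat3) →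
    (g : Mat3) = NormedSpace.exp (X : Mat3) →
    (rep g : Matrix (Fin dim) (Fin dim) ℂ) = NormedSpace.exp (diff X)
  /-- there is a highest weight vector: it is annihilated by `T₊`, `U₊`, `V₊` and has weight `ω` -/
  highest_weight : ∃ v : Fin dim → ℂ, v ≠ 0 ∧
    (∀ j ∈ ({3, 4, 5} : Set (Fin 8)), diff (gtBasis j) *ᵥ v = 0) ∧
    (∀ j ∈ ({6, 7} : Set (Fin 8)),
      diff (gtBasis j) *ᵥ v = (gtMatrix j * ((-Complex.I) • ω)).trace • v)

/-- Operators on the Hilbert space of a quark system. -/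
abbrev QuarkSystem.Op {ω : Mat3} (Q : QuarkSystem ω) : Type := Matrix (Fin Q.dim) (Fin Q.dim) ℂ

/-- The irreducible representation `ρ_ω` of `U(sl(3))`. -/
def QuarkSystem.rho {ω : Mat3} (Q : QuarkSystem ω) : USL3 →ₐ[ℂ] Q.Op :=
  UniversalEnvelopingAlgebra.lift ℂ Q.diff

/-- Symbol correspondences `B(H_ω) → Poly(O_ξ)`: injective linear maps that are equivariant, real
and normalized. The integral over `O_ξ` is the one induced by the normalized Haar measure. -/
structure IsSymbolCorrespondence {ω : Mat3} (Q : QuarkSystem ω) (ξ : Mat3)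
    (W : Q.Op →ₗ[ℂ] PolyOrbit ξ) : Prop where
  injective : Function.Injective W
  equivariant : ∀ (g : SU3) (A : Q.Op) (x : adOrbit ξ),
    (W ((Q.rep g : Q.Op) * A * (Q.rep g⁻¹ : Q.Op))).1 (adOn g x) = (W A).1 x
  real : ∀ (A : Q.Op) (x : adOrbit ξ), (W Aᴴ).1 x = star ((W A).1 x)
  normalized : ∀ A : Q.Op,
    ∫ g : SU3, (W A).1 (adOn g (basePoint ξ)) ∂haarSU3 = A.trace / (Q.dim : ℂ)

/-- Universal correspondences for `ω`: maps `U(sl(3)) → Poly(O_ξ)` of the form `W ∘ ρ_ω` with `W` a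
symbol correspondence. -/
def IsUniversalCorrespondence (ω ξ : Mat3) (w : USL3 →ₗ[ℂ] PolyOrbit ξ) : Prop :=
  ∃ (Q : QuarkSystem ω) (W : Q.Op →ₗ[ℂ] PolyOrbit ξ),
    IsSymbolCorrespondence Q ξ W ∧ ∀ u : USL3, w u = W (Q.rho u)

/-- `ξ`-rays of universal correspondences: `w s` is a universal correspondence for `s ω_ξ`, for
every `s = 1, 2, 3, …` (the value `w 0` plays no role). -/
def IsUniversalRay (ξ : Mat3) (w : ℕ → USL3 →ₗ[ℂ] PolyOrbit ξ) : Prop :=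
  ∀ s : ℕ, 1 ≤ s → IsUniversalCorrespondence ((s : ℝ) • firstDominantWeight ξ) ξ (w s)

/-- The twisted product induced by a universal correspondence `w`, determined on the image of `w` by
`w[u] ⋆ w[v] = w[u v]` (see `twistedProduct_apply`); `Function.invFun w f` is a preimage of `f`
whenever `f` lies in the image of `w`. -/
def twistedProduct {ξ : Mat3} (w : USL3 →ₗ[ℂ] PolyOrbit ξ) (f g : PolyOrbit ξ) : PolyOrbit ξ :=
  w (Function.invFun w f * Function.invFun w g)

theorem twistedProduct_apply {ω ξ : Mat3} {w : USL3 →ₗ[ℂ] PolyOrbit ξ}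
    (hw : IsUniversalCorrespondence ω ξ w) (u v : USL3) :
    twistedProduct w (w u) (w v) = w (u * v) := by
  obtain ⟨Q, W, hW, h⟩ := hw
  have key : ∀ a : USL3, Q.rho (Function.invFun w (w a)) = Q.rho a := fun a => by
    have h1 : w (Function.invFun w (w a)) = w a := Function.invFun_eq ⟨a, rfl⟩
    exact hW.injective (((h _).symm.trans h1).trans (h a))
  unfold twistedProduct
  rw [h (_ * _), h (u * v), map_mul Q.rho, map_mul Q.rho, key, key]

/-- A `ξ`-ray is of Poisson type: for all `f₁ = F₁|O_ξ` and `f₂ = F₂|O_ξ` in `Poly(O_ξ)`, uniformly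
on `O_ξ` as `s → ∞`, `f₁ ⋆ˢ f₂ → f₁ f₂` and `s r(ξ) (f₁ ⋆ˢ f₂ - f₂ ⋆ˢ f₁) → i {f₁, f₂}`.
Both `f₁` and `f₂` lie in the image of `w s`, where `⋆ˢ` is defined, for all large `s`. -/
def IsPoissonType (ξ : Mat3) (w : ℕ → USL3 →ₗ[ℂ] PolyOrbit ξ) : Prop :=
  ∀ F₁ F₂ : PolySU3,
    TendstoUniformly
      (fun (s : ℕ) (x : adOrbit ξ) =>
        (twistedProduct (w s) (resOrbit ξ F₁) (resOrbit ξ F₂)).1 x)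
      (fun x => (resOrbit ξ F₁).1 x * (resOrbit ξ F₂).1 x) atTop ∧
    TendstoUniformly
      (fun (s : ℕ) (x : adOrbit ξ) => ((s * integralRadius ξ : ℝ) : ℂ) *
        ((twistedProduct (w s) (resOrbit ξ F₁) (resOrbit ξ F₂)).1 x -
          (twistedProduct (w s) (resOrbit ξ F₂) (resOrbit ξ F₁)).1 x))
      (fun x => Complex.I * (resOrbit ξ (poissonBracket F₁ F₂)).1 x) atTop

end

noncomputable section

/-! ## The basis of `su(3)` -/

/-! Write `R = s r(ξ)`. Both conditions are shown equivalent to a third one. Let `quantMap R` send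
the generators of the free algebra on eight letters to `-(i/R) E_k`, and let `symbolMap` send them
to `x_k`. The third condition, `QuantTendsto` for all `t`, says that the symbol of `quantMap R t`
tends uniformly to the restriction of `symbolMap t` to the orbit. The free algebra is used because
it does not depend on `s`, and both maps on it are algebra homomorphisms.

Leading terms and quantized words. By Poincaré–Birkhoff–Witt, a word of length `d` in `sl(3)` is the
ordered monomial with the same letters plus ordered monomials of length `< d`, which `R^{-d}` makes
negligible. The constants agree since `tr (E_k X) = -x_k`. Spanning is obtained by straightening
words; independence by letting `U(sl(3))` act through left-invariant differential operators on
powers of a function that vanishes at the identity.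

Quantized words imply Poisson type. The maps from a fixed finite-dimensional representation to
`Poly(O_ξ)` that are equivariant form a finite-dimensional space, since such a map is determined by
its values at `ξ`. Approximating a basis of that space by symbols and averaging over the group gives
families that are again a basis for large `s`. Hence every `f` is eventually exactly the symbol of a
quantized noncommutative polynomial with convergent coefficients (`exists_eventually_eq_quantMap`).
Products are then immediate. For commutators, `R` times the commutator of two quantized polynomials
is the quantization of a polynomial independent of `R` with symbol `i` times the bracket
(`hasPoissonComm`).

Poisson type implies quantized words. As `f ⋆ 1` is a symbol and tends to `f`, the same averaging
shows that `f` itself is eventually a symbol. For a generator, put `θ = x_k - w[quantMap R ι_k]`.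
Equivariance makes the rescaled commutator with `w[quantMap R ι_k]` exactly `i {x_k, ·}`, so the
rescaled commutators of `θ` with the coordinates tend to `0`. In the limit, an equivariant family of
the adjoint type whose brackets with all coordinates vanish at `ξ` is zero, because `su(3)` is
perfect; so `θ → 0` (`HasPoissonLimit.quantTendsto_ι`). Products of families follow by expanding in
fixed bases, where the coefficients converge (`HasPoissonLimit.quantTendsto_mul`). -/

theorem ofReal_sqrt_mul_self {a : ℝ} (ha : 0 ≤ a) :
    ((Real.sqrt a : ℝ) : ℂ) * ((Real.sqrt a : ℝ) : ℂ) = (a : ℂ) := by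
  rw [← Complex.ofReal_mul, Real.mul_self_sqrt ha]

theorem I_div_sqrt_two_sq :
    (Complex.I / ((Real.sqrt 2 : ℝ) : ℂ)) * (Complex.I / ((Real.sqrt 2 : ℝ) : ℂ)) = -(1 / 2) := by
  rw [div_mul_div_comm, Complex.I_mul_I, ofReal_sqrt_mul_self (by norm_num)]
  norm_num

theorem inv_sqrt_three_sq :
    (((Real.sqrt 3 : ℝ) : ℂ))⁻¹ * (((Real.sqrt 3 : ℝ) : ℂ))⁻¹ = 1 / 3 := by
  rw [← mul_inv, ofReal_sqrt_mul_self (by norm_num)]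
  norm_num

theorem gellMann_trace (k : Fin 8) : (gellMann k).trace = 0 := by
  fin_cases k <;> simp [gellMann, Matrix.trace_fin_three]
  ring

theorem gellMann_conjTranspose (k : Fin 8) : (gellMann k)ᴴ = gellMann k := by
  fin_cases k <;> ext i j <;> fin_cases i <;> fin_cases j <;> simp [gellMann]

theorem suBasis_trace (k : Fin 8) : (suBasis k).trace = 0 := by
  simp [suBasis, gellMann_trace]

theorem suBasis_conjTranspose (k : Fin 8) : (suBasis k)ᴴ = -suBasis k := by
  simp [suBasis, gellMann_conjTranspose, neg_div]

/-- The basis `E_1, …, E_8` as elements of `sl(3)`. -/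
def suLie (k : Fin 8) : SL3Lie := ⟨suBasis k, suBasis_trace k⟩

/-- The coordinates as a linear map. -/
def suCoordLin : Mat3 →ₗ[ℂ] (Fin 8 → ℂ) where
  toFun := suCoord
  map_add' X Y := by ext j; simp [suCoord, mul_add]
  map_smul' c X := by ext j; simp [suCoord]

theorem suCoord_smul (c : ℂ) (X : Mat3) : suCoord (c • X) = c • suCoord X := suCoordLin.map_smul c X
theorem suCoord_sum {ι : Type*} (s : Finset ι) (X : ι → Mat3) :
    suCoord (∑ i ∈ s, X i) = ∑ i ∈ s, suCoord (X i) := map_sum suCoordLin X s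

theorem suCoord_eq (X : Mat3) (j : Fin 8) : suCoord X j = -(suBasis j * X).trace := by
  simp [suCoord, suBasis_conjTranspose]

theorem gellMann_trace_mul (j k : Fin 8) :
    (gellMann j * gellMann k).trace = if j = k then 2 else 0 := by
  have h3 := inv_sqrt_three_sq
  fin_cases j <;> fin_cases k <;>
    simp [gellMann, Matrix.trace_fin_three] <;>
    first | linear_combination 6 * h3 | norm_num

theorem suCoord_suBasis (k j : Fin 8) : suCoord (suBasis k) j = if j = k then 1 else 0 := by
  rw [suCoord_eq]
  simp only [suBasis, Matrix.smul_mul, Matrix.mul_smul, smul_smul, Matrix.trace_smul,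
    gellMann_trace_mul, I_div_sqrt_two_sq]
  split_ifs <;> norm_num

theorem sum_gellMann (X : Mat3) (hX : X.trace = 0) :
    ∑ j, (1 / 2 * (gellMann j * X).trace) • gellMann j = X := by
  have h3 := inv_sqrt_three_sq
  have hX' : X 2 2 = -X 0 0 - X 1 1 := by
    rw [Matrix.trace_fin_three] at hX; linear_combination hX
  have hI := Complex.I_mul_I
  ext i j
  fin_cases i <;> fin_cases j <;>
    simp [gellMann, Matrix.trace_fin_three, Matrix.mul_apply, Fin.sum_univ_succ,
      Matrix.vecHead, Matrix.vecTail, hX']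
  · linear_combination (3/2) * (X 0 0 + X 1 1) * h3
  · linear_combination (1/2) * (-X 0 1 + X 1 0) * hI
  · linear_combination (1/2) * (-X 0 2 + X 2 0) * hI
  · linear_combination (1/2) * (-X 1 0 + X 0 1) * hI
  · linear_combination (3/2) * (X 0 0 + X 1 1) * h3
  · linear_combination (1/2) * (-X 1 2 + X 2 1) * hI
  · linear_combination (1/2) * (-X 2 0 + X 0 2) * hI
  · linear_combination (1/2) * (-X 2 1 + X 1 2) * hI
  · linear_combination (-3) * (X 0 0 + X 1 1) * h3

theorem sum_suCoord (X : Mat3) (hX : X.trace = 0) : ∑ j, suCoord X j • suBasis j = X := by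
  conv_rhs => rw [← sum_gellMann X hX]
  refine Finset.sum_congr rfl fun j _ => ?_
  rw [suCoord_eq, suBasis, smul_smul, Matrix.smul_mul, Matrix.trace_smul, smul_eq_mul]
  congr 1
  linear_combination (-(gellMann j * X).trace) * I_div_sqrt_two_sq

theorem sum_suCoord_lie (X : SL3Lie) : ∑ j, suCoord X j • suLie j = X := by
  apply Subtype.ext
  rw [AddSubmonoidClass.coe_finsetSum]
  exact sum_suCoord X X.2

theorem structConst_eq (k j l : Fin 8) :
    structConst k j l = -(suBasis l * (suBasis k * suBasis j - suBasis j * suBasis k)).trace := by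
  rw [structConst, suCoord_eq, Ring.lie_def]

/-- The structure constants change sign when the two last indices are exchanged. -/
theorem structConst_swap (k j l : Fin 8) : structConst k j l = -structConst k l j := by
  rw [structConst_eq, structConst_eq, mul_sub, mul_sub, Matrix.trace_sub, Matrix.trace_sub,
    ← mul_assoc, ← mul_assoc, ← mul_assoc, ← mul_assoc,
    Matrix.trace_mul_cycle (suBasis l) (suBasis k) (suBasis j),
    Matrix.trace_mul_cycle (suBasis j) (suBasis k) (suBasis l),
    Matrix.trace_mul_cycle (suBasis l) (suBasis j) (suBasis k),
    Matrix.trace_mul_cycle (suBasis k) (suBasis l) (suBasis j)]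
  ring

theorem structConst_antisymm (k j l : Fin 8) : structConst k j l = -structConst j k l := by
  rw [structConst_eq, structConst_eq, mul_sub, mul_sub, Matrix.trace_sub, Matrix.trace_sub]
  ring

theorem lie_suLie (k j : Fin 8) : ⁅suLie k, suLie j⁆ = ∑ l, structConst k j l • suLie l :=
  (sum_suCoord_lie ⁅suLie k, suLie j⁆).symm

/-- A linear functional that vanishes on the commutators of traceless matrices vanishes on
traceless matrices. -/
theorem eq_zero_of_forall_commutator (φ : Mat3 →ₗ[ℂ] ℂ)
    (h : ∀ X Y : Mat3, X.trace = 0 → Y.trace = 0 → φ (X * Y - Y * X) = 0)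
    (X : Mat3) (hX : X.trace = 0) : φ X = 0 := by
  -- Off the diagonal, `E_ij = [E_ii - E_jj, E_ij / 2]`.
  have hoff : ∀ i j : Fin 3, i ≠ j → ∀ c : ℂ, φ (Matrix.single i j c) = 0 := by
    intro i j hij c
    have := h (Matrix.single i i 1 - Matrix.single j j 1) (Matrix.single i j (c / 2))
      (by simp) (by simp [hij])
    have e : (Matrix.single i i 1 - Matrix.single j j 1) * Matrix.single i j (c / 2) -
        Matrix.single i j (c / 2) * (Matrix.single i i 1 - Matrix.single j j 1) =
        Matrix.single i j c := by
      simp [sub_mul, mul_sub, hij.symm, ← Matrix.single_add]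
    rwa [e] at this
  -- Here `[E_ij, E_ji] = E_ii - E_jj`, so `φ` takes equal values on the diagonal units and is a
  -- multiple of the trace.
  have hdiag : ∀ i j : Fin 3, i ≠ j → ∀ c : ℂ,
      φ (Matrix.single i i c) = φ (Matrix.single j j c) := by
    intro i j hij c
    have := h (Matrix.single i j c) (Matrix.single j i 1) (by simp [hij]) (by simp [hij.symm])
    simpa [sub_eq_zero] using this
  have hX' : X 2 2 = -X 0 0 - X 1 1 := by
    rw [Matrix.trace_fin_three] at hX; linear_combination hX
  have h2 : φ (Matrix.single 2 2 (X 2 2)) =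
      -φ (Matrix.single 2 2 (X 0 0)) - φ (Matrix.single 2 2 (X 1 1)) := by
    rw [hX', sub_eq_add_neg, Matrix.single_add, map_add]
    simp [← Matrix.single_neg, map_neg, sub_eq_add_neg]
  rw [Matrix.matrix_eq_sum_single X]
  simp only [Fin.sum_univ_three, map_add]
  rw [hoff 0 1 (by decide), hoff 0 2 (by decide), hoff 1 0 (by decide), hoff 1 2 (by decide),
    hoff 2 0 (by decide), hoff 2 1 (by decide), hdiag 0 2 (by decide), hdiag 1 2 (by decide), h2]
  ring

/-- This is the perfectness of `su(3)` in coordinates: the functional with coefficients `θ` kills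
the brackets of basis elements, hence by bilinearity all commutators of traceless matrices. It is
what makes the limit of the linear systems in `HasPoissonLimit.quantTendsto_ι` injective. -/
theorem eq_zero_of_forall_structConst (θ : Fin 8 → ℂ)
    (h : ∀ k l, ∑ j, structConst k l j * θ j = 0) : θ = 0 := by
  let φ : Mat3 →ₗ[ℂ] ℂ := (Fintype.linearCombination ℂ θ).comp suCoordLin
  have hφ : ∀ X, φ X = ∑ j, suCoord X j * θ j := fun X => by
    simp [φ, Fintype.linearCombination_apply, suCoordLin]
  have hb : ∀ X Y : Mat3, X.trace = 0 → Y.trace = 0 → φ (X * Y - Y * X) = 0 := by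
    intro X Y hX hY
    rw [← sum_suCoord X hX, ← sum_suCoord Y hY, ← Ring.lie_def, sum_lie]
    simp only [lie_sum, smul_lie, lie_smul, map_sum, map_smul]
    refine Finset.sum_eq_zero fun k _ => Finset.sum_eq_zero fun l _ => ?_
    rw [hφ, show (∑ j, suCoord ⁅suBasis k, suBasis l⁆ j * θ j) = 0 from h k l]
    simp
  ext j
  have := eq_zero_of_forall_commutator φ hb (suBasis j) (suBasis_trace j)
  simpa [hφ, suCoord_suBasis] using this

/-! ## The Poincaré–Birkhoff–Witt theorem for `sl(3)`: ordered monomials span -/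

theorem sqrt_two_thirds : ((Real.sqrt (2 / 3) : ℝ) : ℂ) * ((Real.sqrt (2 / 3) : ℝ) : ℂ) = 2 / 3 := by
  rw [ofReal_sqrt_mul_self (by norm_num)]; norm_num

/-- The coordinates with respect to the orthonormal basis `e_1, …, e_8`. -/
def gtCoord (X : Mat3) (j : Fin 8) : ℂ := ((gtMatrix j)ᴴ * X).trace

theorem gtCoord_gtMatrix (k j : Fin 8) : gtCoord (gtMatrix k) j = if j = k then 1 else 0 := by
  have h2 := ofReal_sqrt_mul_self (a := 2) (by norm_num)
  have h3 := sqrt_two_thirds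
  push_cast at h2
  have hc : (starRingEnd ℂ) 2 = 2 := map_ofNat _ 2
  fin_cases j <;> fin_cases k <;>
    simp [gtCoord, gtMatrix, Matrix.trace_fin_three, Matrix.mul_apply, Fin.sum_univ_three, hc,
      -Nat.ofNat_nonneg, -Real.sqrt_div', -Real.sqrt_div] <;>
    first | linear_combination (1 / 2) * h2 | linear_combination (3 / 2) * h3 | norm_num

theorem sum_gtCoord (X : Mat3) (hX : X.trace = 0) : ∑ j, gtCoord X j • gtMatrix j = X := by
  have h2 := ofReal_sqrt_mul_self (a := 2) (by norm_num)
  have h3 := sqrt_two_thirds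
  push_cast at h2
  have hc : (starRingEnd ℂ) 2 = 2 := map_ofNat _ 2
  have hX' : X 2 2 = -X 0 0 - X 1 1 := by
    rw [Matrix.trace_fin_three] at hX; linear_combination hX
  ext i j
  fin_cases i <;> fin_cases j <;>
    simp [gtCoord, gtMatrix, Matrix.trace_fin_three, Matrix.mul_apply, Fin.sum_univ_succ,
      Matrix.vecHead, Matrix.vecTail, hX', hc, -Nat.ofNat_nonneg, -Real.sqrt_div', -Real.sqrt_div]
  · linear_combination (3/2) * X 0 0 * h3
  · linear_combination (1/2 * X 1 1 + 1/4 * X 0 0) * h2 - 3/4 * X 0 0 * h3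
  · linear_combination (-1/2 * X 1 1 - 1/4 * X 0 0) * h2 - 3/4 * X 0 0 * h3

theorem sum_gtCoord_lie (X : SL3Lie) : ∑ j, gtCoord X j • gtBasis j = X := by
  apply Subtype.ext
  rw [AddSubmonoidClass.coe_finsetSum]
  exact sum_gtCoord X X.2

theorem pbwMap_monomial (m : Fin 8 →₀ ℕ) (c : ℂ) :
    pbwMap (MvPolynomial.monomial m c) = c • pbwMonomial m := by
  have h : MvPolynomial.monomial m c = c • MvPolynomial.basisMonomials (Fin 8) ℂ m := by
    simp [MvPolynomial.smul_monomial]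
  rw [h, map_smul, pbwMap, Module.Basis.constr_basis]

/-- The product in `U(sl(3))` of the basis elements indexed by a list. -/
def wordProd (l : List (Fin 8)) : USL3 :=
  (l.map fun j => UniversalEnvelopingAlgebra.ι ℂ (gtBasis j)).prod

theorem wordProd_cons (j : Fin 8) (l : List (Fin 8)) :
    wordProd (j :: l) = UniversalEnvelopingAlgebra.ι ℂ (gtBasis j) * wordProd l := by
  simp [wordProd]

theorem wordProd_append (l l' : List (Fin 8)) :
    wordProd (l ++ l') = wordProd l * wordProd l' := by
  simp [wordProd]

/-- The exponents of the commutative monomial underlying a word. -/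
def wordExp (l : List (Fin 8)) : Fin 8 →₀ ℕ := Multiset.toFinsupp (l : Multiset (Fin 8))

theorem wordExp_apply (l : List (Fin 8)) (j : Fin 8) : wordExp l j = l.count j := by
  simp [wordExp]

theorem wordExp_cons (j : Fin 8) (l : List (Fin 8)) :
    wordExp (j :: l) = Finsupp.single j 1 + wordExp l := by
  rw [wordExp, ← Multiset.cons_coe, ← Multiset.singleton_add, map_add, Multiset.toFinsupp_singleton,
    wordExp]

theorem degree_wordExp (l : List (Fin 8)) : (wordExp l).degree = l.length := by
  induction l with
  | nil => simp [wordExp]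
  | cons j l ih => rw [wordExp_cons, map_add, Finsupp.degree_single, ih, List.length_cons, add_comm]

/-- The ordered word with given exponents. -/
def orderedWord (m : Fin 8 →₀ ℕ) : List (Fin 8) :=
  (List.ofFn fun j : Fin 8 => List.replicate (m j) j).flatten

theorem wordProd_orderedWord (m : Fin 8 →₀ ℕ) : wordProd (orderedWord m) = pbwMonomial m := by
  simp only [wordProd, orderedWord, pbwMonomial, List.map_flatten, List.prod_flatten,
    List.map_ofFn]
  congr 2
  funext j
  simp

theorem wordExp_orderedWord (m : Fin 8 →₀ ℕ) : wordExp (orderedWord m) = m := by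
  ext j
  rw [wordExp_apply, orderedWord, List.count_flatten, List.map_ofFn, List.sum_ofFn]
  simp [List.count_replicate]

theorem perm_orderedWord (l : List (Fin 8)) : l.Perm (orderedWord (wordExp l)) := by
  rw [List.perm_iff_count]
  intro j
  rw [← wordExp_apply, ← wordExp_apply, wordExp_orderedWord]

/-- The span of the ordered monomials of length less than `n`. -/
def Ult (n : ℕ) : Submodule ℂ USL3 := Submodule.span ℂ (pbwMonomial '' {m | m.degree < n})

theorem Ult_mono {n n' : ℕ} (h : n ≤ n') : Ult n ≤ Ult n' :=
  Submodule.span_mono (Set.image_mono fun _ hm => lt_of_lt_of_le hm h)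

theorem pbwMonomial_mem_Ult {m : Fin 8 →₀ ℕ} {n : ℕ} (h : m.degree < n) : pbwMonomial m ∈ Ult n :=
  Submodule.subset_span ⟨m, h, rfl⟩

/-- Exchanging two neighbouring letters changes a word by the same word with the pair replaced by
its bracket, which is a combination of words one letter shorter. The prefix `l₀` is quantified
inside because the `cons` case of the induction on permutations moves a letter into it. -/
theorem wordProd_sub_mem_Ult_of_perm {n : ℕ}
    (ih : ∀ l : List (Fin 8), l.length < n → wordProd l ∈ Ult n) {l₁ l₂ : List (Fin 8)}
    (h : l₁.Perm l₂) : ∀ l₀ : List (Fin 8), (l₀ ++ l₁).length = n →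
      wordProd (l₀ ++ l₁) - wordProd (l₀ ++ l₂) ∈ Ult n := by
  induction h with
  | nil => intro l₀ _; simp
  | @cons a l₁ l₂ h ih' =>
    intro l₀ hl
    have := ih' (l₀ ++ [a]) (by simpa using hl)
    simpa using this
  | swap a b l =>
    intro l₀ hl
    have e : wordProd (l₀ ++ b :: a :: l) - wordProd (l₀ ++ a :: b :: l) =
        ∑ j, gtCoord (⁅gtBasis b, gtBasis a⁆ : SL3Lie) j • wordProd (l₀ ++ j :: l) := by
      have h1 : UniversalEnvelopingAlgebra.ι ℂ (gtBasis b) * UniversalEnvelopingAlgebra.ι ℂ (gtBasis a)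
          - UniversalEnvelopingAlgebra.ι ℂ (gtBasis a) * UniversalEnvelopingAlgebra.ι ℂ (gtBasis b) =
          ∑ j, gtCoord (⁅gtBasis b, gtBasis a⁆ : SL3Lie) j •
            UniversalEnvelopingAlgebra.ι ℂ (gtBasis j) := by
        rw [← Ring.lie_def, ← LieHom.map_lie]
        conv_lhs => rw [← sum_gtCoord_lie ⁅gtBasis b, gtBasis a⁆]
        simp only [map_sum, map_smul]
      have h2 : ∑ j, gtCoord (⁅gtBasis b, gtBasis a⁆ : SL3Lie) j • wordProd (l₀ ++ j :: l) =
          wordProd l₀ * (∑ j, gtCoord (⁅gtBasis b, gtBasis a⁆ : SL3Lie) j •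
            UniversalEnvelopingAlgebra.ι ℂ (gtBasis j)) * wordProd l := by
        simp only [wordProd_append, wordProd_cons, Finset.mul_sum, Finset.sum_mul, mul_smul_comm,
          smul_mul_assoc, mul_assoc]
      rw [h2, ← h1]
      simp only [wordProd_append, wordProd_cons, mul_sub, sub_mul, mul_assoc]
    rw [e]
    refine Submodule.sum_mem _ fun j _ => Submodule.smul_mem _ _ (ih _ ?_)
    simp only [List.length_append, List.length_cons] at hl ⊢
    omega
  | @trans l₁ l₂ l₃ h₁ h₂ ih₁ ih₂ =>
    intro l₀ hl
    have := Submodule.add_mem _ (ih₁ l₀ hl) (ih₂ l₀ (by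
      simpa [h₁.length_eq] using hl))
    simpa using this

/-- A product of basis elements is the ordered monomial up to shorter ordered monomials. -/
theorem wordProd_sub_pbwMonomial_mem (l : List (Fin 8)) :
    wordProd l - pbwMonomial (wordExp l) ∈ Ult l.length := by
  induction hn : l.length using Nat.strong_induction_on generalizing l with
  | _ n ih =>
    have ih' : ∀ l : List (Fin 8), l.length < n → wordProd l ∈ Ult n := by
      intro l hl
      have h1 := Ult_mono hl.le (ih _ hl l rfl)
      have h2 : pbwMonomial (wordExp l) ∈ Ult n := pbwMonomial_mem_Ult (by rwa [degree_wordExp])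
      simpa using Submodule.add_mem _ h1 h2
    have := wordProd_sub_mem_Ult_of_perm ih' (perm_orderedWord l) [] (by simpa using hn)
    simpa [wordProd_orderedWord] using this

theorem gtBasis_mul_pbwMonomial (j : Fin 8) (m : Fin 8 →₀ ℕ) :
    UniversalEnvelopingAlgebra.ι ℂ (gtBasis j) * pbwMonomial m -
      pbwMonomial (Finsupp.single j 1 + m) ∈ Ult (m.degree + 1) := by
  have h := wordProd_sub_pbwMonomial_mem (j :: orderedWord m)
  rwa [wordProd_cons, wordProd_orderedWord, wordExp_cons, wordExp_orderedWord, List.length_cons,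
    ← degree_wordExp, wordExp_orderedWord] at h

/-- The linear polynomial in the coordinates of the basis `e_1, …, e_8` that `pbwMap` sends to
`X`. -/
def lieLinPoly (X : Mat3) : MvPolynomial (Fin 8) ℂ :=
  ∑ j, gtCoord X j • MvPolynomial.X j

theorem ι_eq_sum (X : SL3Lie) : UniversalEnvelopingAlgebra.ι ℂ X =
    ∑ j, gtCoord X j • UniversalEnvelopingAlgebra.ι ℂ (gtBasis j) := by
  conv_lhs => rw [← sum_gtCoord_lie X]
  simp only [map_sum, map_smul]

theorem ι_mul_mem_Ult (X : SL3Lie) {n : ℕ} {u : USL3} (hu : u ∈ Ult n) :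
    UniversalEnvelopingAlgebra.ι ℂ X * u ∈ Ult (n + 1) := by
  induction hu using Submodule.span_induction with
  | mem u hu =>
    obtain ⟨m, hm, rfl⟩ := hu
    rw [ι_eq_sum, Finset.sum_mul]
    refine Submodule.sum_mem _ fun j _ => ?_
    rw [smul_mul_assoc]
    refine Submodule.smul_mem _ _ ?_
    have h1 := Ult_mono (Nat.succ_le_succ (le_of_lt hm)) (gtBasis_mul_pbwMonomial j m)
    have h2 : pbwMonomial (Finsupp.single j 1 + m) ∈ Ult (n + 1) := pbwMonomial_mem_Ult (by
      rw [map_add, Finsupp.degree_single, add_comm]; exact Nat.succ_lt_succ hm)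
    simpa using Submodule.add_mem _ h1 h2
  | zero => simp
  | add u v _ _ hu hv => rw [mul_add]; exact Submodule.add_mem _ hu hv
  | smul c u _ hu => rw [mul_smul_comm]; exact Submodule.smul_mem _ _ hu

/-- The associated graded algebra is commutative: to leading order, left multiplication by `X` is
multiplication by its linear polynomial. -/
theorem ι_mul_pbwMap (X : SL3Lie) {n : ℕ} {p : MvPolynomial (Fin 8) ℂ}
    (hp : ∀ m ∈ p.support, m.degree ≤ n) :
    UniversalEnvelopingAlgebra.ι ℂ X * pbwMap p - pbwMap (lieLinPoly X * p) ∈ Ult (n + 1) := by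
  have e : UniversalEnvelopingAlgebra.ι ℂ X * pbwMap p - pbwMap (lieLinPoly X * p) =
      ∑ m ∈ p.support, ∑ j, (p.coeff m * gtCoord X j) •
        (UniversalEnvelopingAlgebra.ι ℂ (gtBasis j) * pbwMonomial m -
          pbwMonomial (Finsupp.single j 1 + m)) := by
    conv_lhs => rw [p.as_sum]
    simp only [map_sum, Finset.mul_sum, ← Finset.sum_sub_distrib]
    refine Finset.sum_congr rfl fun m _ => ?_
    rw [ι_eq_sum, lieLinPoly, Finset.sum_mul, Finset.sum_mul, map_sum, ← Finset.sum_sub_distrib]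
    refine Finset.sum_congr rfl fun j _ => ?_
    rw [pbwMap_monomial, smul_mul_assoc, smul_mul_assoc, map_smul, MvPolynomial.X, MvPolynomial.monomial_mul,
      pbwMap_monomial]
    simp [smul_sub, smul_smul, mul_comm]
  rw [e]
  refine Submodule.sum_mem _ fun m hm => Submodule.sum_mem _ fun j _ => Submodule.smul_mem _ _ ?_
  exact Ult_mono (Nat.succ_le_succ (hp m hm)) (gtBasis_mul_pbwMonomial j m)

theorem lieLinPoly_isHomogeneous (X : Mat3) : (lieLinPoly X).IsHomogeneous 1 := by
  refine MvPolynomial.IsHomogeneous.sum _ _ _ fun j _ => ?_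
  rw [MvPolynomial.smul_eq_C_mul]
  simpa using (MvPolynomial.isHomogeneous_C (Fin 8) (gtCoord X j)).mul
    (MvPolynomial.isHomogeneous_X ℂ j)

theorem lieLinPoly_prod_isHomogeneous (l : List SL3Lie) :
    ((l.map fun X : SL3Lie => lieLinPoly X).prod).IsHomogeneous l.length := by
  induction l with
  | nil => simpa using MvPolynomial.isHomogeneous_one (Fin 8) ℂ
  | cons X l ih =>
    rw [List.map_cons, List.prod_cons, List.length_cons, add_comm]
    exact (lieLinPoly_isHomogeneous X).mul ih

theorem pbwMap_one : pbwMap 1 = 1 := by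
  rw [← MvPolynomial.C_1, ← MvPolynomial.monomial_zero', pbwMap_monomial]
  simp [pbwMonomial]

/-- A product of `d` elements of `sl(3)` is, up to ordered monomials of length less than `d`, the
image of the product of the corresponding linear polynomials. -/
theorem prod_ι_sub_pbwMap_mem (l : List SL3Lie) :
    (l.map fun X => UniversalEnvelopingAlgebra.ι ℂ X).prod -
      pbwMap (l.map fun X : SL3Lie => lieLinPoly X).prod ∈ Ult l.length := by
  induction l with
  | nil => simp [pbwMap_one]
  | cons X l ih =>
    have h1 := ι_mul_mem_Ult X ih
    have h2 := ι_mul_pbwMap X (p := (l.map fun X : SL3Lie => lieLinPoly X).prod) (n := l.length)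
      (fun m hm => by
        have := lieLinPoly_prod_isHomogeneous l (MvPolynomial.mem_support_iff.mp hm)
        rw [Finsupp.degree_eq_weight_one]; exact this.le)
    rw [mul_sub] at h1
    simpa using Submodule.add_mem _ h1 h2

theorem exists_pbwMap_of_mem_Ult {n : ℕ} {u : USL3} (hu : u ∈ Ult n) :
    ∃ p : MvPolynomial (Fin 8) ℂ, pbwMap p = u ∧ ∀ m ∈ p.support, m.degree < n := by
  induction hu using Submodule.span_induction with
  | mem u hu =>
    obtain ⟨m, hm, rfl⟩ := hu
    refine ⟨MvPolynomial.monomial m 1, by rw [pbwMap_monomial, one_smul], fun m' hm' => ?_⟩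
    have := MvPolynomial.support_monomial_subset hm'
    rw [Finset.mem_singleton] at this
    rwa [this]
  | zero => exact ⟨0, by simp, by simp⟩
  | add u v _ _ hu hv =>
    obtain ⟨p, rfl, hp⟩ := hu
    obtain ⟨q, rfl, hq⟩ := hv
    refine ⟨p + q, map_add _ _ _, fun m hm => ?_⟩
    rcases Finset.mem_union.mp (MvPolynomial.support_add hm) with h | h
    exacts [hp m h, hq m h]
  | smul c u _ hu =>
    obtain ⟨p, rfl, hp⟩ := hu
    exact ⟨c • p, map_smul _ _ _, fun m hm => hp m (MvPolynomial.support_smul hm)⟩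

/-! ## The Poincaré–Birkhoff–Witt theorem for `sl(3)`: ordered monomials are independent -/

/-- Polynomial functions on `3 × 3` matrices. -/
abbrev MatPoly : Type := MvPolynomial (Fin 3 × Fin 3) ℂ

/-- The left-invariant vector field on `3 × 3` matrices with value `X` at the identity. -/
def leftField (X : Mat3) : Derivation ℂ MatPoly MatPoly :=
  MvPolynomial.mkDerivation ℂ fun p => ∑ l, X l p.2 • MvPolynomial.X (p.1, l)

theorem leftField_X (X : Mat3) (i k : Fin 3) :
    leftField X (MvPolynomial.X (i, k)) = ∑ l, X l k • MvPolynomial.X (i, l) :=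
  MvPolynomial.mkDerivation_X _ _ _

theorem leftField_lie (X Y : Mat3) : leftField ⁅X, Y⁆ = ⁅leftField X, leftField Y⁆ := by
  refine MvPolynomial.derivation_ext fun p => ?_
  obtain ⟨i, k⟩ := p
  rw [Derivation.commutator_apply]
  simp only [leftField_X, map_sum, Derivation.map_smul, Ring.lie_def, Matrix.sub_apply,
    Matrix.mul_apply, Finset.smul_sum, smul_smul, sub_smul, Finset.sum_smul,
    Finset.sum_sub_distrib]
  congr 1
  · rw [Finset.sum_comm]
    exact Finset.sum_congr rfl fun l _ => Finset.sum_congr rfl fun m _ => by rw [mul_comm]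
  · rw [Finset.sum_comm]
    exact Finset.sum_congr rfl fun l _ => Finset.sum_congr rfl fun m _ => by rw [mul_comm]

/-- The representation of `sl(3)` by left-invariant vector fields. -/
def fieldRep : SL3Lie →ₗ⁅ℂ⁆ Module.End ℂ MatPoly where
  toFun X := (leftField X : MatPoly →ₗ[ℂ] MatPoly)
  map_add' X Y := by
    have : leftField ((X : Mat3) + Y) = leftField X + leftField Y :=
      MvPolynomial.derivation_ext fun p => by
        obtain ⟨i, k⟩ := p
        simp [leftField_X, add_smul, Finset.sum_add_distrib]
    simp [this]
  map_smul' c X := by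
    have : leftField (c • (X : Mat3)) = c • leftField X :=
      MvPolynomial.derivation_ext fun p => by
        obtain ⟨i, k⟩ := p
        simp [leftField_X, mul_smul, Finset.smul_sum]
    simp [this]
  map_lie' {X Y} := by
    have := leftField_lie X Y
    simp [this, Derivation.commutator_coe_linear_map]

/-- The representation of `U(sl(3))` by differential operators. -/
def diffOpRep : USL3 →ₐ[ℂ] Module.End ℂ MatPoly := UniversalEnvelopingAlgebra.lift ℂ fieldRep

theorem diffOpRep_ι (X : SL3Lie) (f : MatPoly) :
    diffOpRep (UniversalEnvelopingAlgebra.ι ℂ X) f = leftField X f := by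
  rw [diffOpRep, UniversalEnvelopingAlgebra.lift_ι_apply]
  rfl

/-- The leading term of the derivatives of a power. -/
theorem diffOpRep_wordProd_pow (f : MatPoly) (l : List (Fin 8)) (k : ℕ) :
    ∃ g : MatPoly, diffOpRep (wordProd l) (f ^ (l.length + k)) =
      ((l.length + k).descFactorial l.length : ℂ) •
        (f ^ k * (l.map fun j => leftField (gtMatrix j) f).prod) + f ^ (k + 1) * g := by
  induction l generalizing k with
  | nil => exact ⟨0, by simp [wordProd]⟩
  | cons j l ih =>
    obtain ⟨g, hg⟩ := ih (k + 1)
    have e : (j :: l).length + k = l.length + (k + 1) := by simp [add_assoc, add_comm 1 k]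
    rw [wordProd_cons, map_mul, Module.End.mul_apply, e, hg, diffOpRep_ι]
    -- With the inductive expression `c f^(k+1) P + f^(k+2) g`, the Leibniz rule gives the new
    -- leading term from differentiating `f^(k+1)`; the three other terms, all divisible by
    -- `f^(k+1)`, make up the witness.
    refine ⟨((l.length + (k + 1)).descFactorial l.length : ℂ) •
        leftField (gtMatrix j) (l.map fun j => leftField (gtMatrix j) f).prod +
      ((k + 2 : ℕ) : ℂ) • (leftField (gtMatrix j) f * g) + f * leftField (gtMatrix j) g, ?_⟩
    have hd : (((l.length + (k + 1)).descFactorial (j :: l).length : ℕ) : ℂ) =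
        (l.length + (k + 1)).descFactorial l.length * (k + 1 : ℂ) := by
      rw [List.length_cons, Nat.descFactorial_succ, Nat.cast_mul, mul_comm]
      congr 1
      rw [Nat.add_sub_cancel_left]
      push_cast; rfl
    rw [hd, List.map_cons, List.prod_cons]
    change leftField (gtMatrix j) _ = _
    simp only [map_add, Derivation.leibniz, Derivation.leibniz_pow, Derivation.map_natCast,
      smul_eq_mul, nsmul_eq_mul, MvPolynomial.smul_eq_C_mul, map_mul, map_add, map_one,
      Nat.add_sub_cancel, map_natCast]
    push_cast
    ring

/-- Evaluation at the identity matrix. -/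
def evalOne : MatPoly →ₐ[ℂ] ℂ := MvPolynomial.aeval fun p => (1 : Mat3) p.1 p.2

theorem evalOne_leftField_linear (a : Mat3) (X : Mat3) :
    evalOne (leftField X (∑ i, ∑ k, a i k • (MvPolynomial.X (i, k) - MvPolynomial.C ((1 : Mat3) i k))))
      = ∑ i, ∑ k, a i k * X i k := by
  simp only [map_sum, Derivation.map_smul, map_sub, MvPolynomial.derivation_C, sub_zero,
    leftField_X, map_smul, evalOne, MvPolynomial.aeval_X, smul_eq_mul]
  refine Finset.sum_congr rfl fun i _ => Finset.sum_congr rfl fun k _ => ?_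
  simp [Matrix.one_apply]

/-- At the identity, the field of `X` pairs the coefficients of an affine function with the entries
of `X`. Since the basis is orthonormal, the conjugates of its entries are dual functionals, so the
derivatives can be prescribed. -/
theorem exists_evalOne_leftField (t : Fin 8 → ℂ) :
    ∃ f : MatPoly, evalOne f = 0 ∧ ∀ j, evalOne (leftField (gtMatrix j) f) = t j := by
  refine ⟨∑ i, ∑ k, (∑ r, t r * star (gtMatrix r i k)) •
    (MvPolynomial.X (i, k) - MvPolynomial.C ((1 : Mat3) i k)), ?_, fun j => ?_⟩
  · simp [evalOne]
  · rw [evalOne_leftField_linear (fun i k => ∑ r, t r * star (gtMatrix r i k))]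
    have h : ∀ r, ∑ i, ∑ k, star (gtMatrix r i k) * gtMatrix j i k = if r = j then 1 else 0 := by
      intro r
      rw [← gtCoord_gtMatrix j r, gtCoord, Matrix.trace, Finset.sum_comm]
      simp [Matrix.mul_apply]
    calc ∑ i, ∑ k, (∑ r, t r * star (gtMatrix r i k)) * gtMatrix j i k
        = ∑ r, t r * ∑ i, ∑ k, star (gtMatrix r i k) * gtMatrix j i k := by
          simp only [Finset.sum_mul, Finset.mul_sum, mul_assoc]
          rw [Finset.sum_comm' (t' := Finset.univ) (s' := fun _ => Finset.univ) (by simp)]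
          rw [Finset.sum_comm]
          simp only [Finset.sum_comm (s := (Finset.univ : Finset (Fin 3))) (t := (Finset.univ : Finset (Fin 8)))]
      _ = t j := by simp only [h]; simp

/-- Each vector field removes at most one factor `f`. With fewer than `d` fields a factor survives
and vanishes at the identity; with exactly `d`, only the term in which every field hits a different
factor remains, and it occurs `d!` times. -/
theorem evalOne_diffOpRep_pbwMonomial {f : MatPoly} (hf : evalOne f = 0) (m : Fin 8 →₀ ℕ) {d : ℕ}
    (hm : m.degree ≤ d) :
    evalOne (diffOpRep (pbwMonomial m) (f ^ d)) =
      if m.degree = d then (d.factorial : ℂ) * ∏ j, evalOne (leftField (gtMatrix j) f) ^ m j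
      else 0 := by
  have hl : (orderedWord m).length = m.degree := by rw [← degree_wordExp, wordExp_orderedWord]
  obtain ⟨k, rfl⟩ := Nat.exists_eq_add_of_le hm
  obtain ⟨g, hg⟩ := diffOpRep_wordProd_pow f (orderedWord m) k
  rw [wordProd_orderedWord, hl] at hg
  rw [hg]
  rcases Nat.eq_zero_or_pos k with rfl | hk
  · have : (((orderedWord m).map fun j => leftField (gtMatrix j) f).map evalOne).prod =
        ∏ j, evalOne (leftField (gtMatrix j) f) ^ m j := by
      rw [orderedWord, List.map_map, List.map_flatten, List.prod_flatten, List.map_ofFn,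
        List.map_ofFn, List.prod_ofFn]
      simp
    simp [hf, map_list_prod, ← this, Nat.descFactorial_self]
  · simp [hf, hk.ne']

/-- If `pbwMap p = 0`, applying it to `f ^ d` with `d` the total degree of `p` and evaluating at the
identity gives `d!` times the top component of `p` at the derivatives `t` of `f`. As `t` is
arbitrary, the top component vanishes, contradicting the choice of `d`. -/
theorem pbwMap_injective : Function.Injective pbwMap := by
  rw [injective_iff_map_eq_zero]
  intro p hp
  by_contra hne
  set d := p.totalDegree with hd
  have hdeg : ∀ m ∈ p.support, m.degree ≤ d := fun m hm => MvPolynomial.le_totalDegree hm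
  have key : MvPolynomial.homogeneousComponent d p = 0 := by
    refine MvPolynomial.funext fun t => ?_
    obtain ⟨f, hf, hft⟩ := exists_evalOne_leftField t
    have h0 : evalOne (diffOpRep (pbwMap p) (f ^ d)) = 0 := by simp [hp]
    rw [p.as_sum, map_sum, map_sum, LinearMap.sum_apply, map_sum] at h0
    have h1 : ∀ m ∈ p.support, evalOne (diffOpRep (pbwMap (MvPolynomial.monomial m (p.coeff m))) (f ^ d))
        = (d.factorial : ℂ) * if m.degree = d then p.coeff m * ∏ j, t j ^ m j else 0 := by
      intro m hm
      rw [pbwMap_monomial, map_smul, LinearMap.smul_apply, map_smul,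
        evalOne_diffOpRep_pbwMonomial hf m (hdeg m hm)]
      split_ifs
      · simp only [hft, smul_eq_mul]; ring
      · simp
    rw [Finset.sum_congr rfl h1, ← Finset.mul_sum] at h0
    have h2 := (mul_eq_zero.mp h0).resolve_left (Nat.cast_ne_zero.mpr d.factorial_ne_zero)
    rw [MvPolynomial.homogeneousComponent_apply, map_sum, map_zero]
    rw [← Finset.sum_filter] at h2
    rw [← h2]
    refine Finset.sum_congr rfl fun m _ => ?_
    rw [MvPolynomial.eval_monomial, Finsupp.prod_fintype _ _ (by simp)]
  obtain ⟨m, hm, hmd⟩ := Finset.exists_mem_eq_sup p.support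
    (MvPolynomial.support_nonempty.mpr hne) fun m => m.degree
  have : MvPolynomial.coeff m (MvPolynomial.homogeneousComponent d p) = p.coeff m := by
    rw [MvPolynomial.coeff_homogeneousComponent, if_pos]
    exact hmd.symm
  rw [key] at this
  exact MvPolynomial.mem_support_iff.mp hm (by simpa using this.symm)

/-- By the universal property, `ι` with values in `S` extends to a homomorphism into `S`, and its
composite with the inclusion is the identity because it fixes `sl(3)`. -/
theorem eq_top_of_ι_mem {S : Subalgebra ℂ USL3}
    (h : ∀ X : SL3Lie, UniversalEnvelopingAlgebra.ι ℂ X ∈ S) : S = ⊤ := by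
  let f : SL3Lie →ₗ⁅ℂ⁆ S :=
    { toFun := fun X => ⟨UniversalEnvelopingAlgebra.ι ℂ X, h X⟩
      map_add' := fun X Y => Subtype.ext (map_add _ X Y)
      map_smul' := fun c X => Subtype.ext (map_smul _ c X)
      map_lie' := fun {X Y} => Subtype.ext (LieHom.map_lie _ X Y) }
  have e : S.val.comp (UniversalEnvelopingAlgebra.lift ℂ f) = AlgHom.id ℂ USL3 := by
    refine UniversalEnvelopingAlgebra.hom_ext ℂ (LieHom.ext fun X => ?_)
    change S.val (UniversalEnvelopingAlgebra.lift ℂ f (UniversalEnvelopingAlgebra.ι ℂ X)) = _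
    rw [UniversalEnvelopingAlgebra.lift_ι_apply]
    rfl
  refine eq_top_iff.mpr fun u _ => ?_
  have := DFunLike.congr_fun e u
  rw [AlgHom.id_apply] at this
  rw [← this]
  exact (UniversalEnvelopingAlgebra.lift ℂ f u).2

/-- A subspace of `U(sl(3))` that contains `1` and is stable under left multiplication by `sl(3)` is
the whole algebra. -/
theorem submodule_eq_top_of_ι_mul_mem {M : Submodule ℂ USL3} (h1 : 1 ∈ M)
    (h : ∀ (X : SL3Lie), ∀ u ∈ M, UniversalEnvelopingAlgebra.ι ℂ X * u ∈ M) : M = ⊤ := by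
  let S : Subalgebra ℂ USL3 :=
    { carrier := {a | ∀ u ∈ M, a * u ∈ M}
      mul_mem' := fun {a b} ha hb u hu => by rw [mul_assoc]; exact ha _ (hb u hu)
      add_mem' := fun {a b} ha hb u hu => by rw [add_mul]; exact M.add_mem (ha u hu) (hb u hu)
      algebraMap_mem' := fun c u hu => by
        rw [Algebra.algebraMap_eq_smul_one, smul_mul_assoc, one_mul]; exact M.smul_mem c hu }
  have hS : S = ⊤ := eq_top_of_ι_mem fun X u hu => h X u hu
  refine eq_top_iff.mpr fun u _ => ?_
  have hu : u ∈ S := hS ▸ Algebra.mem_top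
  simpa using hu 1 h1

theorem pbwMap_surjective : Function.Surjective pbwMap := by
  rw [← LinearMap.range_eq_top]
  refine submodule_eq_top_of_ι_mul_mem ⟨1, pbwMap_one⟩ ?_
  rintro X _ ⟨p, rfl⟩
  obtain ⟨q, hq, -⟩ := exists_pbwMap_of_mem_Ult
    (ι_mul_pbwMap X (p := p) (n := p.totalDegree) fun m hm => MvPolynomial.le_totalDegree hm)
  exact ⟨q + lieLinPoly X * p, by rw [map_add, hq, sub_add_cancel]⟩

theorem pbwCoords_pbwMap (p : MvPolynomial (Fin 8) ℂ) : pbwCoords (pbwMap p) = p :=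
  Function.leftInverse_invFun pbwMap_injective p

/-- Independence of the ordered monomials identifies the filtration of `U(sl(3))` with the one by
total degree. -/
theorem pbwMap_mem_Ult_iff {p : MvPolynomial (Fin 8) ℂ} {n : ℕ} :
    pbwMap p ∈ Ult n ↔ ∀ m ∈ p.support, m.degree < n := by
  refine ⟨fun h => ?_, fun h => ?_⟩
  · obtain ⟨q, hq, hn⟩ := exists_pbwMap_of_mem_Ult h
    rwa [← pbwMap_injective hq]
  · rw [p.as_sum, map_sum]
    refine Submodule.sum_mem _ fun m hm => ?_
    rw [pbwMap_monomial]
    exact Submodule.smul_mem _ _ (pbwMonomial_mem_Ult (h m hm))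

theorem Ule_eq_Ult (d : ℕ) : Ule d = Ult (d + 1) := by
  refine le_antisymm ?_ ?_
  · refine iSup₂_le fun n hn => Submodule.span_mono (Set.image_mono fun m hm => ?_)
    exact Nat.lt_succ_of_le ((le_of_eq hm).trans hn)
  · refine Submodule.span_le.mpr ?_
    rintro _ ⟨m, hm, rfl⟩
    exact Submodule.mem_iSup_of_mem m.degree (Submodule.mem_iSup_of_mem (Nat.le_of_lt_succ hm)
      (Submodule.subset_span ⟨m, rfl, rfl⟩))

theorem Udeg_pbwMap (p : MvPolynomial (Fin 8) ℂ) : Udeg (pbwMap p) = p.totalDegree := by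
  have : {d | pbwMap p ∈ Ule d} = Set.Ici p.totalDegree := by
    ext d
    rw [Set.mem_ofPred_eq, Ule_eq_Ult, pbwMap_mem_Ult_iff, Set.mem_Ici, MvPolynomial.totalDegree,
      Finset.sup_le_iff]
    exact forall₂_congr fun m _ => Nat.lt_succ_iff
  rw [Udeg, this, csInf_Ici]

theorem betaHom_pbwMap (d : ℕ) (p : MvPolynomial (Fin 8) ℂ) :
    betaHom d (pbwMap p) = MvPolynomial.aeval (fun j => linPoly (gtMatrix j))
      (MvPolynomial.homogeneousComponent d p) := by
  rw [betaHom, beta, Uproj, pbwCoords_pbwMap, pbwCoords_pbwMap]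

/-! ## One-parameter subgroups -/

section exponential

theorem NormedAlgebra.hasDerivAt_exp_conj {𝔸 : Type*} [NormedRing 𝔸] [NormedAlgebra ℂ 𝔸]
    [CompleteSpace 𝔸] (φ : 𝔸 →L[ℂ] ℂ) (X A : 𝔸) :
    HasDerivAt (fun t : ℝ => φ (NormedSpace.exp ((t : ℂ) • X) * A * NormedSpace.exp (-((t : ℂ) • X))))
      (φ (X * A - A * X)) 0 := by
  have h1 : HasDerivAt (fun t : ℂ => NormedSpace.exp (t • X)) X 0 := by
    simpa using hasDerivAt_exp_smul_const (𝕂 := ℂ) X (0 : ℂ)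
  have h2 : HasDerivAt (fun t : ℂ => NormedSpace.exp (-(t • X))) (-X) 0 := by
    simpa using hasDerivAt_exp_smul_const (𝕂 := ℂ) (-X) (0 : ℂ)
  have h3 := (h1.mul_const A).mul h2
  rw [zero_smul, neg_zero, NormedSpace.exp_zero, mul_one, one_mul, mul_neg, ← sub_eq_add_neg] at h3
  exact (φ.hasFDerivAt.comp_hasDerivAt (0 : ℂ) h3).comp_ofReal (z := 0)

theorem NormedAlgebra.hasDerivAt_exp_smul {𝔸 : Type*} [NormedRing 𝔸] [NormedAlgebra ℂ 𝔸]
    [CompleteSpace 𝔸] (φ : 𝔸 →L[ℂ] ℂ) (X : 𝔸) :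
    HasDerivAt (fun t : ℝ => φ (NormedSpace.exp ((t : ℂ) • X))) (φ X) 0 := by
  have h1 : HasDerivAt (fun t : ℂ => NormedSpace.exp (t • X)) X 0 := by
    simpa using hasDerivAt_exp_smul_const (𝕂 := ℂ) X (0 : ℂ)
  exact (φ.hasFDerivAt.comp_hasDerivAt (0 : ℂ) h1).comp_ofReal (z := 0)

open scoped Matrix.Norms.Operator

theorem hasDerivAt_exp_conj {n : Type*} [Fintype n] [DecidableEq n] (φ : Matrix n n ℂ →ₗ[ℂ] ℂ)
    (X A : Matrix n n ℂ) :
    HasDerivAt (fun t : ℝ => φ (NormedSpace.exp ((t : ℂ) • X) * A * NormedSpace.exp (-((t : ℂ) • X))))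
      (φ (X * A - A * X)) 0 :=
  NormedAlgebra.hasDerivAt_exp_conj (𝔸 := Matrix n n ℂ) (LinearMap.toContinuousLinearMap φ) X A

theorem hasDerivAt_exp_smul {n : Type*} [Fintype n] [DecidableEq n] (φ : Matrix n n ℂ →ₗ[ℂ] ℂ)
    (X : Matrix n n ℂ) :
    HasDerivAt (fun t : ℝ => φ (NormedSpace.exp ((t : ℂ) • X))) (φ X) 0 :=
  NormedAlgebra.hasDerivAt_exp_smul (𝔸 := Matrix n n ℂ) (LinearMap.toContinuousLinearMap φ) X

end exponential

/-- Unitary diagonalization reduces this to a diagonal matrix, where both sides are the product of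
the exponentials of `c` times the eigenvalues. -/
theorem det_exp_of_isHermitian {n : Type*} [Fintype n] [DecidableEq n] {H : Matrix n n ℂ}
    (hH : H.IsHermitian) (c : ℂ) :
    (NormedSpace.exp (c • H)).det = Complex.exp (c * H.trace) := by
  set U : Matrix n n ℂ := (hH.eigenvectorUnitary : Matrix n n ℂ) with hU
  have hUU : U * star U = 1 := (Matrix.mem_unitaryGroup_iff).mp hH.eigenvectorUnitary.2
  have hinv : U⁻¹ = star U := Matrix.inv_eq_right_inv hUU
  have hunit : IsUnit U := IsUnit.of_mul_eq_one _ hUU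
  have hspec : H = U * Matrix.diagonal (fun i => (hH.eigenvalues i : ℂ)) * U⁻¹ := by
    have := hH.spectral_theorem
    rw [hinv]
    simpa [Unitary.conjStarAlgAut_apply, Function.comp_def] using this
  have htr : H.trace = ∑ i, (hH.eigenvalues i : ℂ) := by
    simpa using hH.trace_eq_sum_eigenvalues
  have hc : c • H = U * Matrix.diagonal (fun i => c * (hH.eigenvalues i : ℂ)) * U⁻¹ := by
    conv_lhs => rw [hspec]
    rw [← Matrix.smul_mul, ← Matrix.mul_smul, ← Matrix.diagonal_smul]
    rfl
  rw [hc, Matrix.exp_conj U _ hunit, Matrix.det_mul, Matrix.det_mul, mul_right_comm,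
    ← Matrix.det_mul, Matrix.mul_nonsing_inv _ ((Matrix.isUnit_iff_isUnit_det U).mp hunit),
    Matrix.det_one, one_mul, Matrix.exp_diagonal, Matrix.det_diagonal, htr, Finset.mul_sum,
    Complex.exp_sum]
  refine Finset.prod_congr rfl fun i _ => ?_
  rw [Pi.coe_exp, Complex.exp_eq_exp_ℂ]

theorem exp_mem_specialUnitaryGroup {X : Mat3} (hX : Xᴴ = -X) (ht : X.trace = 0) :
    NormedSpace.exp X ∈ Matrix.specialUnitaryGroup (Fin 3) ℂ := by
  rw [Matrix.mem_specialUnitaryGroup_iff]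
  constructor
  · rw [Matrix.mem_unitaryGroup_iff', Matrix.star_eq_conjTranspose, ← Matrix.exp_conjTranspose, hX,
      Matrix.exp_neg, Matrix.nonsing_inv_mul]
    exact (Matrix.isUnit_iff_isUnit_det _).mp (Matrix.isUnit_exp X)
  -- `X = -i (iX)` with `iX` Hermitian and traceless, so the determinant is `exp 0`.
  · have hH : (Complex.I • X).IsHermitian := by
      rw [Matrix.IsHermitian, Matrix.conjTranspose_smul, hX]; simp
    have := det_exp_of_isHermitian hH (-Complex.I)
    rw [smul_smul] at this
    simpa [ht] using this

/-- The one-parameter subgroup of `SU(3)` generated by `E_k`. -/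
def expSU (k : Fin 8) (t : ℝ) : SU3 :=
  ⟨NormedSpace.exp ((t : ℂ) • suBasis k), exp_mem_specialUnitaryGroup
    (by rw [Matrix.conjTranspose_smul, suBasis_conjTranspose]; simp)
    (by rw [Matrix.trace_smul, suBasis_trace, smul_zero])⟩

theorem expSU_coe (k : Fin 8) (t : ℝ) :
    (expSU k t : Mat3) = NormedSpace.exp ((t : ℂ) • suBasis k) := rfl

theorem SU3.coe_inv (g : SU3) : ((g⁻¹ : SU3) : Mat3) = (g : Mat3)⁻¹ := by
  refine (Matrix.inv_eq_right_inv ?_).symm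
  rw [← Submonoid.coe_mul, mul_inv_cancel, Submonoid.coe_one]

theorem SU3.coe_mul_inv (g : SU3) : (g : Mat3) * ((g⁻¹ : SU3) : Mat3) = 1 := by
  rw [← Submonoid.coe_mul, mul_inv_cancel, Submonoid.coe_one]

theorem SU3.coe_inv_mul (g : SU3) : ((g⁻¹ : SU3) : Mat3) * (g : Mat3) = 1 := by
  rw [← Submonoid.coe_mul, inv_mul_cancel, Submonoid.coe_one]

theorem expSU_inv_coe (k : Fin 8) (t : ℝ) :
    (((expSU k t)⁻¹ : SU3) : Mat3) = NormedSpace.exp (-((t : ℂ) • suBasis k)) := by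
  rw [SU3.coe_inv, expSU_coe, Matrix.exp_neg]

/-! ## The adjoint action -/

theorem adMat_mul (g h : SU3) (X : Mat3) : adMat (g * h) X = adMat g (adMat h X) := by
  simp only [adMat, _root_.mul_inv_rev, Submonoid.coe_mul, mul_assoc]

theorem adMat_one (X : Mat3) : adMat 1 X = X := by simp [adMat]

theorem adMat_trace (g : SU3) (X : Mat3) : (adMat g X).trace = X.trace := by
  rw [adMat, Matrix.trace_mul_comm, ← mul_assoc, SU3.coe_inv_mul, one_mul]

theorem adMat_mul_adMat (g : SU3) (X Y : Mat3) : adMat g X * adMat g Y = adMat g (X * Y) := by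
  calc adMat g X * adMat g Y
      = g * X * ((((g⁻¹ : SU3) : Mat3)) * g) * Y * ((g⁻¹ : SU3) : Mat3) := by
        simp only [adMat, mul_assoc]
    _ = _ := by rw [SU3.coe_inv_mul, mul_one]; simp only [adMat, mul_assoc]

theorem adMat_sum_smul {ι : Type*} (s : Finset ι) (g : SU3) (c : ι → ℂ) (X : ι → Mat3) :
    adMat g (∑ i ∈ s, c i • X i) = ∑ i ∈ s, c i • adMat g (X i) := by
  simp [adMat, Finset.mul_sum, Finset.sum_mul]

theorem continuous_adMat (X : Mat3) : Continuous fun g : SU3 => adMat g X :=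
  (continuous_subtype_val.mul continuous_const).mul (continuous_subtype_val.comp continuous_inv)

theorem continuous_suCoord (j : Fin 8) : Continuous fun X : Mat3 => suCoord X j :=
  (continuous_const.mul continuous_id).matrix_trace

theorem adMat_suBasis (g : SU3) (k : Fin 8) :
    adMat g (suBasis k) = ∑ j, suCoord (adMat g (suBasis k)) j • suBasis j :=
  (sum_suCoord _ (by rw [adMat_trace, suBasis_trace])).symm

/-- The matrices of the adjoint representation in the basis `E_1, …, E_8`. -/
def adRep : SU3 →* Matrix (Fin 8) (Fin 8) ℂ where
  toFun g := Matrix.of fun j k => suCoord (adMat g (suBasis k)) j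
  map_one' := by
    ext j k
    simp [adMat_one, suCoord_suBasis, Matrix.one_apply]
  map_mul' g h := by
    ext j k
    simp only [Matrix.of_apply, Matrix.mul_apply]
    rw [adMat_mul, adMat_suBasis h, adMat_sum_smul, suCoord_sum, Finset.sum_apply]
    refine Finset.sum_congr rfl fun l _ => ?_
    rw [suCoord_smul, Pi.smul_apply, smul_eq_mul, mul_comm, ← adMat_suBasis h]

theorem adRep_apply (g : SU3) (j k : Fin 8) : adRep g j k = suCoord (adMat g (suBasis k)) j := rfl

theorem continuous_adRep : Continuous adRep :=
  continuous_matrix fun j k => (continuous_suCoord j).comp (continuous_adMat (suBasis k))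

/-- The adjoint action preserves the trace form, so its inverse in the orthonormal basis is the
transpose. This is the equivariance of the family of coordinate functions. -/
theorem suCoord_adMat (g : SU3) (X : Mat3) (k : Fin 8) :
    suCoord X k = ∑ j, adRep g j k * suCoord (adMat g X) j := by
  have h : suCoord X k = -(adMat g (suBasis k) * adMat g X).trace := by
    rw [adMat_mul_adMat, adMat_trace, suCoord_eq]
  rw [h, adMat_suBasis, Finset.sum_mul, Matrix.trace_sum, ← Finset.sum_neg_distrib]
  refine Finset.sum_congr rfl fun j _ => ?_
  rw [Matrix.smul_mul, Matrix.trace_smul, suCoord_eq (adMat g X), adRep_apply, smul_eq_mul, mul_neg]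

/-! ## Functions on adjoint orbits -/

section orbit
variable {ξ : Mat3}

instance instCompactSpaceOrbit : CompactSpace (adOrbit ξ) :=
  isCompact_iff_compactSpace.mp (isCompact_range (continuous_adMat ξ))

theorem adOn_mul (g h : SU3) (x : adOrbit ξ) : adOn (g * h) x = adOn g (adOn h x) :=
  Subtype.ext (adMat_mul g h x)

theorem adOn_one (x : adOrbit ξ) : adOn 1 x = x := Subtype.ext (adMat_one x)

theorem adOn_inv_adOn (g : SU3) (x : adOrbit ξ) : adOn g⁻¹ (adOn g x) = x := by
  rw [← adOn_mul, inv_mul_cancel, adOn_one]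

theorem adOn_adOn_inv (g : SU3) (x : adOrbit ξ) : adOn g (adOn g⁻¹ x) = x := by
  rw [← adOn_mul, mul_inv_cancel, adOn_one]

theorem exists_adOn_basePoint (x : adOrbit ξ) : ∃ g : SU3, adOn g (basePoint ξ) = x := by
  obtain ⟨g, hg⟩ := x.2
  exact ⟨g, Subtype.ext hg⟩

theorem continuous_adOn (x : adOrbit ξ) : Continuous fun g : SU3 => adOn g x :=
  (continuous_adMat (x : Mat3)).subtype_mk _

theorem resOrbit_apply (F : PolySU3) (x : adOrbit ξ) :
    (resOrbit ξ F).1 x = MvPolynomial.eval (suCoord x) F := by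
  change (Pi.evalAlgHom ℂ (fun _ : adOrbit ξ => ℂ) x) (restrictPoly ξ F) = _
  rw [restrictPoly, MvPolynomial.comp_aeval_apply]
  rfl

theorem exists_resOrbit (f : PolyOrbit ξ) : ∃ F, resOrbit ξ F = f := by
  obtain ⟨F, hF⟩ := f.2
  exact ⟨F, Subtype.ext hF⟩

/-- Restriction to the orbit, as a homomorphism onto `Poly(O_ξ)`. -/
def resHom (ξ : Mat3) : PolySU3 →ₐ[ℂ] PolyOrbit ξ := (restrictPoly ξ).rangeRestrict

theorem resHom_apply (F : PolySU3) : resHom ξ F = resOrbit ξ F := rfl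

theorem continuous_polyOrbit (f : PolyOrbit ξ) : Continuous f.1 := by
  obtain ⟨F, rfl⟩ := exists_resOrbit f
  have : (resOrbit ξ F).1 = fun x : adOrbit ξ => MvPolynomial.eval (suCoord x) F :=
    funext (resOrbit_apply F)
  rw [this]
  exact (MvPolynomial.continuous_eval F).comp
    (continuous_pi fun j => (continuous_suCoord j).comp continuous_subtype_val)

/-- `Poly(O_ξ)` as a subalgebra of the algebra of continuous functions with the supremum norm. -/
def toC (ξ : Mat3) : PolyOrbit ξ →ₐ[ℂ] C(adOrbit ξ, ℂ) where
  toFun f := ⟨f.1, continuous_polyOrbit f⟩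
  map_one' := rfl
  map_mul' _ _ := rfl
  map_zero' := rfl
  map_add' _ _ := rfl
  commutes' _ := rfl

theorem toC_apply (f : PolyOrbit ξ) (x : adOrbit ξ) : toC ξ f x = f.1 x := rfl

theorem toC_injective : Function.Injective (toC ξ) := fun _ _ h =>
  Subtype.ext (funext fun x => DFunLike.congr_fun h x)

end orbit

/-! ## The Poisson bracket -/

theorem poissonBracket_add_left (F F' G : PolySU3) :
    poissonBracket (F + F') G = poissonBracket F G + poissonBracket F' G := by
  simp only [poissonBracket, map_add, mul_add, add_mul, Finset.sum_add_distrib]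

theorem poissonBracket_smul_left (c : ℂ) (F G : PolySU3) :
    poissonBracket (c • F) G = c • poissonBracket F G := by
  simp only [poissonBracket, Derivation.map_smul, Finset.smul_sum, mul_smul_comm, smul_mul_assoc]

theorem poissonBracket_mul_left (F F' G : PolySU3) :
    poissonBracket (F * F') G = F * poissonBracket F' G + poissonBracket F G * F' := by
  simp only [poissonBracket, Finset.mul_sum, Finset.sum_mul, ← Finset.sum_add_distrib]
  refine Finset.sum_congr rfl fun j _ => Finset.sum_congr rfl fun k _ =>
    Finset.sum_congr rfl fun l _ => ?_
  rw [Derivation.leibniz, smul_eq_mul, smul_eq_mul]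
  ring

theorem poissonBracket_antisymm (F G : PolySU3) : poissonBracket F G = -poissonBracket G F := by
  rw [poissonBracket, poissonBracket, Finset.sum_comm, ← Finset.sum_neg_distrib]
  refine Finset.sum_congr rfl fun j _ => ?_
  rw [← Finset.sum_neg_distrib]
  refine Finset.sum_congr rfl fun k _ => ?_
  rw [← Finset.sum_neg_distrib]
  refine Finset.sum_congr rfl fun l _ => ?_
  rw [structConst_antisymm, map_neg]
  ring

theorem poissonBracket_sum_left {ι : Type*} (s : Finset ι) (F : ι → PolySU3) (G : PolySU3) :
    poissonBracket (∑ i ∈ s, F i) G = ∑ i ∈ s, poissonBracket (F i) G := by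
  classical
  induction s using Finset.induction_on with
  | empty => simp [poissonBracket]
  | insert a s ha ih => rw [Finset.sum_insert ha, Finset.sum_insert ha, poissonBracket_add_left, ih]

theorem poissonBracket_X_right (F : PolySU3) (k : Fin 8) :
    poissonBracket F (MvPolynomial.X k) =
      ∑ j, ∑ l, MvPolynomial.C (structConst k j l) * MvPolynomial.X l * MvPolynomial.pderiv j F := by
  rw [poissonBracket]
  refine Finset.sum_congr rfl fun j _ => ?_
  rw [Finset.sum_eq_single k]
  · simp
  · intro b _ hb
    simp [MvPolynomial.pderiv_X_of_ne hb.symm]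
  · simp

theorem poissonBracket_X_X (k l : Fin 8) :
    poissonBracket (MvPolynomial.X k) (MvPolynomial.X l) =
      ∑ m, structConst l k m • (MvPolynomial.X m : PolySU3) := by
  rw [poissonBracket_X_right, Finset.sum_eq_single k]
  · simp [MvPolynomial.smul_eq_C_mul]
  · intro b _ hb
    simp [MvPolynomial.pderiv_X_of_ne hb.symm]
  · simp

theorem poissonBracket_eq_sum_right (F G : PolySU3) :
    poissonBracket F G = ∑ k, MvPolynomial.pderiv k G * poissonBracket F (MvPolynomial.X k) := by
  simp only [poissonBracket_X_right, Finset.mul_sum]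
  rw [poissonBracket, Finset.sum_comm]
  refine Finset.sum_congr rfl fun k _ => Finset.sum_congr rfl fun j _ =>
    Finset.sum_congr rfl fun l _ => ?_
  ring

theorem hasDerivAt_eval (F : PolySU3) {c : ℝ → Fin 8 → ℂ} {c' : Fin 8 → ℂ} {t : ℝ}
    (h : ∀ j, HasDerivAt (fun t => c t j) (c' j) t) :
    HasDerivAt (fun t => MvPolynomial.eval (c t) F)
      (∑ j, c' j * MvPolynomial.eval (c t) (MvPolynomial.pderiv j F)) t := by
  induction F using MvPolynomial.induction_on with
  | C a => simpa using hasDerivAt_const t a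
  | add p q hp hq =>
    simp only [map_add, mul_add, Finset.sum_add_distrib]
    exact hp.add hq
  | mul_X p i hp =>
    have hm := hp.mul (h i)
    simp only [map_mul, MvPolynomial.eval_X]
    have hj : ∀ j, c' j * MvPolynomial.eval (c t) (MvPolynomial.pderiv j (p * MvPolynomial.X i)) =
        c' j * MvPolynomial.eval (c t) (MvPolynomial.pderiv j p) * c t i +
          if j = i then MvPolynomial.eval (c t) p * c' i else 0 := by
      intro j
      rw [Derivation.leibniz]
      split_ifs with hj
      · subst hj; simp; ring
      · simp [MvPolynomial.pderiv_X_of_ne (Ne.symm hj)]; ring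
    simp only [hj, Finset.sum_add_distrib, ← Finset.sum_mul, Finset.sum_ite_eq', Finset.mem_univ,
      if_true]
    exact hm

theorem suCoord_commutator_suBasis (k j : Fin 8) (x : Mat3) (hx : x.trace = 0) :
    suCoord (suBasis k * x - x * suBasis k) j = ∑ l, structConst k l j * suCoord x l := by
  conv_lhs => rw [← sum_suCoord x hx]
  rw [← Ring.lie_def, lie_sum]
  simp only [lie_smul, suCoord_sum, suCoord_smul, Finset.sum_apply, Pi.smul_apply, smul_eq_mul]
  exact Finset.sum_congr rfl fun l _ => by rw [mul_comm]; rfl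

/-- The Hamiltonian vector field of a coordinate is the corresponding vector field of the adjoint
action. -/
theorem hasDerivAt_eval_adMat (F : PolySU3) (k : Fin 8) (x : Mat3) (hx : x.trace = 0) :
    HasDerivAt (fun t : ℝ => MvPolynomial.eval (suCoord (adMat (expSU k t) x)) F)
      (-MvPolynomial.eval (suCoord x) (poissonBracket F (MvPolynomial.X k))) 0 := by
  have h : ∀ j, HasDerivAt (fun t : ℝ => suCoord (adMat (expSU k t) x) j)
      (suCoord (suBasis k * x - x * suBasis k) j) 0 := fun j => by
    have := hasDerivAt_exp_conj ((LinearMap.proj j).comp suCoordLin) (suBasis k) x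
    simp only [adMat, expSU_inv_coe, expSU_coe]
    exact this
  have h0 : adMat (expSU k 0) x = x := by
    rw [adMat, expSU_inv_coe, expSU_coe]; simp
  convert hasDerivAt_eval F h using 1
  rw [h0, poissonBracket_X_right]
  simp only [map_sum, map_mul, MvPolynomial.eval_C, MvPolynomial.eval_X,
    suCoord_commutator_suBasis _ _ _ hx, ← Finset.sum_neg_distrib, Finset.sum_mul]
  refine Finset.sum_congr rfl fun j _ => Finset.sum_congr rfl fun l _ => ?_
  rw [structConst_swap k l j]
  ring

/-! ### The Poisson bracket on an orbit -/

section orbit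
variable {ξ : Mat3}

theorem orbit_trace (hξ : ξ.trace = 0) (x : adOrbit ξ) : (x : Mat3).trace = 0 := by
  obtain ⟨g, hg⟩ := x.2
  rw [← hg, adMat_trace, hξ]

theorem hasDerivAt_resOrbit (hξ : ξ.trace = 0) (F : PolySU3) (k : Fin 8) (x : adOrbit ξ) :
    HasDerivAt (fun t : ℝ => (resOrbit ξ F).1 (adOn (expSU k t) x))
      (-(resOrbit ξ (poissonBracket F (MvPolynomial.X k))).1 x) 0 := by
  simp only [resOrbit_apply]
  exact hasDerivAt_eval_adMat F k x (orbit_trace hξ x)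

/-- The bracket with a coordinate is, up to sign, the derivative along the adjoint flow, which stays
on the orbit and hence sees only the restriction of `F`. A general `G` reduces to coordinates
because the bracket is a derivation in `G`. -/
theorem resOrbit_poissonBracket_congr_left (hξ : ξ.trace = 0) {F F' : PolySU3} (G : PolySU3)
    (h : resOrbit ξ F = resOrbit ξ F') :
    resOrbit ξ (poissonBracket F G) = resOrbit ξ (poissonBracket F' G) := by
  have hX : ∀ k, resOrbit ξ (poissonBracket F (MvPolynomial.X k)) =
      resOrbit ξ (poissonBracket F' (MvPolynomial.X k)) := fun k => by
    refine Subtype.ext (funext fun x => ?_)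
    have h1 := hasDerivAt_resOrbit hξ F k x
    rw [h] at h1
    exact neg_injective (h1.unique (hasDerivAt_resOrbit hξ F' k x))
  rw [poissonBracket_eq_sum_right F, poissonBracket_eq_sum_right F', ← resHom_apply, ← resHom_apply,
    map_sum, map_sum]
  refine Finset.sum_congr rfl fun k _ => ?_
  simp only [map_mul, resHom_apply (poissonBracket _ _), hX k]

/-- The bracket of two polynomials on an orbit depends only on their restrictions to the orbit. -/
theorem resOrbit_poissonBracket_congr (hξ : ξ.trace = 0) {F F' G G' : PolySU3}
    (h : resOrbit ξ F = resOrbit ξ F') (h' : resOrbit ξ G = resOrbit ξ G') :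
    resOrbit ξ (poissonBracket F G) = resOrbit ξ (poissonBracket F' G') := by
  rw [resOrbit_poissonBracket_congr_left hξ G h, poissonBracket_antisymm F' G,
    poissonBracket_antisymm F' G', ← resHom_apply, ← resHom_apply, map_neg, map_neg, resHom_apply,
    resHom_apply, resOrbit_poissonBracket_congr_left hξ F' h']

end orbit

/-! ## Equivariance and its infinitesimal form -/

section quark
variable {ω ξ : Mat3} (Q : QuarkSystem ω)

/-- The adjoint action on `sl(3)`. -/
def adLie (g : SU3) (X : SL3Lie) : SL3Lie :=
  ⟨adMat g X, (adMat_trace g X).trans X.2⟩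

theorem rep_expSU (k : Fin 8) (t : ℝ) :
    (Q.rep (expSU k t) : Q.Op) = NormedSpace.exp ((t : ℂ) • Q.diff (suLie k)) := by
  rw [Q.rep_exp ((t : ℂ) • suLie k) (expSU k t) ?_ rfl, map_smul]
  change ((t : ℂ) • suBasis k)ᴴ = -((t : ℂ) • suBasis k)
  rw [Matrix.conjTranspose_smul, suBasis_conjTranspose]; simp

theorem rep_coe_mul (g h : SU3) : (Q.rep (g * h) : Q.Op) = Q.rep g * Q.rep h := by
  rw [map_mul]; rfl

theorem rep_inv_mul (g : SU3) : (Q.rep g⁻¹ : Q.Op) * (Q.rep g : Q.Op) = 1 := by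
  rw [← rep_coe_mul, inv_mul_cancel, map_one]; rfl

theorem rep_mul_inv (g : SU3) : (Q.rep g : Q.Op) * (Q.rep g⁻¹ : Q.Op) = 1 := by
  rw [← rep_coe_mul, mul_inv_cancel, map_one]; rfl

/-- Both matrices generate the image under the representation of the one-parameter group `g exp(t
E_k) g⁻¹`; differentiating at `t = 0`, entry by entry, identifies them. -/
theorem rep_conj_diff_suLie (g : SU3) (k : Fin 8) :
    (Q.rep g : Q.Op) * Q.diff (suLie k) * (Q.rep g⁻¹ : Q.Op) = Q.diff (adLie g (suLie k)) := by
  have hinv : ((Q.rep g : Q.Op))⁻¹ = (Q.rep g⁻¹ : Q.Op) :=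
    Matrix.inv_eq_right_inv (rep_mul_inv Q g)
  have hU : IsUnit (Q.rep g : Q.Op) := IsUnit.of_mul_eq_one _ (rep_mul_inv Q g)
  have hg : IsUnit (g : Mat3) := IsUnit.of_mul_eq_one _ (SU3.coe_mul_inv g)
  have key : ∀ t : ℝ, NormedSpace.exp ((t : ℂ) •
      ((Q.rep g : Q.Op) * Q.diff (suLie k) * (Q.rep g⁻¹ : Q.Op))) =
      NormedSpace.exp ((t : ℂ) • Q.diff (adLie g (suLie k))) := by
    intro t
    have h1 := Q.rep_exp ((t : ℂ) • adLie g (suLie k)) (g * expSU k t * g⁻¹) ?_ ?_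
    · rw [map_smul, rep_coe_mul, rep_coe_mul, rep_expSU] at h1
      rw [← h1, ← hinv, ← Matrix.exp_conj _ _ hU, Matrix.mul_smul, Matrix.smul_mul]
    · change ((t : ℂ) • adMat g (suBasis k))ᴴ = -((t : ℂ) • adMat g (suBasis k))
      have hgi : ((g⁻¹ : SU3) : Mat3) = (g : Mat3)ᴴ := by
        rfl
      rw [adMat, hgi, Matrix.conjTranspose_smul, Matrix.conjTranspose_mul, Matrix.conjTranspose_mul,
        Matrix.conjTranspose_conjTranspose, suBasis_conjTranspose]
      simp [mul_assoc]
    · change _ = NormedSpace.exp ((t : ℂ) • adMat g (suBasis k))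
      rw [Submonoid.coe_mul, Submonoid.coe_mul, expSU_coe, adMat, SU3.coe_inv,
        ← Matrix.exp_conj _ _ hg, Matrix.mul_smul, Matrix.smul_mul]
  ext i j
  have h1 := hasDerivAt_exp_smul (Matrix.entryLinearMap ℂ ℂ i j)
    ((Q.rep g : Q.Op) * Q.diff (suLie k) * (Q.rep g⁻¹ : Q.Op))
  have h2 := hasDerivAt_exp_smul (Matrix.entryLinearMap ℂ ℂ i j) (Q.diff (adLie g (suLie k)))
  simp only [key] at h1
  exact h1.unique h2

theorem rho_ι (X : SL3Lie) : Q.rho (UniversalEnvelopingAlgebra.ι ℂ X) = Q.diff X :=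
  UniversalEnvelopingAlgebra.lift_ι_apply ℂ Q.diff X

theorem adLie_suLie (g : SU3) (k : Fin 8) :
    adLie g (suLie k) = ∑ j, adRep g j k • suLie j := (sum_suCoord_lie (adLie g (suLie k))).symm

theorem rep_conj_rho_suLie (g : SU3) (k : Fin 8) :
    (Q.rep g : Q.Op) * Q.rho (UniversalEnvelopingAlgebra.ι ℂ (suLie k)) * (Q.rep g⁻¹ : Q.Op) =
      ∑ j, adRep g j k • Q.rho (UniversalEnvelopingAlgebra.ι ℂ (suLie j)) := by
  rw [rho_ι, rep_conj_diff_suLie, adLie_suLie, map_sum]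
  simp only [map_smul, rho_ι]

variable {Q}

/-- The infinitesimal form of the equivariance of a symbol correspondence. -/
theorem IsSymbolCorrespondence.lie_apply {W : Q.Op →ₗ[ℂ] PolyOrbit ξ}
    (hW : IsSymbolCorrespondence Q ξ W) (hξ : ξ.trace = 0) (k : Fin 8) (A : Q.Op) {F : PolySU3}
    (hF : W A = resOrbit ξ F) :
    W (Q.diff (suLie k) * A - A * Q.diff (suLie k)) =
      -resOrbit ξ (poissonBracket (MvPolynomial.X k) F) := by
  refine Subtype.ext (funext fun x => ?_)
  let φ : Q.Op →ₗ[ℂ] ℂ :=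
    ((LinearMap.proj x : (adOrbit ξ → ℂ) →ₗ[ℂ] ℂ).comp (PolyOrbit ξ).val.toLinearMap).comp W
  have h1 := hasDerivAt_exp_conj φ (-Q.diff (suLie k)) A
  have h2 := hasDerivAt_resOrbit hξ F k x
  have e : ∀ t : ℝ, φ (NormedSpace.exp ((t : ℂ) • -Q.diff (suLie k)) * A *
      NormedSpace.exp (-((t : ℂ) • -Q.diff (suLie k)))) =
      (resOrbit ξ F).1 (adOn (expSU k t) x) := by
    intro t
    have h3 := hW.equivariant (expSU k t)⁻¹ A (adOn (expSU k t) x)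
    have h4 : (Q.rep (expSU k t)⁻¹ : Q.Op) = NormedSpace.exp (-((t : ℂ) • Q.diff (suLie k))) := by
      rw [Matrix.exp_neg, ← rep_expSU]
      exact (Matrix.inv_eq_right_inv (rep_mul_inv Q _)).symm
    rw [inv_inv, adOn_inv_adOn, h4, rep_expSU, hF] at h3
    rw [← h3, smul_neg, neg_neg]
    rfl
  simp only [e] at h1
  have h5 := h1.unique h2
  rw [poissonBracket_antisymm, ← resHom_apply, map_neg, neg_neg, resHom_apply]
  have h6 : φ (-Q.diff (suLie k) * A - A * -Q.diff (suLie k)) =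
      -(W (Q.diff (suLie k) * A - A * Q.diff (suLie k))).1 x := by
    have : -Q.diff (suLie k) * A - A * -Q.diff (suLie k) =
      -(Q.diff (suLie k) * A - A * Q.diff (suLie k)) := by noncomm_ring
    rw [this, map_neg]
    rfl
  rw [h6] at h5
  exact neg_injective h5

end quark

/-! ## Matrix representations and equivariant families -/

/-- A continuous finite-dimensional matrix representation of `SU(3)`. -/
structure SU3Rep where
  /-- the index set of the basis -/
  T : Type
  fintype : Fintype T
  decEq : DecidableEq T
  /-- the matrices of the representation -/
  D : SU3 →* Matrix T T ℂ
  continuous_D : Continuous D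

attribute [instance] SU3Rep.fintype SU3Rep.decEq

namespace SU3Rep

/-- The trivial representation. -/
def triv : SU3Rep := ⟨Unit, inferInstance, inferInstance, 1, continuous_const⟩

/-- The adjoint representation. -/
def adj : SU3Rep := ⟨Fin 8, inferInstance, inferInstance, adRep, continuous_adRep⟩

/-- The tensor product of representations. -/
def tensor (V V' : SU3Rep) : SU3Rep where
  T := V.T × V'.T
  fintype := inferInstance
  decEq := inferInstance
  D :=
    { toFun := fun g => Matrix.kronecker (V.D g) (V'.D g)
      map_one' := by simp
      map_mul' := fun g h => by rw [map_mul, map_mul]; exact Matrix.mul_kronecker_mul _ _ _ _ }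
  continuous_D := continuous_matrix fun i j =>
    (V.continuous_D.matrix_elem i.1 j.1).mul (V'.continuous_D.matrix_elem i.2 j.2)

/-- The direct sum of a finite family of representations. -/
def sigma {ι : Type} [Fintype ι] [DecidableEq ι] (V : ι → SU3Rep) : SU3Rep where
  T := Σ i, (V i).T
  fintype := inferInstance
  decEq := inferInstance
  D :=
    { toFun := fun g => Matrix.blockDiagonal' fun i => (V i).D g
      map_one' := by
        simp only [map_one]
        exact Matrix.blockDiagonal'_one
      map_mul' := fun g h => by
        simp only [map_mul]
        exact Matrix.blockDiagonal'_mul _ _ }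
  continuous_D := Continuous.matrix_blockDiagonal' (continuous_pi fun i => (V i).continuous_D)

theorem continuous_D_apply (V : SU3Rep) (J K : V.T) : Continuous fun g => V.D g J K :=
  V.continuous_D.matrix_elem J K

/-- Compactness of the group. The constant depends on the representation only, which is what makes
the averaging estimates uniform in `s`. -/
theorem exists_bound (V : SU3Rep) : ∃ C : ℝ, 0 ≤ C ∧ ∀ g K, ∑ J, ‖V.D g J K‖ ≤ C := by
  have hc : Continuous fun g => ∑ K, ∑ J, ‖V.D g J K‖ :=
    continuous_finsetSum _ fun K _ => continuous_finsetSum _ fun J _ =>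
      (V.continuous_D_apply J K).norm
  obtain ⟨C, hC⟩ := isCompact_univ.exists_bound_of_continuousOn hc.continuousOn
  have hC' : ∀ g K, ∑ J, ‖V.D g J K‖ ≤ C := fun g K => by
    have h1 := (le_abs_self _).trans (hC g (Set.mem_univ g))
    refine le_trans ?_ h1
    exact Finset.single_le_sum (f := fun K => ∑ J, ‖V.D g J K‖)
      (fun K _ => Finset.sum_nonneg fun J _ => norm_nonneg _) (Finset.mem_univ K)
  refine ⟨max C 0, le_max_right _ _, fun g K => (hC' g K).trans (le_max_left _ _)⟩

end SU3Rep

/-- The additive group of `Poly(O_ξ)` as found through its ring structure. -/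
instance instAddCommGroupPolyOrbit (ξ : Mat3) : AddCommGroup (PolyOrbit ξ) :=
  (PolyOrbit ξ).toRing.toAddCommGroup

/-- The equivariant maps from a representation to `Poly(O_ξ)`, given by the images of the basis. -/
def equivFam (V : SU3Rep) (ξ : Mat3) : Submodule ℂ (V.T → PolyOrbit ξ) where
  carrier := {h | ∀ (g : SU3) (x : adOrbit ξ) (K : V.T),
    (h K).1 x = ∑ J, V.D g J K * (h J).1 (adOn g x)}
  add_mem' {h h'} hh hh' g x K := by
    have : ((h + h') K).1 x = (h K).1 x + (h' K).1 x := rfl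
    rw [this, hh g x K, hh' g x K, ← Finset.sum_add_distrib]
    exact Finset.sum_congr rfl fun J _ => (mul_add _ _ _).symm
  zero_mem' g x K := by
    refine (Finset.sum_eq_zero fun J _ => ?_).symm
    exact mul_zero _
  smul_mem' c h hh g x K := by
    have : ((c • h) K).1 x = c * (h K).1 x := rfl
    rw [this, hh g x K, Finset.mul_sum]
    refine Finset.sum_congr rfl fun J _ => ?_
    have : ((c • h) J).1 (adOn g x) = c * (h J).1 (adOn g x) := rfl
    rw [this]; ring

section equivFam
variable {V : SU3Rep} {ξ : Mat3}

theorem coe_sum_smul_apply {ι : Type*} (s : Finset ι) (c : ι → ℂ) (f : ι → PolyOrbit ξ)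
    (x : adOrbit ξ) : (∑ i ∈ s, c i • f i : PolyOrbit ξ).1 x = ∑ i ∈ s, c i * (f i).1 x := by
  rw [← toC_apply, map_sum, ContinuousMap.sum_apply]
  refine Finset.sum_congr rfl fun i _ => ?_
  rw [map_smul, ContinuousMap.smul_apply, smul_eq_mul, toC_apply]

/-- Evaluation at the base point. -/
def evBase (V : SU3Rep) (ξ : Mat3) : equivFam V ξ →ₗ[ℂ] (V.T → ℂ) where
  toFun h K := (h.1 K).1 (basePoint ξ)
  map_add' _ _ := rfl
  map_smul' _ _ := rfl

/-- The group acts transitively on the orbit, so equivariance recovers all values of a family from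
those at `ξ`. In particular the space of families is finite-dimensional, whatever the degrees of the
polynomials involved. -/
theorem evBase_injective : Function.Injective (evBase V ξ) := by
  rw [injective_iff_map_eq_zero]
  intro h hh
  refine Subtype.ext (funext fun K => Subtype.ext (funext fun x => ?_))
  obtain ⟨g, hg⟩ := exists_adOn_basePoint x
  have h1 : adOn g⁻¹ x = basePoint ξ := by rw [← hg, adOn_inv_adOn]
  rw [h.2 g⁻¹ x K, h1]
  refine Finset.sum_eq_zero fun J _ => ?_
  have : (h.1 J).1 (basePoint ξ) = 0 := congrFun hh J
  rw [this, mul_zero]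

instance : Module.Finite ℂ (equivFam V ξ) := Module.Finite.of_injective (evBase V ξ) evBase_injective

/-- A basis of the space of equivariant families. -/
def famBasis (V : SU3Rep) (ξ : Mat3) :
    Module.Basis (Fin (Module.finrank ℂ (equivFam V ξ))) ℂ (equivFam V ξ) :=
  Module.finBasis ℂ (equivFam V ξ)

/-- Equivariant families that converge at the base point have convergent coordinates. -/
theorem tendsto_famBasis_repr {h : ℕ → equivFam V ξ} {h₀ : equivFam V ξ}
    (hh : ∀ K, Tendsto (fun s => ((h s).1 K).1 (basePoint ξ)) atTop (𝓝 ((h₀.1 K).1 (basePoint ξ))))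
    (a : Fin (Module.finrank ℂ (equivFam V ξ))) :
    Tendsto (fun s => (famBasis V ξ).repr (h s) a) atTop (𝓝 ((famBasis V ξ).repr h₀ a)) := by
  -- A left inverse of evaluation at `ξ` expresses the coordinates as linear, hence continuous,
  -- functions of the values at `ξ`.
  obtain ⟨L, hL⟩ := (evBase V ξ).exists_leftInverse_of_injective
    (LinearMap.ker_eq_bot.mpr evBase_injective)
  let φ : (V.T → ℂ) →ₗ[ℂ] ℂ := ((famBasis V ξ).coord a).comp L
  have hφ : Continuous φ := φ.continuous_of_finiteDimensional
  have e : ∀ h : equivFam V ξ, (famBasis V ξ).repr h a = φ (evBase V ξ h) := fun h => by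
    have : L (evBase V ξ h) = h := DFunLike.congr_fun hL h
    simp [φ, this]
  simp only [e]
  exact (hφ.tendsto _).comp (tendsto_pi_nhds.mpr hh)

theorem coe_sum_smul_famBasis (h : equivFam V ξ) (K : V.T) :
    h.1 K = ∑ a, (famBasis V ξ).repr h a • (famBasis V ξ a).1 K := by
  conv_lhs => rw [← (famBasis V ξ).sum_repr h]
  rw [Submodule.coe_sum, Finset.sum_apply]
  rfl

theorem tendsto_det_one {n : ℕ} {M : ℕ → Matrix (Fin n) (Fin n) ℂ} (hM : Tendsto M atTop (𝓝 1)) :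
    Tendsto (fun s => (M s).det) atTop (𝓝 1) := by
  have := (Continuous.matrix_det continuous_id).tendsto (1 : Matrix (Fin n) (Fin n) ℂ)
  rw [id, Matrix.det_one] at this
  exact this.comp hM

theorem eventually_mul_inv_eq_one {n : ℕ} {M : ℕ → Matrix (Fin n) (Fin n) ℂ}
    (hM : Tendsto M atTop (𝓝 1)) : ∀ᶠ s in atTop, M s * (M s)⁻¹ = 1 :=
  ((tendsto_det_one hM).eventually_ne one_ne_zero).mono fun _ hs =>
    Matrix.mul_nonsing_inv _ (isUnit_iff_ne_zero.mpr hs)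

theorem tendsto_matrix_inv_one {n : ℕ} {M : ℕ → Matrix (Fin n) (Fin n) ℂ}
    (hM : Tendsto M atTop (𝓝 1)) : Tendsto (fun s => (M s)⁻¹) atTop (𝓝 1) := by
  have hadj := ((Continuous.matrix_adjugate continuous_id).tendsto
    (1 : Matrix (Fin n) (Fin n) ℂ)).comp hM
  have := ((tendsto_det_one hM).inv₀ one_ne_zero).smul hadj
  simpa [Matrix.inv_def, Ring.inverse_eq_inv', Function.comp_def] using this

theorem tendsto_mulVec_zero {P P' : Type*} [Fintype P'] {M : ℕ → Matrix P P' ℂ} {M₀ : Matrix P P' ℂ}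
    (hM : Tendsto M atTop (𝓝 M₀)) {t : ℕ → P' → ℂ} (ht : Tendsto t atTop (𝓝 0)) :
    Tendsto (fun s => M s *ᵥ t s) atTop (𝓝 0) := by
  refine tendsto_pi_nhds.mpr fun i => ?_
  have h : Tendsto (fun s => ∑ j, M s i j * t s j) atTop (𝓝 (∑ j, M₀ i j * 0)) :=
    tendsto_finsetSum _ fun j _ => (tendsto_pi_nhds.mp (tendsto_pi_nhds.mp hM i) j).mul
      (tendsto_pi_nhds.mp ht j)
  simp only [mul_zero, Finset.sum_const_zero] at h
  exact h

/-- A sequence of vectors that tends to zero after multiplication by matrices converging to an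
injective matrix tends to zero. -/
theorem tendsto_zero_of_tendsto_mulVec {P : Type*} [Fintype P] [DecidableEq P] {n : ℕ}
    {v : ℕ → Matrix P (Fin n) ℂ} {v₀ : Matrix P (Fin n) ℂ} (hv : Tendsto v atTop (𝓝 v₀))
    (hinj : ∀ t, v₀ *ᵥ t = 0 → t = 0) {t : ℕ → Fin n → ℂ}
    (ht : Tendsto (fun s => v s *ᵥ t s) atTop (𝓝 0)) : Tendsto t atTop (𝓝 0) := by
  -- With `Λ` a left inverse of `v₀`, the square matrices `Λ v_s` tend to `1`, so eventually `t_s =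
  -- (Λ v_s)⁻¹ Λ (v_s t_s)`.
  obtain ⟨L, hL⟩ := (Matrix.toLin' v₀).exists_leftInverse_of_injective
    (LinearMap.ker_eq_bot'.mpr fun t ht => hinj t (by simpa using ht))
  have hΛ : LinearMap.toMatrix' L * v₀ = 1 := by
    rw [← LinearMap.toMatrix'_toLin' v₀, ← LinearMap.toMatrix'_comp, hL, LinearMap.toMatrix'_id]
  have hM : Tendsto (fun s => LinearMap.toMatrix' L * v s) atTop (𝓝 1) := by
    rw [← hΛ]
    exact ((continuous_const.matrix_mul continuous_id).tendsto v₀).comp hv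
  have h1 := tendsto_mulVec_zero (tendsto_const_nhds (x := LinearMap.toMatrix' L)) ht
  have h2 := tendsto_mulVec_zero (tendsto_matrix_inv_one hM) h1
  refine h2.congr' ?_
  filter_upwards [(tendsto_det_one hM).eventually_ne one_ne_zero] with s hs
  rw [Matrix.mulVec_mulVec, Matrix.mulVec_mulVec, Matrix.mul_assoc,
    Matrix.nonsing_inv_mul _ (isUnit_iff_ne_zero.mpr hs), Matrix.one_mulVec]

theorem basis_eq_sum_of_mul_eq_one {n : ℕ} {H : Type*} [AddCommGroup H] [Module ℂ H]
    (b : Module.Basis (Fin n) ℂ H) (T : Fin n → H) {N : Matrix (Fin n) (Fin n) ℂ}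
    (h : (Matrix.of fun i a => b.repr (T a) i) * N = 1) (a : Fin n) :
    b a = ∑ a', N a' a • T a' := by
  apply b.repr.injective
  ext i
  have h1 := congrFun (congrFun h i) a
  rw [Matrix.mul_apply, Matrix.one_apply] at h1
  rw [map_sum, Finsupp.finsetSum_apply, Module.Basis.repr_self, Finsupp.single_apply]
  simp only [eq_comm (a := a), ← h1, map_smul, Finsupp.smul_apply, smul_eq_mul, Matrix.of_apply]
  exact Finset.sum_congr rfl fun j _ => mul_comm _ _

/-- Families close to a basis form a basis. -/
theorem exists_famBasis_eq_sum {T : ℕ → Fin (Module.finrank ℂ (equivFam V ξ)) → equivFam V ξ}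
    (hT : ∀ a K, Tendsto (fun s => ((T s a).1 K).1 (basePoint ξ)) atTop
      (𝓝 (((famBasis V ξ a).1 K).1 (basePoint ξ)))) :
    ∃ N : ℕ → Matrix (Fin (Module.finrank ℂ (equivFam V ξ))) (Fin (Module.finrank ℂ (equivFam V ξ))) ℂ,
      Tendsto N atTop (𝓝 1) ∧
      ∀ᶠ s in atTop, ∀ a, famBasis V ξ a = ∑ a', N s a' a • T s a' := by
  set b := famBasis V ξ
  -- The columns of `M s` are the coordinates of the given families; since `M s` tends to `1` it is
  -- eventually invertible, and its inverse expresses the basis in those families.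
  let M : ℕ → Matrix (Fin (Module.finrank ℂ (equivFam V ξ)))
    (Fin (Module.finrank ℂ (equivFam V ξ))) ℂ := fun s => Matrix.of fun i a => b.repr (T s a) i
  have hM : Tendsto M atTop (𝓝 1) := by
    refine tendsto_pi_nhds.mpr fun i => tendsto_pi_nhds.mpr fun a => ?_
    have := tendsto_famBasis_repr (hT a) i
    have e : (famBasis V ξ).repr (famBasis V ξ a) i =
        (1 : Matrix (Fin (Module.finrank ℂ (equivFam V ξ)))
          (Fin (Module.finrank ℂ (equivFam V ξ))) ℂ) i a := by
      rw [Module.Basis.repr_self, Finsupp.single_apply, Matrix.one_apply]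
      simp [eq_comm]
    rw [e] at this
    exact this
  exact ⟨fun s => (M s)⁻¹, tendsto_matrix_inv_one hM, (eventually_mul_inv_eq_one hM).mono
    fun s hs a => basis_eq_sum_of_mul_eq_one b (T s) hs a⟩

end equivFam

/-! ## Averaging over the group -/

instance : MeasureTheory.Measure.IsHaarMeasure haarSU3 :=
  inferInstanceAs (MeasureTheory.Measure.IsHaarMeasure (MeasureTheory.Measure.haarMeasure ⊤))

instance : MeasureTheory.IsProbabilityMeasure haarSU3 :=
  ⟨MeasureTheory.Measure.haarMeasure_self (G := SU3) (K₀ := ⊤)⟩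

theorem integrable_haarSU3 {f : SU3 → ℂ} (hf : Continuous f) : MeasureTheory.Integrable f haarSU3 :=
  hf.integrable_of_hasCompactSupport (HasCompactSupport.of_compactSpace f)

/-- Averaging a linear map between representations over the group. -/
def avgMatrix (V V' : SU3Rep) (c : Matrix V'.T V.T ℂ) : Matrix V'.T V.T ℂ :=
  Matrix.of fun L K => ∫ g, (V'.D g * c * V.D g⁻¹) L K ∂haarSU3

section average
variable {V V' : SU3Rep} {ξ : Mat3}

theorem equivFam_apply_inv {F : V'.T → PolyOrbit ξ} (hF : F ∈ equivFam V' ξ) (g : SU3)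
    (x : adOrbit ξ) (L : V'.T) : (F L).1 (adOn g⁻¹ x) = ∑ J, V'.D g J L * (F J).1 x := by
  rw [hF g (adOn g⁻¹ x) L, adOn_adOn_inv]

/-- Equivariance of `F` turns the action of `g` on the coefficients into translation of the
argument. The averaged combination therefore stays in the span of `F`, yet depends on `c` only
through the functions `∑ L, c L J • F L`. -/
theorem sum_avgMatrix_apply (c : Matrix V'.T V.T ℂ) {F : V'.T → PolyOrbit ξ}
    (hF : F ∈ equivFam V' ξ) (K : V.T) (x : adOrbit ξ) :
    (∑ L, avgMatrix V V' c L K • F L).1 x =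
      ∫ g, ∑ J, V.D g⁻¹ J K * (∑ L, c L J • F L).1 (adOn g⁻¹ x) ∂haarSU3 := by
  have hcont : ∀ L, Continuous fun g : SU3 => (V'.D g * c * V.D g⁻¹) L K := fun L =>
    ((V'.continuous_D.matrix_mul continuous_const).matrix_mul
      (V.continuous_D.comp continuous_inv)).matrix_elem L K
  rw [coe_sum_smul_apply]
  simp only [avgMatrix, Matrix.of_apply]
  have h1 : ∀ L, (∫ g, (V'.D g * c * V.D g⁻¹) L K ∂haarSU3) * (F L).1 x =
      ∫ g, (V'.D g * c * V.D g⁻¹) L K * (F L).1 x ∂haarSU3 := fun L =>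
    (MeasureTheory.integral_mul_const _ _).symm
  simp only [h1]
  rw [← MeasureTheory.integral_finsetSum (f := fun L g => (V'.D g * c * V.D g⁻¹) L K * (F L).1 x) _ fun L _ =>
    integrable_haarSU3 ((hcont L).mul continuous_const)]
  congr 1
  funext g
  simp only [coe_sum_smul_apply, equivFam_apply_inv hF, Matrix.mul_apply, Finset.sum_mul,
    Finset.mul_sum]
  rw [Finset.sum_comm]
  refine Finset.sum_congr rfl fun J _ => ?_
  rw [Finset.sum_comm]
  refine Finset.sum_congr rfl fun L _ => Finset.sum_congr rfl fun L' _ => ?_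
  ring

/-- Substitute `g ↦ k g` in the integral, by left invariance of the Haar measure; the factor `V.D k`
is absorbed because `V.D` is multiplicative. -/
theorem sum_avgMatrix_mem (c : Matrix V'.T V.T ℂ) {F : V'.T → PolyOrbit ξ}
    (hF : F ∈ equivFam V' ξ) : (fun K => ∑ L, avgMatrix V V' c L K • F L) ∈ equivFam V ξ := by
  intro k x K
  simp only [sum_avgMatrix_apply c hF]
  have hcont : ∀ J K', Continuous fun g : SU3 =>
      V.D g⁻¹ J K' * (∑ L, c L J • F L).1 (adOn g⁻¹ (adOn k x)) := fun J K' =>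
    ((V.continuous_D_apply J K').comp continuous_inv).mul
      ((continuous_polyOrbit _).comp ((continuous_adOn (adOn k x)).comp continuous_inv))
  have h1 : ∀ K', V.D k K' K * ∫ g, ∑ J, V.D g⁻¹ J K' *
      (∑ L, c L J • F L).1 (adOn g⁻¹ (adOn k x)) ∂haarSU3 =
      ∫ g, V.D k K' K * ∑ J, V.D g⁻¹ J K' *
      (∑ L, c L J • F L).1 (adOn g⁻¹ (adOn k x)) ∂haarSU3 := fun K' =>
    (MeasureTheory.integral_const_mul _ _).symm
  simp only [h1]
  rw [← MeasureTheory.integral_finsetSum (f := fun K' g => V.D k K' K * ∑ J, V.D g⁻¹ J K' *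
      (∑ L, c L J • F L).1 (adOn g⁻¹ (adOn k x))) _ fun K' _ => integrable_haarSU3
    (continuous_const.mul (continuous_finsetSum _ fun J _ => hcont J K'))]
  rw [← MeasureTheory.integral_mul_left_eq_self (fun g => ∑ K', V.D k K' K * ∑ J, V.D g⁻¹ J K' *
      (∑ L, c L J • F L).1 (adOn g⁻¹ (adOn k x))) k]
  congr 1
  funext g
  have h3 : ∀ J, V.D g⁻¹ J K = ∑ K', V.D (k * g)⁻¹ J K' * V.D k K' K := fun J => by
    rw [← Matrix.mul_apply, ← map_mul]
    group
  have h4 : adOn (k * g)⁻¹ (adOn k x) = adOn g⁻¹ x := by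
    rw [← adOn_mul]; congr 1; group
  simp only [h4, h3, Finset.sum_mul, Finset.mul_sum]
  rw [Finset.sum_comm]
  refine Finset.sum_congr rfl fun K' _ => Finset.sum_congr rfl fun J _ => ?_
  ring

/-- The average of a family that is close to an equivariant family is close to it. -/
theorem norm_sum_avgMatrix_sub_le {C : ℝ} (hC : ∀ g K, ∑ J, ‖V.D g J K‖ ≤ C)
    (c : Matrix V'.T V.T ℂ) {F : V'.T → PolyOrbit ξ} (hF : F ∈ equivFam V' ξ)
    {b : V.T → PolyOrbit ξ} (hb : b ∈ equivFam V ξ) {ε : ℝ} (hε : 0 ≤ ε)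
    (h : ∀ J, ‖toC ξ (∑ L, c L J • F L) - toC ξ (b J)‖ ≤ ε) (K : V.T) (x : adOrbit ξ) :
    ‖(∑ L, avgMatrix V V' c L K • F L).1 x - (b K).1 x‖ ≤ C * ε := by
  have h1 : (b K).1 x = ∫ _g : SU3, (b K).1 x ∂haarSU3 := by simp
  have hcont : Continuous fun g : SU3 =>
      ∑ J, V.D g⁻¹ J K * (∑ L, c L J • F L).1 (adOn g⁻¹ x) :=
    continuous_finsetSum _ fun J _ => ((V.continuous_D_apply J K).comp continuous_inv).mul
      ((continuous_polyOrbit _).comp ((continuous_adOn x).comp continuous_inv))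
  rw [sum_avgMatrix_apply c hF, h1, ← MeasureTheory.integral_sub (integrable_haarSU3 hcont)
    (integrable_haarSU3 continuous_const)]
  have h2 : ∀ g : SU3, ‖∑ J, V.D g⁻¹ J K * (∑ L, c L J • F L).1 (adOn g⁻¹ x) - (b K).1 x‖ ≤
      C * ε := by
    intro g
    -- Expanding `b K` by its own equivariance gives the same weights `V.D g⁻¹` as in the average,
    -- so the two can be compared term by term.
    rw [hb g⁻¹ x K, ← Finset.sum_sub_distrib]
    calc ‖∑ J, (V.D g⁻¹ J K * (∑ L, c L J • F L).1 (adOn g⁻¹ x) -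
          V.D g⁻¹ J K * (b J).1 (adOn g⁻¹ x))‖
        ≤ ∑ J, ‖V.D g⁻¹ J K‖ * ε := by
          refine (norm_sum_le _ _).trans (Finset.sum_le_sum fun J _ => ?_)
          rw [← mul_sub, norm_mul]
          refine mul_le_mul_of_nonneg_left ?_ (norm_nonneg _)
          exact ((toC ξ (∑ L, c L J • F L) - toC ξ (b J)).norm_coe_le_norm (adOn g⁻¹ x)).trans (h J)
      _ ≤ C * ε := by
          rw [← Finset.sum_mul]
          exact mul_le_mul_of_nonneg_right (hC g⁻¹ K) hε
  have h3 := MeasureTheory.norm_integral_le_of_norm_le_const (μ := haarSU3)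
    (MeasureTheory.ae_of_all _ h2)
  simpa using h3

end average

/-! ## Noncommutative polynomials, their symbols and their quantizations -/

/-- Noncommutative polynomials in the coordinates. -/
abbrev FreePoly : Type := FreeAlgebra ℂ (Fin 8)

/-- The action of `SU(3)` on noncommutative polynomials. -/
def freeAct (g : SU3) : FreePoly →ₐ[ℂ] FreePoly :=
  FreeAlgebra.lift ℂ fun k => ∑ j, adRep g j k • FreeAlgebra.ι ℂ j

theorem freeAct_ι (g : SU3) (k : Fin 8) :
    freeAct g (FreeAlgebra.ι ℂ k) = ∑ j, adRep g j k • FreeAlgebra.ι ℂ j := by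
  rw [freeAct, FreeAlgebra.lift_ι_apply]

/-- Families of noncommutative polynomials that transform by a given representation. -/
def IsFreeFam (V : SU3Rep) (F : V.T → FreePoly) : Prop :=
  ∀ g K, freeAct g (F K) = ∑ J, V.D g J K • F J

theorem IsFreeFam.adj : IsFreeFam SU3Rep.adj fun k : Fin 8 => FreeAlgebra.ι ℂ k := freeAct_ι

theorem IsFreeFam.triv : IsFreeFam SU3Rep.triv fun _ => (1 : FreePoly) := fun g K => by
  rw [map_one]
  have : (Finset.univ : Finset SU3Rep.triv.T) = {K} :=
    Finset.eq_singleton_iff_unique_mem.mpr ⟨Finset.mem_univ _, fun _ _ => Subsingleton.elim (α := Unit) _ _⟩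
  rw [this, Finset.sum_singleton]
  change (1 : FreePoly) = (1 : Matrix Unit Unit ℂ) K K • 1
  exact (one_smul ℂ (1 : FreePoly)).symm

theorem IsFreeFam.tensor {V V' : SU3Rep} {F : V.T → FreePoly} {F' : V'.T → FreePoly}
    (hF : IsFreeFam V F) (hF' : IsFreeFam V' F') :
    IsFreeFam (V.tensor V') fun p : V.T × V'.T => F p.1 * F' p.2 := fun g p => by
  rw [map_mul, hF, hF', Finset.sum_mul_sum]
  change _ = ∑ q : V.T × V'.T, _
  rw [Fintype.sum_prod_type]
  refine Finset.sum_congr rfl fun J _ => Finset.sum_congr rfl fun J' _ => ?_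
  rw [smul_mul_smul_comm]
  rfl

theorem IsFreeFam.sigma {ι : Type} [Fintype ι] [DecidableEq ι] {V : ι → SU3Rep}
    {F : ∀ i, (V i).T → FreePoly} (hF : ∀ i, IsFreeFam (V i) (F i)) :
    IsFreeFam (SU3Rep.sigma V) fun p : Σ i, (V i).T => F p.1 p.2 := fun g p => by
  obtain ⟨i, K⟩ := p
  change _ = ∑ q : Σ i, (V i).T, Matrix.blockDiagonal' (fun i => (V i).D g) q ⟨i, K⟩ • F q.1 q.2
  rw [hF i g K, Fintype.sum_sigma, Finset.sum_eq_single i]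
  · exact Finset.sum_congr rfl fun J _ => by rw [Matrix.blockDiagonal'_apply_eq]
  · intro i' _ hi'
    refine Finset.sum_eq_zero fun J _ => ?_
    rw [Matrix.blockDiagonal'_apply_ne _ _ _ hi', zero_smul]
  · simp

/-- Every noncommutative polynomial is contained in the span of an equivariant family. If a set
contains `1`, the generators and the products of equivariant families contained in it, then the
family can be found in it. -/
theorem exists_freeFam_subset (S : Set FreePoly) (h1 : 1 ∈ S) (hι : ∀ k, FreeAlgebra.ι ℂ k ∈ S)
    (hmul : ∀ (V V' : SU3Rep) (F : V.T → FreePoly) (F' : V'.T → FreePoly), IsFreeFam V F →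
      IsFreeFam V' F' → (∀ K, F K ∈ S) → (∀ K, F' K ∈ S) → ∀ K K', F K * F' K' ∈ S)
    (t : FreePoly) : ∃ (V : SU3Rep) (F : V.T → FreePoly), IsFreeFam V F ∧ (∀ K, F K ∈ S) ∧
      t ∈ Submodule.span ℂ (Set.range F) := by
  induction t using FreeAlgebra.induction with
  | grade0 c =>
    refine ⟨SU3Rep.triv, _, IsFreeFam.triv, fun _ => h1, ?_⟩
    rw [Algebra.algebraMap_eq_smul_one]
    exact Submodule.smul_mem _ _ (Submodule.subset_span ⟨(), rfl⟩)
  | grade1 k => exact ⟨SU3Rep.adj, _, IsFreeFam.adj, hι, Submodule.subset_span ⟨k, rfl⟩⟩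
  | mul a b ha hb =>
    obtain ⟨V, F, hF, hS, ha⟩ := ha
    obtain ⟨V', F', hF', hS', hb⟩ := hb
    refine ⟨V.tensor V', _, hF.tensor hF', fun K => hmul V V' F F' hF hF' hS hS' _ _, ?_⟩
    have := Submodule.mul_mem_mul ha hb
    rw [Submodule.span_mul_span] at this
    refine Submodule.span_mono ?_ this
    rintro _ ⟨_, ⟨K, rfl⟩, _, ⟨K', rfl⟩, rfl⟩
    exact ⟨(K, K'), rfl⟩
  | add a b ha hb =>
    obtain ⟨V, F, hF, hS, ha⟩ := ha
    obtain ⟨V', F', hF', hS', hb⟩ := hb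
    let W : Bool → SU3Rep := fun i => cond i V V'
    let G : ∀ i, (W i).T → FreePoly := fun i => match i with
      | true => F
      | false => F'
    refine ⟨SU3Rep.sigma W, fun p : Σ i, (W i).T => G p.1 p.2, IsFreeFam.sigma (F := G) ?_, ?_, ?_⟩
    · rintro (_ | _)
      exacts [hF', hF]
    · rintro ⟨_ | _, K⟩
      exacts [hS' K, hS K]
    · refine Submodule.add_mem _ (Submodule.span_mono ?_ ha) (Submodule.span_mono ?_ hb)
      · rintro _ ⟨K, rfl⟩
        exact ⟨⟨true, K⟩, rfl⟩
      · rintro _ ⟨K, rfl⟩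
        exact ⟨⟨false, K⟩, rfl⟩

theorem exists_freeFam (t : FreePoly) : ∃ (V : SU3Rep) (F : V.T → FreePoly), IsFreeFam V F ∧
    ∃ c : V.T → ℂ, t = ∑ K, c K • F K := by
  obtain ⟨V, F, hF, -, h⟩ := exists_freeFam_subset Set.univ trivial (fun _ => trivial)
    (fun _ _ _ _ _ _ _ _ _ _ => trivial) t
  obtain ⟨c, hc⟩ := (Submodule.mem_span_range_iff_exists_fun ℂ).mp h
  exact ⟨V, F, hF, c, hc.symm⟩

/-- Finitely many noncommutative polynomials are contained in the span of one equivariant family. -/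
theorem exists_freeFam_finite {ι : Type} [Fintype ι] [DecidableEq ι] (t : ι → FreePoly) :
    ∃ (V : SU3Rep) (F : V.T → FreePoly), IsFreeFam V F ∧
      ∃ c : ι → V.T → ℂ, ∀ i, t i = ∑ K, c i K • F K := by
  choose V F hF c hc using fun i => exists_freeFam (t i)
  refine ⟨SU3Rep.sigma V, fun p : Σ i, (V i).T => F p.1 p.2, IsFreeFam.sigma hF,
    fun i (p : Σ i, (V i).T) => if p.1 = i then c p.1 p.2 else 0, fun i => ?_⟩
  change _ = ∑ p : Σ i, (V i).T, _
  rw [Fintype.sum_sigma, Finset.sum_eq_single i, hc i]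
  · simp
  · intro i' _ hi'
    simp [hi']
  · simp

/-- The commutative polynomial underlying a noncommutative one. -/
def symbolMap : FreePoly →ₐ[ℂ] PolySU3 := FreeAlgebra.lift ℂ MvPolynomial.X

theorem symbolMap_ι (k : Fin 8) : symbolMap (FreeAlgebra.ι ℂ k) = MvPolynomial.X k :=
  FreeAlgebra.lift_ι_apply _ _

theorem symbolMap_surjective : Function.Surjective symbolMap := by
  rw [← AlgHom.range_eq_top, eq_top_iff, ← MvPolynomial.adjoin_range_X, Algebra.adjoin_le_iff]
  rintro _ ⟨k, rfl⟩
  exact ⟨FreeAlgebra.ι ℂ k, symbolMap_ι k⟩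

/-- The quantization of a noncommutative polynomial at radius `R`. -/
def quantMap (R : ℂ) : FreePoly →ₐ[ℂ] USL3 :=
  FreeAlgebra.lift ℂ fun k => (-(Complex.I / R)) • UniversalEnvelopingAlgebra.ι ℂ (suLie k)

theorem quantMap_ι (R : ℂ) (k : Fin 8) : quantMap R (FreeAlgebra.ι ℂ k) =
    (-(Complex.I / R)) • UniversalEnvelopingAlgebra.ι ℂ (suLie k) :=
  FreeAlgebra.lift_ι_apply _ _

theorem I_mul_neg_I_div {R : ℂ} (hR : R ≠ 0) : Complex.I * R * -(Complex.I / R) = 1 := by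
  field_simp
  rw [Complex.I_sq]; ring

theorem ι_suLie_eq_quantMap {R : ℂ} (hR : R ≠ 0) (k : Fin 8) :
    UniversalEnvelopingAlgebra.ι ℂ (suLie k) =
      (Complex.I * R) • quantMap R (FreeAlgebra.ι ℂ k) := by
  rw [quantMap_ι, smul_smul, I_mul_neg_I_div hR, one_smul]

theorem quantMap_surjective {R : ℂ} (hR : R ≠ 0) : Function.Surjective (quantMap R) := by
  rw [← AlgHom.range_eq_top]
  refine eq_top_of_ι_mem fun X => ?_
  rw [← sum_suCoord_lie X, map_sum]
  refine Subalgebra.sum_mem _ fun k _ => ?_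
  rw [map_smul, ι_suLie_eq_quantMap hR]
  exact Subalgebra.smul_mem _ (Subalgebra.smul_mem _ (AlgHom.mem_range_self _ _) _) _

/-- Equivariant linear maps from noncommutative polynomials to `Poly(O_ξ)`. -/
def IsEquivMap {ξ : Mat3} (q : FreePoly →ₗ[ℂ] PolyOrbit ξ) : Prop :=
  ∀ (g : SU3) (t : FreePoly) (x : adOrbit ξ), (q (freeAct g t)).1 (adOn g x) = (q t).1 x

theorem IsEquivMap.mem_equivFam {ξ : Mat3} {q : FreePoly →ₗ[ℂ] PolyOrbit ξ} (hq : IsEquivMap q)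
    {V : SU3Rep} {F : V.T → FreePoly} (hF : IsFreeFam V F) : (fun K => q (F K)) ∈ equivFam V ξ := by
  intro g x K
  rw [← hq g (F K) x, hF g K, map_sum]
  simp only [map_smul, coe_sum_smul_apply]

/-- The restriction to the orbit of the symbol. -/
def classMap (ξ : Mat3) : FreePoly →ₐ[ℂ] PolyOrbit ξ := (resHom ξ).comp symbolMap

theorem classMap_apply (ξ : Mat3) (t : FreePoly) : classMap ξ t = resOrbit ξ (symbolMap t) := rfl

theorem classMap_surjective (ξ : Mat3) : Function.Surjective (classMap ξ) := fun f => by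
  obtain ⟨F, rfl⟩ := exists_resOrbit f
  obtain ⟨t, rfl⟩ := symbolMap_surjective F
  exact ⟨t, rfl⟩

theorem isEquivMap_classMap (ξ : Mat3) : IsEquivMap (classMap ξ).toLinearMap := by
  intro g t x
  change (classMap ξ (freeAct g t)).1 (adOn g x) = (classMap ξ t).1 x
  induction t using FreeAlgebra.induction with
  | grade0 c => rw [AlgHom.commutes, AlgHom.commutes]; rfl
  | grade1 k =>
    rw [freeAct_ι, map_sum]
    simp only [map_smul]
    rw [coe_sum_smul_apply]
    simp only [classMap_apply, symbolMap_ι, resOrbit_apply, MvPolynomial.eval_X]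
    exact (suCoord_adMat g x k).symm
  | mul a b ha hb =>
    simp only [map_mul]
    exact congrArg₂ (· * ·) ha hb
  | add a b ha hb =>
    simp only [map_add]
    exact congrArg₂ (· + ·) ha hb

theorem rep_conj_quantMap {ω : Mat3} (Q : QuarkSystem ω) (R : ℂ) (g : SU3) (t : FreePoly) :
    (Q.rep g : Q.Op) * Q.rho (quantMap R t) * (Q.rep g⁻¹ : Q.Op) =
      Q.rho (quantMap R (freeAct g t)) := by
  induction t using FreeAlgebra.induction with
  | grade0 c =>
    simp only [AlgHom.commutes]
    rw [Algebra.algebraMap_eq_smul_one, Matrix.mul_smul, mul_one, Matrix.smul_mul, rep_mul_inv]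
  | grade1 k =>
    rw [freeAct_ι, quantMap_ι, map_sum, map_sum, map_smul, Matrix.mul_smul, Matrix.smul_mul,
      rep_conj_rho_suLie, Finset.smul_sum]
    refine Finset.sum_congr rfl fun j _ => ?_
    rw [map_smul, map_smul, quantMap_ι, map_smul, smul_comm]
  | mul a b ha hb =>
    rw [map_mul, map_mul, map_mul, map_mul, map_mul, ← ha, ← hb]
    calc _ = (Q.rep g : Q.Op) * Q.rho (quantMap R a) * 1 * Q.rho (quantMap R b) *
          (Q.rep g⁻¹ : Q.Op) := by rw [mul_one]; simp only [mul_assoc]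
      _ = _ := by rw [← rep_inv_mul Q g]; simp only [mul_assoc]
  | add a b ha hb => simp only [map_add, mul_add, add_mul, ha, hb]

theorem isEquivMap_quantMap {ω ξ : Mat3} {w : USL3 →ₗ[ℂ] PolyOrbit ξ}
    (hw : IsUniversalCorrespondence ω ξ w) (R : ℂ) :
    IsEquivMap (w.comp (quantMap R).toLinearMap) := by
  obtain ⟨Q, W, hW, h⟩ := hw
  intro g t x
  change (w (quantMap R (freeAct g t))).1 (adOn g x) = (w (quantMap R t)).1 x
  rw [h, h, ← rep_conj_quantMap, hW.equivariant]

/-- The commutator of two quantized polynomials is, after rescaling, quantized, and its symbol is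
given by the Poisson bracket. -/
def HasPoissonComm (t t' : FreePoly) : Prop :=
  ∃ b : FreePoly, (∀ R : ℂ, R ≠ 0 →
    R • (quantMap R t * quantMap R t' - quantMap R t' * quantMap R t) = quantMap R b) ∧
    symbolMap b = Complex.I • poissonBracket (symbolMap t) (symbolMap t')

theorem HasPoissonComm.symm {t t' : FreePoly} (h : HasPoissonComm t t') : HasPoissonComm t' t := by
  obtain ⟨b, hb, hs⟩ := h
  refine ⟨-b, fun R hR => ?_, ?_⟩
  · rw [map_neg, ← hb R hR, ← smul_neg, neg_sub]
  · rw [map_neg, hs, poissonBracket_antisymm, smul_neg, neg_neg]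

/-- Of the two factors `-(i/R)`, one is cancelled up to `-i` by the rescaling and the other
quantizes the bracket `[E_k, E_l]`. The sign matches because `{x_k, x_l}` involves `c_{lk} =
-c_{kl}`. -/
theorem hasPoissonComm_ι_ι (k l : Fin 8) :
    HasPoissonComm (FreeAlgebra.ι ℂ k) (FreeAlgebra.ι ℂ l) := by
  refine ⟨∑ m, (-Complex.I * structConst k l m) • FreeAlgebra.ι ℂ m, fun R hR => ?_, ?_⟩
  · simp only [map_sum, map_smul]
    rw [quantMap_ι, quantMap_ι, smul_mul_smul_comm, smul_mul_smul_comm, ← smul_sub, ← Ring.lie_def,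
      ← LieHom.map_lie, lie_suLie, map_sum, Finset.smul_sum, Finset.smul_sum]
    refine Finset.sum_congr rfl fun m _ => ?_
    rw [map_smul, quantMap_ι, smul_smul, smul_smul, smul_smul]
    congr 1
    field_simp
  · simp only [map_sum, map_smul, symbolMap_ι]
    rw [poissonBracket_X_X, Finset.smul_sum]
    refine Finset.sum_congr rfl fun m _ => ?_
    rw [smul_smul, structConst_antisymm l k m, mul_neg, neg_mul]

/-- Commutator and bracket are both derivations in the first argument, so the property passes from
the generators to products and sums. -/
theorem hasPoissonComm_of_ι {t' : FreePoly} (h : ∀ k, HasPoissonComm (FreeAlgebra.ι ℂ k) t')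
    (t : FreePoly) : HasPoissonComm t t' := by
  induction t using FreeAlgebra.induction with
  | grade0 c =>
    refine ⟨0, fun R hR => ?_, ?_⟩
    · rw [AlgHom.commutes, Algebra.commutes, sub_self, smul_zero, map_zero]
    · rw [AlgHom.commutes, map_zero]
      simp [poissonBracket, MvPolynomial.algebraMap_eq]
  | grade1 k => exact h k
  | mul a b ha hb =>
    obtain ⟨u, hu, hus⟩ := ha
    obtain ⟨v, hv, hvs⟩ := hb
    refine ⟨a * v + u * b, fun R hR => ?_, ?_⟩
    · rw [map_add, map_mul, map_mul, map_mul, ← hu R hR, ← hv R hR, mul_smul_comm, smul_mul_assoc,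
        ← smul_add]
      congr 1
      noncomm_ring
    · rw [map_add, map_mul, map_mul, map_mul, hus, hvs, poissonBracket_mul_left, smul_add,
        mul_smul_comm, smul_mul_assoc]
  | add a b ha hb =>
    obtain ⟨u, hu, hus⟩ := ha
    obtain ⟨v, hv, hvs⟩ := hb
    refine ⟨u + v, fun R hR => ?_, ?_⟩
    · rw [map_add, map_add, ← hu R hR, ← hv R hR, ← smul_add]
      congr 1
      noncomm_ring
    · rw [map_add, map_add, hus, hvs, poissonBracket_add_left, smul_add]

theorem hasPoissonComm (t t' : FreePoly) : HasPoissonComm t t' :=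
  hasPoissonComm_of_ι (fun k => (hasPoissonComm_of_ι (fun l => hasPoissonComm_ι_ι l k) t').symm) t

/-! ## Sequences of universal correspondences -/

section ray
variable {ξ : Mat3} (w : ℕ → USL3 →ₗ[ℂ] PolyOrbit ξ) (R : ℕ → ℂ)

/-- The symbols of the quantizations of `t` converge uniformly to the classical function. -/
def QuantTendsto (t : FreePoly) : Prop :=
  Tendsto (fun s => toC ξ (w s (quantMap (R s) t))) atTop (𝓝 (toC ξ (classMap ξ t)))

/-- The twisted products converge to the pointwise product, and their rescaled commutators to the
Poisson bracket. -/
def HasPoissonLimit : Prop :=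
  ∀ F₁ F₂ : PolySU3,
    Tendsto (fun s => toC ξ (twistedProduct (w s) (resOrbit ξ F₁) (resOrbit ξ F₂))) atTop
      (𝓝 (toC ξ (resOrbit ξ F₁ * resOrbit ξ F₂))) ∧
    Tendsto (fun s => R s • (toC ξ (twistedProduct (w s) (resOrbit ξ F₁) (resOrbit ξ F₂)) -
        toC ξ (twistedProduct (w s) (resOrbit ξ F₂) (resOrbit ξ F₁)))) atTop
      (𝓝 (Complex.I • toC ξ (resOrbit ξ (poissonBracket F₁ F₂))))

variable {w R}

theorem tendsto_quantMap_sum {ι : Type*} [Fintype ι] {F : ι → FreePoly}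
    (hF : ∀ i, QuantTendsto w R (F i)) {C : ℕ → ι → ℂ} {C₀ : ι → ℂ}
    (hC : ∀ i, Tendsto (fun s => C s i) atTop (𝓝 (C₀ i))) :
    Tendsto (fun s => toC ξ (w s (quantMap (R s) (∑ i, C s i • F i)))) atTop
      (𝓝 (toC ξ (classMap ξ (∑ i, C₀ i • F i)))) := by
  simp only [map_sum, map_smul]
  exact tendsto_finsetSum _ fun i _ => (hC i).smul (hF i)

theorem poissonBracket_sum_smul {ι ι' : Type*} [Fintype ι] [Fintype ι'] (c : ι → ℂ) (c' : ι' → ℂ)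
    (F : ι → PolySU3) (G : ι' → PolySU3) :
    poissonBracket (∑ i, c i • F i) (∑ j, c' j • G j) =
      ∑ p : ι × ι', (c p.1 * c' p.2) • poissonBracket (F p.1) (G p.2) := by
  rw [poissonBracket_sum_left, Fintype.sum_prod_type]
  refine Finset.sum_congr rfl fun i _ => ?_
  rw [poissonBracket_smul_left, poissonBracket_antisymm, poissonBracket_sum_left,
    ← Finset.sum_neg_distrib, Finset.smul_sum]
  refine Finset.sum_congr rfl fun j _ => ?_
  rw [poissonBracket_smul_left, ← smul_neg, ← poissonBracket_antisymm, smul_smul]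

/-- If the symbols of all quantizations converge, then every polynomial function on the orbit is
the symbol of a quantization with convergent coefficients. -/
theorem exists_eventually_eq_quantMap (hw : ∀ s, ∃ ω, IsUniversalCorrespondence ω ξ (w s))
    (hS : ∀ t, QuantTendsto w R t) (f : PolyOrbit ξ) :
    ∃ (V : SU3Rep) (F : V.T → FreePoly) (C : ℕ → V.T → ℂ) (C₀ : V.T → ℂ),
      (∀ L, Tendsto (fun s => C s L) atTop (𝓝 (C₀ L))) ∧
      ∀ᶠ s in atTop, w s (quantMap (R s) (∑ L, C s L • F L)) = f := by
  obtain ⟨t₀, rfl⟩ := classMap_surjective ξ f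
  obtain ⟨V, F, hF, c₀, rfl⟩ := exists_freeFam t₀
  let h : equivFam V ξ := ⟨fun K => classMap ξ (F K), (isEquivMap_classMap ξ).mem_equivFam hF⟩
  choose τ hτ using fun p : Fin (Module.finrank ℂ (equivFam V ξ)) × V.T =>
    classMap_surjective ξ ((famBasis V ξ p.1).1 p.2)
  obtain ⟨V', F', hF', c, hc⟩ := exists_freeFam_finite τ
  -- The averaged coefficients of noncommutative lifts of the basis functions; they do not depend on
  -- `s`.
  let A : Fin (Module.finrank ℂ (equivFam V ξ)) → Matrix V'.T V.T ℂ := fun a =>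
    avgMatrix V V' (Matrix.of fun L K => c (a, K) L)
  have hq : ∀ s, (fun L => w s (quantMap (R s) (F' L))) ∈ equivFam V' ξ := fun s => by
    obtain ⟨ω, hs⟩ := hw s
    exact (isEquivMap_quantMap hs (R s)).mem_equivFam hF'
  have hcl : (fun L => classMap ξ (F' L)) ∈ equivFam V' ξ :=
    (isEquivMap_classMap ξ).mem_equivFam hF'
  obtain ⟨N, hN, hev⟩ := exists_famBasis_eq_sum (V := V) (ξ := ξ)
    (T := fun s a => ⟨fun K => ∑ L, A a L K • w s (quantMap (R s) (F' L)),
      sum_avgMatrix_mem _ (hq s)⟩) fun a K => by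
    -- In the classical limit the lifts are exact, so the averaging estimate with error `0` shows
    -- that averaging reproduces the basis.
    have h1 : (∑ L, A a L K • classMap ξ (F' L)).1 (basePoint ξ) =
        ((famBasis V ξ a).1 K).1 (basePoint ξ) := by
      obtain ⟨C, -, hC⟩ := V.exists_bound
      have := norm_sum_avgMatrix_sub_le hC (Matrix.of fun L K => c (a, K) L) hcl
        (famBasis V ξ a).2 le_rfl (fun J => by
          rw [← hτ (a, J), hc, map_sum]
          simp) K (basePoint ξ)
      rw [mul_zero, norm_le_zero_iff, sub_eq_zero] at this
      exact this
    rw [← h1]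
    simp only [coe_sum_smul_apply]
    refine tendsto_finsetSum _ fun L _ => tendsto_const_nhds.mul ?_
    exact ((continuous_eval_const (F := C(adOrbit ξ, ℂ)) (basePoint ξ)).tendsto _).comp (hS (F' L))
  -- Expand `f` in the components of `h`, `h` in the basis, the basis in the averaged families
  -- through `N s`, and these in the `F' L`. The limit coefficients have `1` in place of `N s`.
  refine ⟨V', F', fun s L => ∑ K, ∑ a, ∑ a', c₀ K * (famBasis V ξ).repr h a * N s a' a * A a' L K,
    fun L => ∑ K, ∑ a, ∑ a', c₀ K * (famBasis V ξ).repr h a *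
      (1 : Matrix (Fin (Module.finrank ℂ (equivFam V ξ))) _ ℂ) a' a * A a' L K, fun L => ?_, ?_⟩
  · refine tendsto_finsetSum _ fun K _ => tendsto_finsetSum _ fun a _ => tendsto_finsetSum _ fun a' _ =>
      (tendsto_const_nhds.mul ?_).mul tendsto_const_nhds
    exact tendsto_pi_nhds.mp (tendsto_pi_nhds.mp hN a') a
  · filter_upwards [hev] with s hs
    have e : ∀ K, classMap ξ (F K) = ∑ a, ∑ a', ∑ L,
        ((famBasis V ξ).repr h a * N s a' a * A a' L K) • w s (quantMap (R s) (F' L)) := fun K => by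
      refine (coe_sum_smul_famBasis h K).trans (Finset.sum_congr rfl fun a _ => ?_)
      rw [hs a, Submodule.coe_sum, Finset.sum_apply, Finset.smul_sum]
      refine Finset.sum_congr rfl fun a' _ => ?_
      change _ • N s a' a • ∑ L, A a' L K • w s (quantMap (R s) (F' L)) = _
      rw [Finset.smul_sum, Finset.smul_sum]
      exact Finset.sum_congr rfl fun L _ => by rw [smul_smul, smul_smul]
    simp only [map_sum, map_smul, e, Finset.smul_sum, Finset.sum_smul, smul_smul]
    rw [Finset.sum_comm]
    refine Finset.sum_congr rfl fun K _ => ?_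
    rw [Finset.sum_comm]
    refine Finset.sum_congr rfl fun a _ => ?_
    rw [Finset.sum_comm]
    refine Finset.sum_congr rfl fun a' _ => Finset.sum_congr rfl fun L _ => ?_
    simp only [mul_assoc]

/-- If the symbols of all quantizations converge, then the twisted products have the Poisson
limit. -/
theorem hasPoissonLimit_of_quantTendsto (hw : ∀ s, ∃ ω, IsUniversalCorrespondence ω ξ (w s))
    (hξ : ξ.trace = 0) (hR : ∀ s, R s ≠ 0) (hS : ∀ t, QuantTendsto w R t) :
    HasPoissonLimit w R := by
  intro F₁ F₂
  obtain ⟨V, F, C, C₀, hC, hev⟩ := exists_eventually_eq_quantMap hw hS (resOrbit ξ F₁)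
  obtain ⟨V', F', C', C₀', hC', hev'⟩ := exists_eventually_eq_quantMap hw hS (resOrbit ξ F₂)
  -- The symbols are eventually constant, so by uniqueness of limits the limit coefficients
  -- represent the same function.
  have h1 : classMap ξ (∑ L, C₀ L • F L) = resOrbit ξ F₁ := toC_injective <|
    tendsto_nhds_unique_of_eventuallyEq (tendsto_quantMap_sum (fun _ => hS _) hC)
      tendsto_const_nhds (hev.mono fun s hs => congrArg (toC ξ) hs)
  have h2 : classMap ξ (∑ L, C₀' L • F' L) = resOrbit ξ F₂ := toC_injective <|
    tendsto_nhds_unique_of_eventuallyEq (tendsto_quantMap_sum (fun _ => hS _) hC')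
      tendsto_const_nhds (hev'.mono fun s hs => congrArg (toC ξ) hs)
  have hCC : ∀ p : V.T × V'.T, Tendsto (fun s => C s p.1 * C' s p.2) atTop
      (𝓝 (C₀ p.1 * C₀' p.2)) := fun p => (hC p.1).mul (hC' p.2)
  have hmul : ∀ (c : V.T → ℂ) (c' : V'.T → ℂ), (∑ L, c L • F L) * (∑ L, c' L • F' L) =
      ∑ p : V.T × V'.T, (c p.1 * c' p.2) • (F p.1 * F' p.2) := fun c c' => by
    rw [Finset.sum_mul_sum, Fintype.sum_prod_type]
    simp only [smul_mul_smul_comm]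
  have htp : ∀ᶠ s in atTop, twistedProduct (w s) (resOrbit ξ F₁) (resOrbit ξ F₂) =
      w s (quantMap (R s) (∑ L, C s L • F L) * quantMap (R s) (∑ L, C' s L • F' L)) ∧
      twistedProduct (w s) (resOrbit ξ F₂) (resOrbit ξ F₁) =
      w s (quantMap (R s) (∑ L, C' s L • F' L) * quantMap (R s) (∑ L, C s L • F L)) := by
    filter_upwards [hev, hev'] with s hs hs'
    obtain ⟨ω, hws⟩ := hw s
    rw [← twistedProduct_apply hws, ← twistedProduct_apply hws, hs, hs']
    exact ⟨rfl, rfl⟩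
  constructor
  · rw [← h1, ← h2, ← map_mul, hmul]
    refine (tendsto_quantMap_sum (fun _ => hS _) hCC).congr' ?_
    filter_upwards [htp] with s hs
    rw [← h1, ← h2] at hs
    rw [hs.1, ← hmul, map_mul]
  · choose b hb hbs using fun p : V.T × V'.T => hasPoissonComm (F p.1) (F' p.2)
    have e : classMap ξ (∑ p : V.T × V'.T, (C₀ p.1 * C₀' p.2) • b p) =
        Complex.I • resOrbit ξ (poissonBracket F₁ F₂) := by
      -- The symbols of the limits agree with `F₁` and `F₂` only on the orbit, which suffices for
      -- the restricted bracket.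
      rw [← resOrbit_poissonBracket_congr hξ (F := symbolMap (∑ L, C₀ L • F L))
        (G := symbolMap (∑ L, C₀' L • F' L)) h1 h2, classMap_apply]
      simp only [map_sum, map_smul, hbs]
      rw [poissonBracket_sum_smul, ← resHom_apply, ← resHom_apply, ← map_smul, Finset.smul_sum]
      exact congrArg _ (Finset.sum_congr rfl fun p _ => smul_comm _ _ _)
    rw [← map_smul, ← e]
    refine (tendsto_quantMap_sum (fun _ => hS _) hCC).congr' ?_
    filter_upwards [htp] with s hs
    rw [hs.1, hs.2, ← map_sub, ← map_sub, ← map_smul, ← map_smul]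
    congr 2
    rw [map_sum]
    simp only [map_smul, ← hb _ _ (hR s)]
    rw [map_sum, map_sum]
    simp only [map_smul]
    rw [Finset.sum_mul_sum, Finset.sum_mul_sum, Finset.sum_comm (γ := V'.T), ← Finset.sum_sub_distrib,
      Finset.smul_sum, Fintype.sum_prod_type]
    refine Finset.sum_congr rfl fun L _ => ?_
    rw [← Finset.sum_sub_distrib, Finset.smul_sum]
    refine Finset.sum_congr rfl fun L' _ => ?_
    rw [smul_mul_smul_comm, smul_mul_smul_comm, mul_comm (C' s L'), ← smul_sub, smul_comm]

end ray

/-! ### Properties of a single universal correspondence -/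

section correspondence
variable {ω ξ : Mat3} {w : USL3 →ₗ[ℂ] PolyOrbit ξ}

/-- The symbol of the identity operator is invariant, hence constant on the orbit, and normalization
fixes the constant. The highest weight vector guarantees a nonzero dimension. -/
theorem IsUniversalCorrespondence.map_one (hw : IsUniversalCorrespondence ω ξ w) : w 1 = 1 := by
  obtain ⟨Q, W, hW, h⟩ := hw
  have hdim : (Q.dim : ℂ) ≠ 0 := by
    obtain ⟨v, hv, -⟩ := Q.highest_weight
    intro h0
    have h0' : Q.dim = 0 := by exact_mod_cast h0
    have : IsEmpty (Fin Q.dim) := by rw [h0']; infer_instance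
    exact hv (Subsingleton.elim _ _)
  have hinv : ∀ (g : SU3) (x : adOrbit ξ), (W 1).1 (adOn g x) = (W 1).1 x := fun g x => by
    have := hW.equivariant g 1 x
    rwa [mul_one, rep_mul_inv] at this
  have hbase : (W 1).1 (basePoint ξ) = 1 := by
    have := hW.normalized 1
    simp only [hinv] at this
    rw [Matrix.trace_one, Fintype.card_fin, div_self hdim] at this
    simpa using this
  rw [h, _root_.map_one]
  refine Subtype.ext (funext fun x => ?_)
  obtain ⟨g, rfl⟩ := exists_adOn_basePoint x
  rw [hinv, hbase]
  rfl

theorem IsUniversalCorrespondence.lie_apply (hw : IsUniversalCorrespondence ω ξ w)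
    (hξ : ξ.trace = 0) (k : Fin 8) {u : USL3} {F : PolySU3} (hF : w u = resOrbit ξ F) :
    w (UniversalEnvelopingAlgebra.ι ℂ (suLie k) * u - u * UniversalEnvelopingAlgebra.ι ℂ (suLie k)) =
      -resOrbit ξ (poissonBracket (MvPolynomial.X k) F) := by
  obtain ⟨Q, W, hW, h⟩ := hw
  rw [h] at hF
  rw [h, map_sub, map_mul, map_mul, rho_ι, hW.lie_apply hξ k _ hF]

/-- The range hypotheses are essential here: `Function.invFun` need not be linear, and only on the
image of `w` is the product independent of the chosen preimages. -/
theorem twistedProduct_sum_smul (hw : IsUniversalCorrespondence ω ξ w) {ι ι' : Type*} [Fintype ι]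
    [Fintype ι'] {f : ι → PolyOrbit ξ} {f' : ι' → PolyOrbit ξ} (hf : ∀ i, f i ∈ LinearMap.range w)
    (hf' : ∀ i, f' i ∈ LinearMap.range w) (c : ι → ℂ) (c' : ι' → ℂ) :
    twistedProduct w (∑ i, c i • f i) (∑ j, c' j • f' j) =
      ∑ i, ∑ j, (c i * c' j) • twistedProduct w (f i) (f' j) := by
  choose u hu using hf
  choose u' hu' using hf'
  simp only [← hu, ← hu', ← map_smul, ← map_sum, twistedProduct_apply hw]
  rw [Finset.sum_mul_sum]
  simp only [smul_mul_smul_comm]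

end correspondence

/-- The infinitesimal form of equivariance under the adjoint representation. -/
theorem sum_structConst_mul_equivFam_adj {ξ : Mat3} (hξ : ξ.trace = 0) {θ : Fin 8 → PolyOrbit ξ}
    (hθ : θ ∈ equivFam SU3Rep.adj ξ) {Θ : Fin 8 → PolySU3} (hΘ : ∀ k, resOrbit ξ (Θ k) = θ k)
    (l k : Fin 8) (x : adOrbit ξ) :
    ∑ j, structConst l k j * (θ j).1 x =
      (resOrbit ξ (poissonBracket (Θ k) (MvPolynomial.X l))).1 x := by
  have had : ∀ j, HasDerivAt (fun t : ℝ => adRep (expSU l t) j k) (structConst l k j) 0 :=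
    fun j => by
      have := hasDerivAt_exp_conj ((LinearMap.proj j).comp suCoordLin) (suBasis l) (suBasis k)
      simp only [adRep_apply, adMat, expSU_inv_coe, expSU_coe]
      exact this
  have h0 : expSU l 0 = 1 := by
    apply Subtype.ext
    rw [expSU_coe]
    simp
  have hd : HasDerivAt (fun t : ℝ => ∑ j, adRep (expSU l t) j k * (θ j).1 (adOn (expSU l t) x))
      (∑ j, (structConst l k j * (θ j).1 x + (1 : Matrix (Fin 8) (Fin 8) ℂ) j k *
        -(resOrbit ξ (poissonBracket (Θ j) (MvPolynomial.X l))).1 x)) 0 := by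
    refine HasDerivAt.fun_sum fun j _ => ?_
    have h2 := hasDerivAt_resOrbit hξ (Θ j) l x
    rw [hΘ] at h2
    have := (had j).mul h2
    rw [h0, _root_.map_one, adOn_one] at this
    exact this
  -- Equivariance makes this function of `t` constant; its derivative at `0`, computed in `hd`,
  -- therefore vanishes.
  have hc : (fun t : ℝ => ∑ j, adRep (expSU l t) j k * (θ j).1 (adOn (expSU l t) x)) =
      fun _ => (θ k).1 x := funext fun t => (hθ (expSU l t) x k).symm
  rw [hc] at hd
  have := hd.unique (hasDerivAt_const 0 _)
  rw [Finset.sum_add_distrib] at this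
  simp only [Matrix.one_apply, ite_mul, one_mul, zero_mul, Finset.sum_ite_eq', Finset.mem_univ,
    if_true] at this
  linear_combination this

/-- The factor `1 / r` of the quantized generator `x` cancels the rescaling, leaving a term
independent of `r`. -/
theorem smul_commutator_sub_smul {A : Type*} [Ring A] [Algebra ℂ A] {r : ℂ} (hr : r ≠ 0)
    (a b x : A) : r • ((a - (-(Complex.I / r)) • x) * b - b * (a - (-(Complex.I / r)) • x)) =
      r • (a * b - b * a) - Complex.I • -(x * b - b * x) := by
  have h : r * (Complex.I / r) = Complex.I := mul_div_cancel₀ _ hr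
  simp only [sub_mul, mul_sub, smul_sub, smul_mul_assoc, mul_smul_comm, smul_neg, smul_smul,
    neg_smul, neg_mul, mul_neg, h]
  abel

/-! ### From the Poisson limit to the symbols of quantized polynomials -/

section ray
variable {ξ : Mat3} {w : ℕ → USL3 →ₗ[ℂ] PolyOrbit ξ} {R : ℕ → ℂ}

/-- If the twisted products converge to the pointwise product, then every polynomial function on
the orbit is eventually a symbol. -/
theorem HasPoissonLimit.eventually_mem_range (hw : ∀ s, ∃ ω, IsUniversalCorrespondence ω ξ (w s))
    (hR : ∀ s, R s ≠ 0) (hP : HasPoissonLimit w R) (f : PolyOrbit ξ) :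
    ∀ᶠ s in atTop, f ∈ LinearMap.range (w s) := by
  obtain ⟨t₀, rfl⟩ := classMap_surjective ξ f
  obtain ⟨V, F, hF, c₀, rfl⟩ := exists_freeFam t₀
  let h : equivFam V ξ := ⟨fun K => classMap ξ (F K), (isEquivMap_classMap ξ).mem_equivFam hF⟩
  -- `twistedProduct` takes values in the image of `w s` even when its arguments lie outside it, so
  -- `B ⋆ 1 → B` already gives approximation by symbols.
  have happ : ∀ p : Fin (Module.finrank ℂ (equivFam V ξ)) × V.T, ∃ u : ℕ → FreePoly,
      Tendsto (fun s => toC ξ (w s (quantMap (R s) (u s)))) atTop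
        (𝓝 (toC ξ ((famBasis V ξ p.1).1 p.2))) := fun p => by
    obtain ⟨B, hB⟩ := exists_resOrbit ((famBasis V ξ p.1).1 p.2)
    have h1 := (hP B 1).1
    choose u hu using fun s => quantMap_surjective (hR s)
      (Function.invFun (w s) (resOrbit ξ B) * Function.invFun (w s) (resOrbit ξ 1))
    refine ⟨u, ?_⟩
    simp only [hu, ← hB]
    have h2 : resOrbit ξ B * resOrbit ξ 1 = resOrbit ξ B := by
      rw [← resHom_apply (ξ := ξ) 1, _root_.map_one, mul_one]
    rwa [h2] at h1
  choose u hu using happ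
  -- The auxiliary representation varies with `s`, without control on its size; the averaging
  -- estimate involves only the bound `C` of `V`.
  choose V' F' hF' c hc using fun s => exists_freeFam_finite fun p => u p s
  have hq : ∀ s, (fun L => w s (quantMap (R s) (F' s L))) ∈ equivFam (V' s) ξ := fun s => by
    obtain ⟨ω, hs⟩ := hw s
    exact (isEquivMap_quantMap hs (R s)).mem_equivFam (hF' s)
  let A : ∀ s, Fin (Module.finrank ℂ (equivFam V ξ)) → Matrix (V' s).T V.T ℂ := fun s a =>
    avgMatrix V (V' s) (Matrix.of fun L K => c s (a, K) L)
  obtain ⟨C, -, hC⟩ := V.exists_bound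
  obtain ⟨N, -, hev⟩ := exists_famBasis_eq_sum (V := V) (ξ := ξ)
    (T := fun s a => ⟨fun K => ∑ L, A s a L K • w s (quantMap (R s) (F' s L)),
      sum_avgMatrix_mem _ (hq s)⟩) fun a K => by
    have hε : Tendsto (fun s => C * ∑ K, ‖toC ξ (w s (quantMap (R s) (u (a, K) s))) -
        toC ξ ((famBasis V ξ a).1 K)‖) atTop (𝓝 0) := by
      have h2 := (tendsto_finsetSum Finset.univ fun K _ =>
        tendsto_iff_norm_sub_tendsto_zero.mp (hu (a, K))).const_mul C
      simpa using h2
    rw [tendsto_iff_norm_sub_tendsto_zero]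
    refine squeeze_zero (fun _ => norm_nonneg _) (fun s => ?_) hε
    refine norm_sum_avgMatrix_sub_le hC (Matrix.of fun L K => c s (a, K) L) (hq s)
      (famBasis V ξ a).2 (Finset.sum_nonneg fun _ _ => norm_nonneg _) (fun J => ?_) K (basePoint ξ)
    have e : ∑ L, (Matrix.of fun L K => c s (a, K) L) L J • w s (quantMap (R s) (F' s L)) =
        w s (quantMap (R s) (u (a, J) s)) := by
      rw [hc s (a, J), map_sum, map_sum]
      simp
    rw [e]
    exact Finset.single_le_sum (f := fun J => ‖toC ξ (w s (quantMap (R s) (u (a, J) s))) -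
        toC ξ ((famBasis V ξ a).1 J)‖) (fun _ _ => norm_nonneg _) (Finset.mem_univ J)
  filter_upwards [hev] with s hs
  rw [map_sum]
  refine Submodule.sum_mem _ fun K _ => ?_
  rw [map_smul]
  refine Submodule.smul_mem _ _ ?_
  have e : classMap ξ (F K) = _ := coe_sum_smul_famBasis h K
  rw [e]
  refine Submodule.sum_mem _ fun a _ => Submodule.smul_mem _ _ ?_
  rw [hs a, Submodule.coe_sum, Finset.sum_apply]
  refine Submodule.sum_mem _ fun a' _ => Submodule.smul_mem _ _ ?_
  exact Submodule.sum_mem _ fun L _ => Submodule.smul_mem _ _ ⟨_, rfl⟩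

/-- The coefficient matrix that governs the Poisson brackets of equivariant families with the
coordinates is injective. -/
theorem eq_zero_of_poissonBracket_famBasis (hξ : ξ.trace = 0)
    {B : Fin (Module.finrank ℂ (equivFam SU3Rep.adj ξ)) → Fin 8 → PolySU3}
    (hB : ∀ a k, resOrbit ξ (B a k) = (famBasis SU3Rep.adj ξ a).1 k)
    {t : Fin (Module.finrank ℂ (equivFam SU3Rep.adj ξ)) → ℂ}
    (ht : ∀ k l, ∑ a, t a *
      (resOrbit ξ (poissonBracket (B a k) (MvPolynomial.X l))).1 (basePoint ξ) = 0) : t = 0 := by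
  let θ : equivFam SU3Rep.adj ξ := ∑ a, t a • famBasis SU3Rep.adj ξ a
  have hrepr : ∀ a, (famBasis SU3Rep.adj ξ).repr θ a = t a := fun a =>
    congrFun ((famBasis SU3Rep.adj ξ).repr_sum_self t) a
  have hθ : ∀ k : Fin 8, θ.1 k = ∑ a, t a • (famBasis SU3Rep.adj ξ a).1 k := fun k => by
    simp only [← hrepr]
    exact coe_sum_smul_famBasis θ k
  have hΘ : ∀ k : Fin 8, resOrbit ξ (∑ a, t a • B a k) = θ.1 k := fun k => by
    rw [hθ, ← resHom_apply, map_sum]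
    simp only [map_smul, resHom_apply, hB]
  -- Infinitesimal equivariance converts the vanishing brackets at `ξ` into `∑ c θ_j(ξ) = 0`, and
  -- perfectness gives `θ(ξ) = 0`.
  have h1 : (fun j => (θ.1 j).1 (basePoint ξ)) = (0 : Fin 8 → ℂ) := by
    refine eq_zero_of_forall_structConst _ fun l k => ?_
    rw [sum_structConst_mul_equivFam_adj hξ θ.2 hΘ l k, poissonBracket_sum_left,
      ← resHom_apply, map_sum]
    simp only [poissonBracket_smul_left, map_smul, resHom_apply]
    rw [coe_sum_smul_apply]
    exact ht k l
  have h2 : θ = 0 := evBase_injective (h1.trans (map_zero (evBase SU3Rep.adj ξ)).symm)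
  funext a
  rw [← hrepr, h2, LinearEquiv.map_zero]
  rfl

/-- If the twisted products have the Poisson limit, then the symbols of the generators converge. -/
theorem HasPoissonLimit.quantTendsto_ι (hw : ∀ s, ∃ ω, IsUniversalCorrespondence ω ξ (w s))
    (hξ : ξ.trace = 0) (hR : ∀ s, R s ≠ 0) (hP : HasPoissonLimit w R) (k : Fin 8) :
    QuantTendsto w R (FreeAlgebra.ι ℂ k) := by
  let b := famBasis SU3Rep.adj ξ
  let h₀ : equivFam SU3Rep.adj ξ := ⟨fun k : Fin 8 => classMap ξ (FreeAlgebra.ι ℂ k),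
    (isEquivMap_classMap ξ).mem_equivFam IsFreeFam.adj⟩
  let h : ℕ → equivFam SU3Rep.adj ξ := fun s =>
    ⟨fun k : Fin 8 => w s (quantMap (R s) (FreeAlgebra.ι ℂ k)), by
      obtain ⟨ω, hs⟩ := hw s
      exact (isEquivMap_quantMap hs (R s)).mem_equivFam IsFreeFam.adj⟩
  -- The coordinates of the error family `x_k - w[quantMap R ι_k]`; the aim is `t s → 0`.
  let t : ℕ → Fin (Module.finrank ℂ (equivFam SU3Rep.adj ξ)) → ℂ := fun s => b.repr (h₀ - h s)
  have hθ : ∀ s (k : Fin 8), resOrbit ξ (MvPolynomial.X k) -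
      w s (quantMap (R s) (FreeAlgebra.ι ℂ k)) = ∑ a, t s a • (b a).1 k := fun s k => by
    rw [← symbolMap_ι, ← classMap_apply]
    exact coe_sum_smul_famBasis (h₀ - h s) k
  choose B hB using fun a (k : Fin 8) => exists_resOrbit ((b a).1 k)
  let comm : ℕ → PolyOrbit ξ → PolyOrbit ξ → PolyOrbit ξ := fun s f g =>
    twistedProduct (w s) f g - twistedProduct (w s) g f
  have hcomm : ∀ F G : PolySU3, Tendsto
      (fun s => (R s • comm s (resOrbit ξ F) (resOrbit ξ G)).1 (basePoint ξ)) atTop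
      (𝓝 (Complex.I * (resOrbit ξ (poissonBracket F G)).1 (basePoint ξ))) := fun F G =>
    ((continuous_eval_const (F := C(adOrbit ξ, ℂ)) (basePoint ξ)).tendsto _).comp (hP F G).2
  let v : ℕ → Matrix (Fin 8 × Fin 8) (Fin (Module.finrank ℂ (equivFam SU3Rep.adj ξ))) ℂ := fun s =>
    Matrix.of fun p a => (R s • comm s (resOrbit ξ (B a p.1))
      (resOrbit ξ (MvPolynomial.X p.2))).1 (basePoint ξ)
  let v₀ : Matrix (Fin 8 × Fin 8) (Fin (Module.finrank ℂ (equivFam SU3Rep.adj ξ))) ℂ :=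
    Matrix.of fun p a => Complex.I *
      (resOrbit ξ (poissonBracket (B a p.1) (MvPolynomial.X p.2))).1 (basePoint ξ)
  have hv : Tendsto v atTop (𝓝 v₀) :=
    tendsto_pi_nhds.mpr fun p => tendsto_pi_nhds.mpr fun a => hcomm _ _
  have hinj : ∀ t, v₀ *ᵥ t = 0 → t = 0 := fun t ht => by
    refine eq_zero_of_poissonBracket_famBasis hξ hB fun k l => ?_
    have h1 : ∑ a, Complex.I * (resOrbit ξ (poissonBracket (B a k) (MvPolynomial.X l))).1
        (basePoint ξ) * t a = 0 := congrFun ht (k, l)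
    refine mul_left_cancel₀ Complex.I_ne_zero ?_
    rw [mul_zero, ← h1, Finset.mul_sum]
    exact Finset.sum_congr rfl fun a _ => by ring
  have hmem : ∀ᶠ s in atTop, (∀ a k, resOrbit ξ (B a k) ∈ LinearMap.range (w s)) ∧
      ∀ l, resOrbit ξ (MvPolynomial.X l) ∈ LinearMap.range (w s) := by
    refine Filter.Eventually.and ?_ ?_
    · exact eventually_all.mpr fun a => eventually_all.mpr fun k =>
        hP.eventually_mem_range hw hR _
    · exact eventually_all.mpr fun l => hP.eventually_mem_range hw hR _
  -- The vector `v s *ᵥ t s` collects the rescaled commutators of the errors with the coordinates.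
  -- By `e1` and `e2` its entries are eventually `R [x_p, x_l]_⋆ - i {x_p, x_l}` at `ξ`, which tends
  -- to `0` by hypothesis.
  have hvt : Tendsto (fun s => v s *ᵥ t s) atTop (𝓝 0) := by
    refine tendsto_pi_nhds.mpr fun p => ?_
    have h1 := (hcomm (MvPolynomial.X p.1) (MvPolynomial.X p.2)).sub_const
      (Complex.I * (resOrbit ξ (poissonBracket (MvPolynomial.X p.1)
        (MvPolynomial.X p.2))).1 (basePoint ξ))
    rw [sub_self] at h1
    refine h1.congr' ?_
    filter_upwards [hmem] with s hs
    obtain ⟨ω, hws⟩ := hw s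
    choose u hu using hs.1
    choose u' hu' using hs.2
    have hc : ∀ x y, comm s (w s x) (w s y) = w s (x * y - y * x) := fun x y => by
      simp only [comm]
      rw [twistedProduct_apply hws, twistedProduct_apply hws, map_sub]
    have e1 : ∑ a, t s a • comm s (resOrbit ξ (B a p.1)) (resOrbit ξ (MvPolynomial.X p.2)) =
        comm s (resOrbit ξ (MvPolynomial.X p.1) - w s (quantMap (R s) (FreeAlgebra.ι ℂ p.1)))
          (resOrbit ξ (MvPolynomial.X p.2)) := by
      rw [hθ]
      simp only [← hB, ← hu, ← hu', hc, ← map_smul, ← map_sum]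
      rw [Finset.sum_mul, Finset.mul_sum, ← Finset.sum_sub_distrib]
      simp only [smul_sub, smul_mul_assoc, mul_smul_comm]
    have e2 : R s • comm s (resOrbit ξ (MvPolynomial.X p.1) -
          w s (quantMap (R s) (FreeAlgebra.ι ℂ p.1))) (resOrbit ξ (MvPolynomial.X p.2)) =
        R s • comm s (resOrbit ξ (MvPolynomial.X p.1)) (resOrbit ξ (MvPolynomial.X p.2)) -
          Complex.I • resOrbit ξ (poissonBracket (MvPolynomial.X p.1) (MvPolynomial.X p.2)) := by
      -- The commutator with a quantized generator is exact for each `s`, by equivariance; no limit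
      -- is taken here.
      have e3 := hws.lie_apply hξ p.1 (hu' p.2)
      have e4 : resOrbit ξ (poissonBracket (MvPolynomial.X p.1) (MvPolynomial.X p.2)) =
          -w s (UniversalEnvelopingAlgebra.ι ℂ (suLie p.1) * u' p.2 -
            u' p.2 * UniversalEnvelopingAlgebra.ι ℂ (suLie p.1)) := by rw [e3, neg_neg]
      rw [e4, ← hu', ← hu', ← map_sub, hc, hc, quantMap_ι, ← (w s).map_neg,
        ← (w s).map_smul, ← (w s).map_smul, ← (w s).map_smul, ← (w s).map_sub]
      congr 1
      exact smul_commutator_sub_smul (hR s) _ _ _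
    have e6 := congrArg (fun f : PolyOrbit ξ => f.1 (basePoint ξ)) ((congrArg (R s • ·) e1).trans e2)
    refine (e6.symm.trans ?_ : _ = _)
    change (R s • ∑ a, t s a • comm s (resOrbit ξ (B a p.1))
      (resOrbit ξ (MvPolynomial.X p.2)) : PolyOrbit ξ).1 _ = ∑ a, v s p a * t s a
    rw [Finset.smul_sum]
    simp only [smul_comm (R s) (t s _)]
    rw [coe_sum_smul_apply]
    exact Finset.sum_congr rfl fun a _ => mul_comm _ _
  have ht := tendsto_zero_of_tendsto_mulVec hv hinj hvt
  have h1 : Tendsto (fun s => toC ξ (∑ a, t s a • (b a).1 k)) atTop (𝓝 0) := by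
    have h2 : Tendsto (fun s => ∑ a, t s a • toC ξ ((b a).1 k)) atTop
        (𝓝 (∑ a, (0 : ℂ) • toC ξ ((b a).1 k))) :=
      tendsto_finsetSum _ fun a _ => (tendsto_pi_nhds.mp ht a).smul tendsto_const_nhds
    simpa using h2
  have h3 := (tendsto_const_nhds (x := toC ξ (resOrbit ξ (MvPolynomial.X k)))).sub h1
  rw [sub_zero] at h3
  rw [QuantTendsto, classMap_apply, symbolMap_ι]
  refine h3.congr fun s => ?_
  rw [← hθ, ← map_sub, sub_sub_cancel]

/-- The hypothesis controls twisted products of fixed functions only, while the symbols to be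
multiplied vary with `s`. Equivariance confines them to the span of finitely many fixed functions
with convergent coefficients, and bilinearity does the rest. -/
theorem HasPoissonLimit.quantTendsto_mul (hw : ∀ s, ∃ ω, IsUniversalCorrespondence ω ξ (w s))
    (hR : ∀ s, R s ≠ 0) (hP : HasPoissonLimit w R) {V V' : SU3Rep} {F : V.T → FreePoly}
    {F' : V'.T → FreePoly} (hF : IsFreeFam V F) (hF' : IsFreeFam V' F')
    (hS : ∀ K, QuantTendsto w R (F K)) (hS' : ∀ K, QuantTendsto w R (F' K)) (K : V.T) (K' : V'.T) :
    QuantTendsto w R (F K * F' K') := by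
  have hq : ∀ (V : SU3Rep) (F : V.T → FreePoly), IsFreeFam V F → ∀ s,
      (fun L => w s (quantMap (R s) (F L))) ∈ equivFam V ξ := fun V F hF s => by
    obtain ⟨ω, hs⟩ := hw s
    exact (isEquivMap_quantMap hs (R s)).mem_equivFam hF
  have hlim : ∀ (V : SU3Rep) (F : V.T → FreePoly) (hF : IsFreeFam V F),
      (∀ K, QuantTendsto w R (F K)) → ∀ a,
      Tendsto (fun s => (famBasis V ξ).repr ⟨_, hq V F hF s⟩ a) atTop
        (𝓝 ((famBasis V ξ).repr ⟨_, (isEquivMap_classMap ξ).mem_equivFam hF⟩ a)) :=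
    fun V F hF hS a => tendsto_famBasis_repr (fun K =>
      ((continuous_eval_const (F := C(adOrbit ξ, ℂ)) (basePoint ξ)).tendsto _).comp (hS K)) a
  have hb : ∀ a a', Tendsto (fun s => toC ξ (twistedProduct (w s) ((famBasis V ξ a).1 K)
      ((famBasis V' ξ a').1 K'))) atTop
      (𝓝 (toC ξ ((famBasis V ξ a).1 K * (famBasis V' ξ a').1 K'))) := fun a a' => by
    obtain ⟨B, hB⟩ := exists_resOrbit ((famBasis V ξ a).1 K)
    obtain ⟨B', hB'⟩ := exists_resOrbit ((famBasis V' ξ a').1 K')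
    rw [← hB, ← hB']
    exact (hP B B').1
  have hsum := tendsto_finsetSum Finset.univ fun a _ => tendsto_finsetSum Finset.univ fun a' _ =>
    ((hlim V F hF hS a).mul (hlim V' F' hF' hS' a')).smul (hb a a')
  have e₀ : classMap ξ (F K * F' K') = ∑ a, ∑ a',
      ((famBasis V ξ).repr ⟨_, (isEquivMap_classMap ξ).mem_equivFam hF⟩ a *
        (famBasis V' ξ).repr ⟨_, (isEquivMap_classMap ξ).mem_equivFam hF'⟩ a') •
      ((famBasis V ξ a).1 K * (famBasis V' ξ a').1 K') := by
    have e1 : classMap ξ (F K) = _ :=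
      coe_sum_smul_famBasis ⟨_, (isEquivMap_classMap ξ).mem_equivFam hF⟩ K
    have e2 : classMap ξ (F' K') = _ :=
      coe_sum_smul_famBasis ⟨_, (isEquivMap_classMap ξ).mem_equivFam hF'⟩ K'
    rw [map_mul, e1, e2, Finset.sum_mul_sum]
    simp only [smul_mul_smul_comm]
  change Tendsto _ _ _
  rw [e₀, map_sum]
  simp only [map_sum, map_smul]
  refine hsum.congr' ?_
  have hmem : ∀ᶠ s in atTop, (∀ a, (famBasis V ξ a).1 K ∈ LinearMap.range (w s)) ∧
      ∀ a', (famBasis V' ξ a').1 K' ∈ LinearMap.range (w s) :=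
    (eventually_all.mpr fun a => hP.eventually_mem_range hw hR _).and
      (eventually_all.mpr fun a => hP.eventually_mem_range hw hR _)
  filter_upwards [hmem] with s hs
  obtain ⟨ω, hws⟩ := hw s
  have e1 : w s (quantMap (R s) (F K)) = _ := coe_sum_smul_famBasis ⟨_, hq V F hF s⟩ K
  have e2 : w s (quantMap (R s) (F' K')) = _ := coe_sum_smul_famBasis ⟨_, hq V' F' hF' s⟩ K'
  rw [map_mul, ← twistedProduct_apply hws, e1, e2, twistedProduct_sum_smul hws hs.1 hs.2]
  simp only [map_sum, map_smul]

/-- If the twisted products have the Poisson limit, then the symbols of all quantizations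
converge. -/
theorem HasPoissonLimit.quantTendsto (hw : ∀ s, ∃ ω, IsUniversalCorrespondence ω ξ (w s))
    (hξ : ξ.trace = 0) (hR : ∀ s, R s ≠ 0) (hP : HasPoissonLimit w R) (t : FreePoly) :
    QuantTendsto w R t := by
  have h1 : QuantTendsto w R 1 := by
    refine tendsto_const_nhds.congr fun s => ?_
    obtain ⟨ω, hs⟩ := hw s
    rw [_root_.map_one (quantMap (R s)), hs.map_one, _root_.map_one (classMap ξ)]
  -- Closure under products is available for members of equivariant families, not for single
  -- polynomials, hence this form of induction.
  obtain ⟨V, F, -, hF, ht⟩ := exists_freeFam_subset {t | QuantTendsto w R t} h1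
    (hP.quantTendsto_ι hw hξ hR)
    (fun _ _ _ _ hF hF' hS hS' => hP.quantTendsto_mul hw hR hF hF' hS hS') t
  obtain ⟨c, rfl⟩ := (Submodule.mem_span_range_iff_exists_fun ℂ).mp ht
  exact tendsto_quantMap_sum hF fun _ => tendsto_const_nhds

end ray

/-! ## Asymptotics of the symbols of elements of the enveloping algebra -/

/-- The sign comes from `tr (E_j E_k) = -δ_jk`, and is the reason why `(-i)^d` appears in the limit
formula. -/
theorem linPoly_eq_neg_sum (Y : Mat3) :
    linPoly Y = -∑ k, suCoord Y k • (MvPolynomial.X k : PolySU3) := by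
  rw [linPoly, ← Finset.sum_neg_distrib]
  refine Finset.sum_congr rfl fun k _ => ?_
  rw [suCoord_eq, Matrix.trace_mul_comm, neg_smul, neg_neg, MvPolynomial.smul_eq_C_mul]

theorem linPoly_sum_smul {ι : Type*} (s : Finset ι) (c : ι → ℂ) (Y : ι → Mat3) :
    linPoly (∑ i ∈ s, c i • Y i) = ∑ i ∈ s, c i • linPoly (Y i) := by
  simp only [linPoly, Finset.sum_mul, Matrix.trace_sum, Matrix.smul_mul, Matrix.trace_smul,
    map_sum, Finset.smul_sum, MvPolynomial.smul_eq_C_mul, smul_eq_mul, map_mul]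
  rw [Finset.sum_comm]
  simp only [mul_assoc]

theorem aeval_linPoly_lieLinPoly (Y : SL3Lie) :
    MvPolynomial.aeval (fun j => linPoly (gtMatrix j)) (lieLinPoly Y) = linPoly Y := by
  conv_rhs => rw [← sum_gtCoord Y Y.2, linPoly_sum_smul]
  simp [lieLinPoly]

/-- The noncommutative polynomial of degree one given by an element of `sl(3)`. -/
def freeLin (Y : SL3Lie) : FreePoly := ∑ k, suCoord Y k • FreeAlgebra.ι ℂ k

theorem freeLin_suLie (k : Fin 8) : freeLin (suLie k) = FreeAlgebra.ι ℂ k := by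
  rw [freeLin, Finset.sum_eq_single k]
  · change suCoord (suBasis k) k • _ = _
    simp [suCoord_suBasis]
  · intro j _ hj
    change suCoord (suBasis k) j • _ = _
    simp [suCoord_suBasis, hj]
  · simp

theorem quantMap_freeLin (R : ℂ) (Y : SL3Lie) :
    quantMap R (freeLin Y) = (-(Complex.I / R)) • UniversalEnvelopingAlgebra.ι ℂ Y := by
  conv_rhs => rw [← sum_suCoord_lie Y, map_sum, Finset.smul_sum]
  rw [freeLin, map_sum]
  refine Finset.sum_congr rfl fun k _ => ?_
  rw [map_smul, map_smul, quantMap_ι, smul_comm]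

theorem symbolMap_freeLin (Y : SL3Lie) : symbolMap (freeLin Y) = -linPoly Y := by
  rw [linPoly_eq_neg_sum, neg_neg, freeLin, map_sum]
  simp only [map_smul, symbolMap_ι]

theorem quantMap_freeLin_prod (R : ℂ) (l : List SL3Lie) :
    quantMap R (l.map freeLin).prod = (-(Complex.I / R)) ^ l.length •
      (l.map fun Y => UniversalEnvelopingAlgebra.ι ℂ Y).prod := by
  induction l with
  | nil => simp
  | cons Y l ih =>
    rw [List.map_cons, List.prod_cons, map_mul, ih, quantMap_freeLin, List.map_cons, List.prod_cons,
      List.length_cons, smul_mul_smul_comm, pow_succ']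

theorem symbolMap_freeLin_prod (l : List SL3Lie) :
    symbolMap (l.map freeLin).prod = (-1 : ℂ) ^ l.length •
      (l.map fun Y : SL3Lie => linPoly Y).prod := by
  induction l with
  | nil => simp
  | cons Y l ih =>
    rw [List.map_cons, List.prod_cons, map_mul, ih, symbolMap_freeLin, List.map_cons, List.prod_cons,
      List.length_cons, pow_succ', ← smul_mul_smul_comm, neg_one_smul]

theorem aeval_linPoly_monomial (m : Fin 8 →₀ ℕ) :
    MvPolynomial.aeval (fun j => linPoly (gtMatrix j)) (MvPolynomial.monomial m (1 : ℂ)) =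
      (((orderedWord m).map gtBasis).map fun Y : SL3Lie => linPoly Y).prod := by
  have h : ∀ l : List (Fin 8), MvPolynomial.aeval (fun j => linPoly (gtMatrix j))
      (MvPolynomial.monomial (wordExp l) (1 : ℂ)) =
      ((l.map gtBasis).map fun Y : SL3Lie => linPoly Y).prod := fun l => by
    induction l with
    | nil => simp [wordExp]
    | cons j l ih =>
      rw [List.map_cons, List.map_cons, List.prod_cons, ← ih, wordExp_cons,
        ← one_mul (1 : ℂ), ← MvPolynomial.monomial_mul, map_mul, one_mul]
      congr 1
      rw [← MvPolynomial.X, MvPolynomial.aeval_X]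
      rfl
  rw [← h, wordExp_orderedWord]

/-! ### Leading terms versus quantized words -/

section ray
variable {ξ : Mat3} (w : ℕ → USL3 →ₗ[ℂ] PolyOrbit ξ) (R : ℕ → ℂ)

/-- The rescaled symbols of `u` converge to the classical function given by its leading part. -/
def LeadingTendsto (u : USL3) : Prop :=
  Tendsto (fun s => (R s ^ Udeg u)⁻¹ • toC ξ (w s u)) atTop
    (𝓝 ((-Complex.I) ^ Udeg u • toC ξ (resOrbit ξ (betaHom (Udeg u) u))))

variable {w R}

theorem tendsto_inv_pow_mul_pow (hR : ∀ s, R s ≠ 0)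
    (hR0 : Tendsto (fun s => (R s)⁻¹) atTop (𝓝 0)) {e d : ℕ} (h : e < d) :
    Tendsto (fun s => (R s ^ d)⁻¹ * R s ^ e) atTop (𝓝 0) := by
  have h1 := hR0.pow (d - e)
  rw [zero_pow (Nat.sub_ne_zero_of_lt h)] at h1
  refine h1.congr fun s => ?_
  obtain ⟨n, rfl⟩ := Nat.exists_eq_add_of_le h.le
  rw [Nat.add_sub_cancel_left, pow_add, inv_pow]
  have := hR s
  field_simp

/-- An ordered monomial of degree `n` is `(iR)^n` times the quantization of a word whose symbol is
`(-1)^n` times the product of the linear forms. This gives `(-i)^n` when `n = d`, and a vanishing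
factor `R^(n-d)` when `n < d`. -/
theorem tendsto_pbwMonomial (hR : ∀ s, R s ≠ 0)
    (hR0 : Tendsto (fun s => (R s)⁻¹) atTop (𝓝 0)) (hS : ∀ t, QuantTendsto w R t)
    (m : Fin 8 →₀ ℕ) {d : ℕ} (h : m.degree ≤ d) :
    Tendsto (fun s => (R s ^ d)⁻¹ • toC ξ (w s (pbwMonomial m))) atTop
      (𝓝 (if m.degree = d then (-Complex.I) ^ d • toC ξ (resOrbit ξ
        (MvPolynomial.aeval (fun j => linPoly (gtMatrix j)) (MvPolynomial.monomial m (1 : ℂ))))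
        else 0)) := by
  set l := (orderedWord m).map gtBasis with hl
  have hlen : l.length = m.degree := by
    rw [hl, List.length_map, ← degree_wordExp, wordExp_orderedWord]
  have hw' : ∀ s, pbwMonomial m =
      (Complex.I * R s) ^ m.degree • quantMap (R s) (l.map freeLin).prod := fun s => by
    rw [quantMap_freeLin_prod, hlen, smul_smul, ← mul_pow, I_mul_neg_I_div (hR s), one_pow, one_smul,
      ← wordProd_orderedWord, wordProd, hl, List.map_map]
    rfl
  have hq := hS (l.map freeLin).prod
  rw [QuantTendsto, classMap_apply, symbolMap_freeLin_prod, ← aeval_linPoly_monomial, hlen,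
    ← resHom_apply, map_smul, map_smul, resHom_apply] at hq
  have e : ∀ s, (R s ^ d)⁻¹ • toC ξ (w s (pbwMonomial m)) =
      (((R s ^ d)⁻¹ * R s ^ m.degree) * Complex.I ^ m.degree) •
        toC ξ (w s (quantMap (R s) (l.map freeLin).prod)) := fun s => by
    conv_lhs => rw [hw' s]
    rw [map_smul, map_smul, smul_smul, mul_pow]
    ring_nf
  simp only [e]
  split_ifs with hd
  · subst hd
    have h1 : ∀ s, (R s ^ m.degree)⁻¹ * R s ^ m.degree = 1 := fun s =>
      inv_mul_cancel₀ (pow_ne_zero _ (hR s))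
    simp only [h1, one_mul]
    have h2 := hq.const_smul (Complex.I ^ m.degree)
    rw [smul_smul, ← mul_pow, mul_neg_one] at h2
    exact h2
  · have h2 := ((tendsto_inv_pow_mul_pow hR hR0 (lt_of_le_of_ne h hd)).mul_const
      (Complex.I ^ m.degree)).smul hq
    rw [zero_mul, zero_smul] at h2
    exact h2

theorem leadingTendsto_of_quantTendsto (hR : ∀ s, R s ≠ 0)
    (hR0 : Tendsto (fun s => (R s)⁻¹) atTop (𝓝 0)) (hS : ∀ t, QuantTendsto w R t) (u : USL3) :
    LeadingTendsto w R u := by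
  obtain ⟨p, rfl⟩ := pbwMap_surjective u
  rw [LeadingTendsto, Udeg_pbwMap, betaHom_pbwMap]
  set d := p.totalDegree
  have hp : pbwMap p = ∑ m ∈ p.support, p.coeff m • pbwMonomial m := by
    conv_lhs => rw [p.as_sum, map_sum]
    simp only [pbwMap_monomial]
  have hlim := tendsto_finsetSum p.support fun m hm =>
    (tendsto_pbwMonomial hR hR0 hS m (MvPolynomial.le_totalDegree hm)).const_smul (p.coeff m)
  have e₀ : (-Complex.I) ^ d • toC ξ (resOrbit ξ (MvPolynomial.aeval
      (fun j => linPoly (gtMatrix j)) (MvPolynomial.homogeneousComponent d p))) =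
      ∑ m ∈ p.support, p.coeff m • if m.degree = d then (-Complex.I) ^ d • toC ξ (resOrbit ξ
        (MvPolynomial.aeval (fun j => linPoly (gtMatrix j)) (MvPolynomial.monomial m (1 : ℂ))))
        else 0 := by
    rw [MvPolynomial.homogeneousComponent_apply, map_sum, ← resHom_apply, map_sum, map_sum,
      Finset.smul_sum, Finset.sum_filter]
    refine Finset.sum_congr rfl fun m _ => ?_
    split_ifs with hm
    · rw [← mul_one (p.coeff m), ← smul_eq_mul, ← MvPolynomial.smul_monomial, map_smul, map_smul,
        map_smul, smul_comm, smul_eq_mul, mul_one, resHom_apply]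
    · rw [smul_zero]
  rw [e₀]
  refine hlim.congr fun s => ?_
  rw [hp, map_sum, map_sum, Finset.smul_sum]
  refine Finset.sum_congr rfl fun m _ => ?_
  rw [map_smul, map_smul, smul_comm]

/-- Allows any upper bound `n` in place of the exact degree: when the degree is smaller, extra
powers of `R⁻¹` force the limit `0`, and the component of degree `n` vanishes as well. -/
theorem tendsto_pbwMap_of_leadingTendsto (hR : ∀ s, R s ≠ 0)
    (hR0 : Tendsto (fun s => (R s)⁻¹) atTop (𝓝 0)) (hL : ∀ u, LeadingTendsto w R u)
    (p : MvPolynomial (Fin 8) ℂ) {n : ℕ} (hn : p.totalDegree ≤ n) :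
    Tendsto (fun s => (R s ^ n)⁻¹ • toC ξ (w s (pbwMap p))) atTop
      (𝓝 ((-Complex.I) ^ n • toC ξ (resOrbit ξ (MvPolynomial.aeval
        (fun j => linPoly (gtMatrix j)) (MvPolynomial.homogeneousComponent n p))))) := by
  have h := hL (pbwMap p)
  rw [LeadingTendsto, Udeg_pbwMap, betaHom_pbwMap] at h
  rcases hn.eq_or_lt with rfl | hlt
  · exact h
  · rw [MvPolynomial.homogeneousComponent_eq_zero _ _ hlt, map_zero, ← resHom_apply, map_zero,
      map_zero, smul_zero]
    have h1 := (tendsto_inv_pow_mul_pow hR hR0 hlt).smul h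
    rw [zero_smul] at h1
    refine h1.congr fun s => ?_
    rw [smul_smul, mul_assoc, mul_inv_cancel₀ (pow_ne_zero _ (hR s)), mul_one]

/-- A word equals `pbwMap (P + q)` with `P` the commutative product of its letters and `q` of lower
degree, invisible in the component of degree `l.length`. Only an upper bound for the degree is at
hand, since `P` is zero if a letter is. -/
theorem quantTendsto_word (hR : ∀ s, R s ≠ 0)
    (hR0 : Tendsto (fun s => (R s)⁻¹) atTop (𝓝 0)) (hL : ∀ u, LeadingTendsto w R u)
    (l : List SL3Lie) : QuantTendsto w R (l.map freeLin).prod := by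
  obtain ⟨q, hq, hqn⟩ := exists_pbwMap_of_mem_Ult (prod_ι_sub_pbwMap_mem l)
  set P := (l.map fun X : SL3Lie => lieLinPoly X).prod with hP
  have hhom : P.IsHomogeneous l.length := lieLinPoly_prod_isHomogeneous l
  have hq0 : MvPolynomial.homogeneousComponent l.length q = 0 := by
    rw [MvPolynomial.homogeneousComponent_apply]
    refine Finset.sum_eq_zero fun m hm => ?_
    rw [Finset.mem_filter] at hm
    exact absurd hm.2 (hqn m hm.1).ne
  have hdeg : (P + q).totalDegree ≤ l.length := by
    refine (MvPolynomial.totalDegree_add _ _).trans (max_le hhom.totalDegree_le ?_)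
    exact Finset.sup_le fun m hm => (hqn m hm).le
  have hu : (l.map fun X => UniversalEnvelopingAlgebra.ι ℂ X).prod = pbwMap (P + q) := by
    rw [map_add, hq]
    abel
  have h1 := tendsto_pbwMap_of_leadingTendsto hR hR0 hL (P + q) hdeg
  have haev : MvPolynomial.aeval (fun j => linPoly (gtMatrix j)) P =
      (l.map fun Y : SL3Lie => linPoly Y).prod := by
    rw [hP, map_list_prod, List.map_map]
    congr 1
    exact List.map_congr_left fun Y _ => aeval_linPoly_lieLinPoly Y
  rw [map_add (MvPolynomial.homogeneousComponent l.length), hq0, add_zero,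
    MvPolynomial.homogeneousComponent_of_mem hhom, if_pos rfl, haev] at h1
  have h2 := h1.const_smul ((-Complex.I) ^ l.length)
  rw [smul_smul, ← mul_pow, neg_mul_neg, Complex.I_mul_I] at h2
  rw [QuantTendsto, classMap_apply, symbolMap_freeLin_prod, ← resHom_apply, map_smul, map_smul,
    resHom_apply]
  refine h2.congr fun s => ?_
  rw [quantMap_freeLin_prod, hu, map_smul, map_smul, smul_smul]
  congr 1
  rw [← inv_pow, ← mul_pow, neg_div', div_eq_mul_inv]

theorem quantTendsto_of_leadingTendsto (hR : ∀ s, R s ≠ 0)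
    (hR0 : Tendsto (fun s => (R s)⁻¹) atTop (𝓝 0)) (hL : ∀ u, LeadingTendsto w R u)
    (t : FreePoly) : QuantTendsto w R t := by
  have ht : t ∈ Algebra.adjoin ℂ (Set.range (FreeAlgebra.ι ℂ : Fin 8 → FreePoly)) := by
    rw [FreeAlgebra.adjoin_range_ι]
    trivial
  rw [← Subalgebra.mem_toSubmodule, Algebra.adjoin_eq_span] at ht
  induction ht using Submodule.span_induction with
  | mem t ht =>
    obtain ⟨l, hl, rfl⟩ := Submonoid.exists_list_of_mem_closure ht
    have : ∃ l' : List SL3Lie, l = l'.map freeLin := by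
      refine ⟨l.map fun y => suLie (Function.invFun (FreeAlgebra.ι ℂ) y), ?_⟩
      rw [List.map_map]
      refine (List.map_id l).symm.trans (List.map_congr_left fun y hy => ?_)
      rw [Function.comp_apply, freeLin_suLie]
      exact (Function.invFun_eq (hl y hy)).symm
    obtain ⟨l', rfl⟩ := this
    exact quantTendsto_word hR hR0 hL l'
  | zero =>
    simp only [QuantTendsto, map_zero]
    exact tendsto_const_nhds
  | add x y _ _ hx hy =>
    simp only [QuantTendsto, map_add]
    exact hx.add hy
  | smul c x _ hx =>
    simp only [QuantTendsto, map_smul]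
    exact hx.const_smul c

end ray

/-! ## Rational points and the main theorem -/

theorem fundWeight₁_eq : fundWeight₁ =
    Complex.I • Matrix.diagonal ![2 / 3, -1 / 3, -1 / 3] := by
  have h2 : ((Real.sqrt 2 : ℝ) : ℂ) * ((Real.sqrt 2 : ℝ) : ℂ) = 2 := by
    rw [ofReal_sqrt_mul_self (by norm_num)]; norm_num
  have h3 : ((Real.sqrt 3 : ℝ) : ℂ) * ((Real.sqrt 3 : ℝ) : ℂ) = 3 := by
    rw [ofReal_sqrt_mul_self (by norm_num)]; norm_num
  have h6 : ((Real.sqrt 6 : ℝ) : ℂ) = ((Real.sqrt 2 : ℝ) : ℂ) * ((Real.sqrt 3 : ℝ) : ℂ) := by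
    rw [← Complex.ofReal_mul, ← Real.sqrt_mul (by norm_num)]; norm_num
  have hn2 : ((Real.sqrt 2 : ℝ) : ℂ) ≠ 0 := fun h => by simp [h] at h2
  have hn3 : ((Real.sqrt 3 : ℝ) : ℂ) ≠ 0 := fun h => by simp [h] at h3
  ext i j
  fin_cases i <;> fin_cases j <;>
    simp [fundWeight₁, suBasis, gellMann, h6] <;> field_simp <;> simp only [pow_two, h2, h3] <;> ring

theorem fundWeight₂_eq : fundWeight₂ =
    Complex.I • Matrix.diagonal ![1 / 3, 1 / 3, -2 / 3] := by
  have h2 : ((Real.sqrt 2 : ℝ) : ℂ) * ((Real.sqrt 2 : ℝ) : ℂ) = 2 := by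
    rw [ofReal_sqrt_mul_self (by norm_num)]; norm_num
  have h3 : ((Real.sqrt 3 : ℝ) : ℂ) * ((Real.sqrt 3 : ℝ) : ℂ) = 3 := by
    rw [ofReal_sqrt_mul_self (by norm_num)]; norm_num
  have hn2 : ((Real.sqrt 2 : ℝ) : ℂ) ≠ 0 := fun h => by simp [h] at h2
  have hn3 : ((Real.sqrt 3 : ℝ) : ℂ) ≠ 0 := fun h => by simp [h] at h3
  ext i j
  fin_cases i <;> fin_cases j <;>
    simp [fundWeight₂, suBasis, gellMann] <;> field_simp <;> simp only [pow_two, h3]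

theorem smul_fundWeight_add_injective {a b a' b' : ℝ}
    (h : a • fundWeight₁ + b • fundWeight₂ = a' • fundWeight₁ + b' • fundWeight₂) :
    a = a' ∧ b = b' := by
  rw [fundWeight₁_eq, fundWeight₂_eq] at h
  have h0 := congrArg Complex.im (congrFun (congrFun h 0) 0)
  have h1 := congrArg Complex.im (congrFun (congrFun h 1) 1)
  simp at h0 h1
  constructor <;> linarith

theorem trace_eq_zero_of_mem_unitChamber {ξ : Mat3} (hξ : ξ ∈ unitChamber) : ξ.trace = 0 := by
  obtain ⟨x, y, -, -, -, rfl⟩ := hξ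
  simp [fundWeight₁, fundWeight₂, suBasis_trace]

/-- If `R ξ = p ϖ₁ + q ϖ₂`, then `p² + p q + q² = (3/2) R²` is a positive integer, hence at least
`1`. -/
theorem two_thirds_le_sq_of_isDominantWeight {ξ : Mat3} (hξ : ξ ∈ unitChamber) {R : ℝ} (hR : 0 < R)
    (h : IsDominantWeight (R • ξ)) : 2 / 3 ≤ R ^ 2 := by
  obtain ⟨x, y, -, -, hxy, rfl⟩ := hξ
  obtain ⟨p, q, hpq⟩ := h
  rw [smul_smul, smul_add, smul_smul, smul_smul] at hpq
  obtain ⟨hp, hq⟩ := smul_fundWeight_add_injective hpq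
  have hs : Real.sqrt (3 / 2) * Real.sqrt (3 / 2) = 3 / 2 := Real.mul_self_sqrt (by norm_num)
  have e : ((p ^ 2 + p * q + q ^ 2 : ℕ) : ℝ) = 3 / 2 * R ^ 2 := by
    push_cast
    rw [← hp, ← hq]
    linear_combination (R ^ 2 * (x ^ 2 + x * y + y ^ 2)) * hs + (3 / 2 * R ^ 2) * hxy
  have hpos : 0 < p ^ 2 + p * q + q ^ 2 := by
    have : (0 : ℝ) < ((p ^ 2 + p * q + q ^ 2 : ℕ) : ℝ) := by rw [e]; positivity
    exact_mod_cast this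
  have h1 : (1 : ℝ) ≤ ((p ^ 2 + p * q + q ^ 2 : ℕ) : ℝ) := by exact_mod_cast hpos
  linarith

theorem integralRadius_pos {ξ : Mat3} (hξ : ξ ∈ rationalPoints) : 0 < integralRadius ξ := by
  -- Any positive bound below `√(2/3)` would do.
  have h : 1 / 2 ≤ integralRadius ξ := by
    refine le_csInf hξ.2 fun R hR => ?_
    have := two_thirds_le_sq_of_isDominantWeight hξ.1 hR.1 hR.2
    nlinarith [hR.1]
  linarith

theorem tendstoUniformly_iff_tendsto_succ {ξ : Mat3} {f : ℕ → adOrbit ξ → ℂ} {g : adOrbit ξ → ℂ}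
    {f' : ℕ → C(adOrbit ξ, ℂ)} {g' : C(adOrbit ξ, ℂ)} (hf : ∀ s x, f' s x = f (s + 1) x)
    (hg : ∀ x, g' x = g x) : TendstoUniformly f g atTop ↔ Tendsto f' atTop (𝓝 g') := by
  have e : ∀ s, (f' s : adOrbit ξ → ℂ) = f (s + 1) := fun s => funext (hf s)
  rw [ContinuousMap.tendsto_iff_tendstoUniformly, funext hg, funext e]
  refine forall₂_congr fun u _ => ?_
  conv_lhs => rw [← map_add_atTop_eq_nat 1, eventually_map]


/-- A `ξ`-ray of universal correspondences is of Poisson type if and only if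
`(s r(ξ))^{-deg u} w^s[u] → (-i)^{deg u} β_{deg u}[u]|O_ξ` uniformly, for every `u ∈ U(sl(3))`. -/
theorem theorem3p12 (ξ : Mat3) (hξ : ξ ∈ rationalPoints)
    (w : ℕ → USL3 →ₗ[ℂ] PolyOrbit ξ) (hw : IsUniversalRay ξ w) :
    IsPoissonType ξ w ↔
      ∀ u : USL3, TendstoUniformly
        (fun (s : ℕ) (x : adOrbit ξ) =>
          (((s * integralRadius ξ : ℝ) : ℂ) ^ Udeg u)⁻¹ * (w s u).1 x)
        (fun x => (-Complex.I) ^ Udeg u * (resOrbit ξ (betaHom (Udeg u) u)).1 x) atTop := by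
  have hr : integralRadius ξ ≠ 0 := (integralRadius_pos hξ).ne'
  have htr : ξ.trace = 0 := trace_eq_zero_of_mem_unitChamber hξ.1
  -- Shifted by one, so that `R s` is never zero and `w (s + 1)` is a universal correspondence for
  -- every `s`; the limits are unaffected.
  let R : ℕ → ℂ := fun s => (((s + 1 : ℕ) * integralRadius ξ : ℝ) : ℂ)
  have hR : ∀ s, R s ≠ 0 := fun s => by
    simp only [R, ne_eq, Complex.ofReal_eq_zero]
    exact mul_ne_zero (by positivity) hr
  have hR0 : Tendsto (fun s => (R s)⁻¹) atTop (𝓝 0) := by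
    have h1 : Tendsto (fun s : ℕ => ((s + 1 : ℕ) : ℝ) * integralRadius ξ) atTop atTop :=
      (tendsto_natCast_atTop_atTop.comp (tendsto_add_atTop_nat 1)).atTop_mul_const
        (integralRadius_pos hξ)
    have h2 := (Complex.continuous_ofReal.tendsto 0).comp (tendsto_inv_atTop_zero.comp h1)
    simpa [R, Function.comp_def] using h2
  have hw' : ∀ s, ∃ ω, IsUniversalCorrespondence ω ξ (w (s + 1)) := fun s =>
    ⟨_, hw (s + 1) (Nat.le_add_left 1 s)⟩
  have hP : IsPoissonType ξ w ↔ HasPoissonLimit (fun s => w (s + 1)) R :=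
    forall₂_congr fun F₁ F₂ => and_congr
      (tendstoUniformly_iff_tendsto_succ (fun _ _ => rfl) fun _ => rfl)
      (tendstoUniformly_iff_tendsto_succ (fun _ _ => rfl) fun _ => rfl)
  have hL : ∀ u : USL3, TendstoUniformly (fun (s : ℕ) (x : adOrbit ξ) =>
      (((s * integralRadius ξ : ℝ) : ℂ) ^ Udeg u)⁻¹ * (w s u).1 x)
      (fun x => (-Complex.I) ^ Udeg u * (resOrbit ξ (betaHom (Udeg u) u)).1 x) atTop ↔
      LeadingTendsto (fun s => w (s + 1)) R u := fun u =>
    tendstoUniformly_iff_tendsto_succ (fun _ _ => rfl) fun _ => rfl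
  rw [hP, forall_congr' hL]
  constructor
  · exact fun h => leadingTendsto_of_quantTendsto hR hR0 (h.quantTendsto hw' htr hR)
  · exact fun h => hasPoissonLimit_of_quantTendsto hw' htr hR
      (quantTendsto_of_leadingTendsto hR hR0 h)

end
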